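/- Let $\Bbbk$ be a commutative ring (for instance $\mathbb Z$ or a field). For $n\ge 0$ let $$\mathrm{OPol}_n=\Bbbk\langle x_1,\dots,x_n\rangle/(x_ix_j+x_jx_i=0\ \text{ for } i\neq j),$$ a superalgebra with all $x_i$ odd, graded with every $x_i$ in degree one, and a dg algebra with respect to the odd derivation $d$ given by $d(x_i)=x_i^2$, $d(fg)=d(f)g+(-1)^{p(f)}f\,d(g)$. Let $\mathrm{O\Lambda}_n\subseteq\mathrm{OPol}_n$ be the dg subalgebra generated by the odd elementary symmetric polynomials $e_m=\sum_{1\le i_1<\dots<i_m\le n}x_{i_1}\cdots x_{i_m}$, $m\ge 0$. Let $\mathrm{O\Lambda}$ be the inverse limit, in the category of graded algebras, of the dg algebras $\mathrm{O\Lambda}_n$ along the maps $\mathrm{O\Lambda}_{n+1}\to\mathrm{O\Lambda}_n$ with $x_{n+1}\mapsto 0$ and $x_i\mapsto x_i$ for $i\le n$ (that is, $\mathrm{O\Lambda}$ is the direct sum over all degrees of the limits of the homogeneous components), with the induced differential. For a partition $\lambda$ of length $\ell(\lambda)\le n$ the (untwisted) odd Schur polynomial in $n$ variables is $$s_\lambda=w_0\,\theta\,\partial_{w_0}\bigl(\widetilde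 x^{\,\delta}\,\widetilde x^{\,\lambda}\bigr)\in\mathrm{O\Lambda}_n .$$ Here $\theta$ and $w_0$ are the algebra endomorphisms of $\mathrm{OPol}_n$ with $\theta(x_i)=(-1)^{i-1}x_i=:\widetilde x_i$ and $w_0(x_i)=x_{n+1-i}$; $\delta=(n-1,\dots,1,0)$ and $\widetilde x^{\,a}=\widetilde x_1^{\,a_1}\cdots\widetilde x_n^{\,a_n}$; $\partial_{w_0}=\partial_1(\partial_2\partial_1)\cdots(\partial_{n-1}\cdots\partial_1)$, where $\partial_i$ is the $\Bbbk$-linear operator with $\partial_i(x_j)=1$ for $j\in\{i,i+1\}$, $\partial_i(x_j)=0$ otherwise, and $\partial_i(fg)=\partial_i(f)g+(-1)^{p(f)}s_i(f)\partial_i(g)$, with $s_i$ the transposition of the variables $x_i,x_{i+1}$. The odd Schur function $s_\lambda\in\mathrm{O\Lambda}$ is the element whose component in $\mathrm{O\Lambda}_n$ is the odd Schur polynomial $s_\lambda$ if $n\ge\ell(\lambda)$, and $0$ if $n<\ell(\lambda)$. A partition is called a Lima partition if all its parts are even and every value occurs an even number of times among its parts (equivalently, its Young diagram can be subdivided into $2\times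 2$ squares). Then: 1. For every Lima partition $\lambda$ the odd Schur function $s_\lambda\in\mathrm{O\Lambda}$ is a cocycle, and the cohomology $H(\mathrm{O\Lambda})=\ker d/\operatorname{im} d$ is a free $\Bbbk$-module with basis the classes of the $s_\lambda$, $\lambda$ a Lima partition. 2. For every $n\ge 0$ and every Lima partition $\lambda$ with $\ell(\lambda)\le n$ the odd Schur polynomial $s_\lambda\in\mathrm{O\Lambda}_n$ is a cocycle, and the cohomology $H(\mathrm{O\Lambda}_n)$ is a free $\Bbbk$-module with basis the classes of the $s_\lambda$, $\lambda$ a Lima partition with $\ell(\lambda)\le n$. In particular, for $\Bbbk=\mathbb Z$ both cohomology rings are free abelian groups with these bases. -/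

import Mathlib

namespace OddSym

/-! ### Skew polynomials -/

/-- The relations `x_i x_j + x_j x_i = 0` for `i ≠ j`. -/
inductive SkewRel (k : Type*) [CommRing k] (n : ℕ) :
    FreeAlgebra k (Fin n) → FreeAlgebra k (Fin n) → Prop
  | anticomm (i j : Fin n) (h : i ≠ j) :
      SkewRel k n
        (FreeAlgebra.ι k i * FreeAlgebra.ι k j + FreeAlgebra.ι k j * FreeAlgebra.ι k i) 0

/-- The algebra `OPol_n = k⟨x_1, …, x_n⟩ / (x_i x_j + x_j x_i = 0 for i ≠ j)`.
The variables are indexed by `Fin n`, so that `x i` is the variable usually written `x_{i+1}`. -/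
def OPol (k : Type*) [CommRing k] (n : ℕ) : Type _ := RingQuot (SkewRel k n)

instance (k : Type*) [CommRing k] (n : ℕ) : Ring (OPol k n) :=
  inferInstanceAs (Ring (RingQuot (SkewRel k n)))

instance (k : Type*) [CommRing k] (n : ℕ) : Algebra k (OPol k n) :=
  inferInstanceAs (Algebra k (RingQuot (SkewRel k n)))

section OPol

variable {k : Type*} [CommRing k] {n : ℕ}

/-- The quotient map. -/
def mk : FreeAlgebra k (Fin n) →ₐ[k] OPol k n := RingQuot.mkAlgHom k (SkewRel k n)

/-- The generators of `OPol_n`. -/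
def x (i : Fin n) : OPol k n := mk (FreeAlgebra.ι k i)

theorem x_anticomm {i j : Fin n} (h : i ≠ j) : (x i * x j + x j * x i : OPol k n) = 0 := by
  have : mk (FreeAlgebra.ι k i * FreeAlgebra.ι k j + FreeAlgebra.ι k j * FreeAlgebra.ι k i) =
      mk (0 : FreeAlgebra k (Fin n)) :=
    RingQuot.mkAlgHom_rel k (SkewRel.anticomm (k := k) i j h)
  simpa [x] using this

/-- The universal property of `OPol_n`. -/
def lift {A : Type*} [Ring A] [Algebra k A] (y : Fin n → A)
    (h : ∀ i j, i ≠ j → y i * y j + y j * y i = 0) : OPol k n →ₐ[k] A :=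
  RingQuot.liftAlgHom k ⟨FreeAlgebra.lift k y, by
    rintro _ _ ⟨i, j, hij⟩
    simpa using h i j hij⟩

@[simp] theorem lift_x {A : Type*} [Ring A] [Algebra k A] (y : Fin n → A)
    (h : ∀ i j, i ≠ j → y i * y j + y j * y i = 0) (i : Fin n) :
    lift (k := k) y h (x i) = y i :=
  (RingQuot.liftAlgHom_mkAlgHom_apply k _ _ _).trans (FreeAlgebra.lift_ι_apply _ _)

theorem induction {P : OPol k n → Prop} (hc : ∀ r : k, P (algebraMap k _ r))
    (hx : ∀ i, P (x i)) (hadd : ∀ f g, P f → P g → P (f + g))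
    (hmul : ∀ f g, P f → P g → P (f * g)) (f : OPol k n) : P f := by
  obtain ⟨f, rfl⟩ : ∃ g, mk g = f := RingQuot.mkAlgHom_surjective k (SkewRel k n) f
  induction f using FreeAlgebra.induction with
  | grade0 r => simpa using hc r
  | grade1 i => exact hx i
  | mul a b ha hb => simpa using hmul _ _ ha hb
  | add a b ha hb => simpa using hadd _ _ ha hb

/-- The algebra endomorphism `x_j ↦ ε_j x_{w(j)}`, for signs (or scalars) `ε_j`. -/
def signedPerm (ε : Fin n → k) (w : Equiv.Perm (Fin n)) : OPol k n →ₐ[k] OPol k n :=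
  lift (fun j => ε j • x (w j)) fun i j h => by
    have := x_anticomm (k := k) (w.injective.ne h)
    rw [smul_mul_smul_comm, smul_mul_smul_comm, mul_comm (ε j), ← smul_add, this, smul_zero]

/-- The parity involution `f ↦ (-1)^{p(f)} f`; all `x_j` are odd. -/
def parity : OPol k n →ₐ[k] OPol k n := signedPerm (fun _ => -1) 1

/-- The twisting `θ : x_i ↦ (-1)^{i-1} x_i` (for `i = 1, …, n`). -/
def twist : OPol k n →ₐ[k] OPol k n := signedPerm (fun i => (-1) ^ (i : ℕ)) 1

/-- The longest permutation acting by `w_0 : x_i ↦ x_{n+1-i}` (for `i = 1, …, n`). -/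
def longest : OPol k n →ₐ[k] OPol k n := signedPerm (fun _ => 1) Fin.revPerm

@[simp] theorem signedPerm_x (ε : Fin n → k) (w : Equiv.Perm (Fin n)) (j : Fin n) :
    signedPerm ε w (x j) = ε j • x (w j) := by
  simp [signedPerm]

@[simp] theorem parity_x (j : Fin n) : parity (x j : OPol k n) = - x j := by
  simp [parity]

/-- Auxiliary homomorphism to `2 × 2` matrices whose upper right entry is the odd derivation `D`
with `D(f g) = D(f) g + σ(ι f) D(g)` and `D(x_j) = y_j`, where `σ` permutes the variables by `w`
and `ι` is the parity involution. -/
def skewDerAux (w : Equiv.Perm (Fin n)) (y : Fin n → OPol k n)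
    (h : ∀ i j, i ≠ j → (y i * x j - x (w i) * y j) + (y j * x i - x (w j) * y i) = 0) :
    OPol k n →ₐ[k] Matrix (Fin 2) (Fin 2) (OPol k n) :=
  lift (fun j => !![- x (w j), y j; 0, x j]) fun i j hij => by
    have h1 := x_anticomm (k := k) (w.injective.ne hij)
    have h2 := x_anticomm (k := k) hij
    have h3 := h i j hij
    ext a b
    fin_cases a <;> fin_cases b
    · simpa [Matrix.mul_apply, Fin.sum_univ_two] using h1
    · simp only [Fin.zero_eta, Fin.mk_one, Matrix.add_apply, Matrix.mul_apply, Fin.sum_univ_two,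
        Matrix.zero_apply]
      rw [← h3]
      simp
      abel
    · simp
    · simpa [Matrix.mul_apply, Fin.sum_univ_two] using h2

/-- The unique `k`-linear `D : OPol_n → OPol_n` with `D(x_j) = y_j` and
`D(f g) = D(f) g + σ(ι f) D(g)`; see `skewDer_x` and `skewDer_mul`. -/
def skewDer (w : Equiv.Perm (Fin n)) (y : Fin n → OPol k n)
    (h : ∀ i j, i ≠ j → (y i * x j - x (w i) * y j) + (y j * x i - x (w j) * y i) = 0) :
    OPol k n →ₗ[k] OPol k n :=
  Matrix.entryLinearMap k (OPol k n) (0 : Fin 2) (1 : Fin 2) ∘ₗ (skewDerAux w y h).toLinearMap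

theorem skewDer_x (w : Equiv.Perm (Fin n)) (y : Fin n → OPol k n)
    (h : ∀ i j, i ≠ j → (y i * x j - x (w i) * y j) + (y j * x i - x (w j) * y i) = 0)
    (j : Fin n) : skewDer w y h (x j) = y j := by
  simp [skewDer, skewDerAux]

theorem skewDerAux_entries (w : Equiv.Perm (Fin n)) (y : Fin n → OPol k n)
    (h : ∀ i j, i ≠ j → (y i * x j - x (w i) * y j) + (y j * x i - x (w j) * y i) = 0)
    (f : OPol k n) :
    skewDerAux w y h f 0 0 = signedPerm (fun _ => 1) w (parity f) ∧
      skewDerAux w y h f 1 0 = 0 ∧ skewDerAux w y h f 1 1 = f := by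
  induction f using induction with
  | hc r => simp [Matrix.algebraMap_matrix_apply]
  | hx i => simp [skewDerAux]
  | hadd f g hf hg => simp [hf, hg]
  | hmul f g hf hg => simp [Matrix.mul_apply, Fin.sum_univ_two, hf, hg]

theorem skewDer_mul (w : Equiv.Perm (Fin n)) (y : Fin n → OPol k n)
    (h : ∀ i j, i ≠ j → (y i * x j - x (w i) * y j) + (y j * x i - x (w j) * y i) = 0)
    (f g : OPol k n) :
    skewDer w y h (f * g) =
      skewDer w y h f * g + signedPerm (fun _ => 1) w (parity f) * skewDer w y h g := by
  obtain ⟨h1, -, -⟩ := skewDerAux_entries w y h f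
  obtain ⟨-, -, h2⟩ := skewDerAux_entries w y h g
  simp [skewDer, Matrix.mul_apply, Fin.sum_univ_two, h1, h2, add_comm]

theorem sq_comm {i j : Fin n} (h : i ≠ j) : (x i ^ 2 * x j : OPol k n) = x j * x i ^ 2 := by
  have h2 : (x i * x j : OPol k n) = - (x j * x i) := eq_neg_of_add_eq_zero_left (x_anticomm h)
  rw [pow_two, mul_assoc, h2, mul_neg, ← mul_assoc, h2, neg_mul, neg_neg, mul_assoc]

theorem sq_compat (i j : Fin n) (h : i ≠ j) :
    ((x i ^ 2 * x j - x ((1 : Equiv.Perm (Fin n)) i) * x j ^ 2) +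
      (x j ^ 2 * x i - x ((1 : Equiv.Perm (Fin n)) j) * x i ^ 2) : OPol k n) = 0 := by
  simp [sq_comm h, sq_comm h.symm]

/-- The differential on `OPol_n`: the odd derivation with `d(x_i) = x_i ^ 2`. -/
def d : OPol k n →ₗ[k] OPol k n :=
  skewDer 1 (fun j => x j ^ 2) sq_compat

@[simp] theorem d_x (i : Fin n) : d (x i : OPol k n) = x i ^ 2 := skewDer_x _ _ _ i

theorem signedPerm_one (f : OPol k n) : signedPerm (fun _ => (1 : k)) 1 f = f := by
  induction f using induction with
  | hc r => simp
  | hx i => simp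
  | hadd f g hf hg => simp [hf, hg]
  | hmul f g hf hg => simp [hf, hg]

/-- `d(f g) = d(f) g + (-1)^{p(f)} f d(g)`. -/
theorem d_mul (f g : OPol k n) : d (f * g) = d f * g + parity f * d g := by
  have := skewDer_mul (k := k) (n := n) 1 (fun j => x j ^ 2) sq_compat f g
  rw [signedPerm_one] at this
  exact this

@[simp] theorem d_one : d (1 : OPol k n) = 0 := by
  have h := d_mul (1 : OPol k n) 1
  simpa using h

@[simp] theorem d_algebraMap (r : k) : d (algebraMap k (OPol k n) r) = 0 := by
  rw [Algebra.algebraMap_eq_smul_one, map_smul, d_one, smul_zero]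

theorem parity_parity (f : OPol k n) : parity (parity f) = f := by
  induction f using induction with
  | hc r => simp
  | hx i => simp
  | hadd f g hf hg => simp [hf, hg]
  | hmul f g hf hg => simp [hf, hg]

/-- `d` is odd. -/
theorem d_parity (f : OPol k n) : d (parity f) = - parity (d f) := by
  induction f using induction with
  | hc r => simp
  | hx i => simp
  | hadd f g hf hg => simp [hf, hg, add_comm]
  | hmul f g hf hg => simp [d_mul, hf, hg, parity_parity, add_comm]

theorem d_d (f : OPol k n) : d (d f) = 0 := by
  induction f using induction with
  | hc r => simp
  | hx i => simp [pow_two, d_mul, mul_assoc]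
  | hadd f g hf hg => simp [hf, hg]
  | hmul f g hf hg => simp [d_mul, hf, hg, d_parity]

/-- The `i`-th odd divided difference operator `∂_i`, for `1 ≤ i ≤ n - 1`, numbered from `0`:
`∂_i(x_j) = 1` for `j ∈ {i, i+1}`, `∂_i(x_j) = 0` for the other `j`, and
`∂_i(f g) = ∂_i(f) g + (-1)^{p(f)} s_i(f) ∂_i(g)`. It is set to `0` if `i` is out of range. -/
def divDiff (i : ℕ) : OPol k n →ₗ[k] OPol k n :=
  if h : i + 1 < n then
    skewDer (Equiv.swap ⟨i, by omega⟩ ⟨i + 1, h⟩)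
      (fun j => if (j : ℕ) = i ∨ (j : ℕ) = i + 1 then 1 else 0) (by
        have key : ∀ a b : Fin n, (a : ℕ) = i ∨ (a : ℕ) = i + 1 → a ≠ b →
            (b : ℕ) = i ∨ (b : ℕ) = i + 1 →
            Equiv.swap (⟨i, by omega⟩ : Fin n) ⟨i + 1, h⟩ a = b := by
          rintro ⟨a, ha⟩ ⟨b, hb⟩ h1 h2 h3
          simp only [ne_eq, Fin.mk.injEq] at h1 h2 h3
          rcases h1 with rfl | rfl <;> rcases h3 with rfl | rfl <;> simp_all
        have key' : ∀ b : Fin n, ¬ ((b : ℕ) = i ∨ (b : ℕ) = i + 1) →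
            Equiv.swap (⟨i, by omega⟩ : Fin n) ⟨i + 1, h⟩ b = b := by
          rintro ⟨b, hb⟩ h1
          apply Equiv.swap_apply_of_ne_of_ne <;> simp only [ne_eq, Fin.mk.injEq] <;> tauto
        intro a b hab
        by_cases h1 : (a : ℕ) = i ∨ (a : ℕ) = i + 1 <;>
          by_cases h2 : (b : ℕ) = i ∨ (b : ℕ) = i + 1
        · simp [h1, h2, key a b h1 hab h2, key b a h2 hab.symm h1]
        · simp [h1, h2, key' b h2]
        · simp [h1, h2, key' a h1]
        · simp [h1, h2])
  else 0

/-- `∂_{w_0} = ∂_1 (∂_2 ∂_1) ⋯ (∂_{n-1} ⋯ ∂_1)`, a composition of operators. -/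
def divDiffLongest : OPol k n →ₗ[k] OPol k n :=
  ((List.range (n - 1)).map fun m =>
    ((List.range (m + 1)).reverse.map fun i => (divDiff i : Module.End k (OPol k n))).prod).prod

/-- `y_1^{a_1} ⋯ y_n^{a_n}`, in this order. -/
def monomial (y : Fin n → OPol k n) (a : Fin n → ℕ) : OPol k n :=
  (List.ofFn fun i => y i ^ a i).prod

end OPol

/-! ### Odd symmetric polynomials -/

section Sym

variable (k : Type*) [CommRing k] (n : ℕ)

/-- The sum of all products `x_{i_1} ⋯ x_{i_m}` over sublists `i_1, …, i_m` of `l`. -/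
def esymm (l : List (Fin n)) (m : ℕ) : OPol k n :=
  ((l.sublistsLen m).map fun s => (s.map x).prod).sum

/-- The odd elementary symmetric polynomial
`e_m = ∑_{1 ≤ i_1 < ⋯ < i_m ≤ n} x_{i_1} ⋯ x_{i_m}`. -/
def e (m : ℕ) : OPol k n := esymm k n (List.finRange n) m

/-- The algebra `OΛ_n` of (untwisted) odd symmetric polynomials in `n` variables. -/
def OLam : Subalgebra k (OPol k n) := Algebra.adjoin k (Set.range (e k n))

variable {k n}

theorem esymm_zero (l : List (Fin n)) : esymm k n l 0 = 1 := by simp [esymm]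

theorem esymm_nil_succ (m : ℕ) : esymm k n [] (m + 1) = 0 := by simp [esymm]

theorem esymm_cons_succ (a : Fin n) (l : List (Fin n)) (m : ℕ) :
    esymm k n (a :: l) (m + 1) = esymm k n l (m + 1) + x a * esymm k n l m := by
  simp only [esymm, List.sublistsLen_succ_cons, List.map_append, List.sum_append, List.map_map]
  rw [← List.sum_map_mul_left]
  simp [Function.comp_def]

theorem x_mul_esymm_one (a : Fin n) (l : List (Fin n)) (h : a ∉ l) :
    x a * esymm k n l 1 = - (esymm k n l 1 * x a) := by
  induction l with
  | nil => simp [esymm_nil_succ]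
  | cons b l ih =>
    simp only [List.mem_cons, not_or] at h
    have hx : (x a * x b : OPol k n) = - (x b * x a) :=
      eq_neg_of_add_eq_zero_left (x_anticomm h.1)
    rw [esymm_cons_succ, esymm_zero, mul_one, mul_add, add_mul, ih h.2, hx]
    abel

theorem d_esymm (l : List (Fin n)) (hl : l.Nodup) (m : ℕ) :
    d (esymm k n l m) = esymm k n l 1 * esymm k n l m
      - (if Odd (m + 1) then esymm k n l (m + 1) else 0) := by
  induction l generalizing m with
  | nil => cases m <;> simp [esymm_zero, esymm_nil_succ]
  | cons a l ih =>
    rw [List.nodup_cons] at hl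
    have hx := x_mul_esymm_one (k := k) a l hl.1
    cases m with
    | zero => simp [esymm_zero]
    | succ m =>
      have hx' : ∀ f, esymm k n l 1 * (x a * f) = - (x a * (esymm k n l 1 * f)) := fun f => by
        rw [← mul_assoc, ← mul_assoc, hx, neg_mul, neg_neg]
      rw [esymm_cons_succ, map_add, d_mul, ih hl.2, ih hl.2, esymm_cons_succ a l 0, esymm_zero,
        esymm_cons_succ a l (m + 1), d_x, parity_x]
      by_cases hm : Odd (m + 1)
      · have hm' : ¬ Odd (m + 1 + 1) := by
          rw [Nat.odd_add_one]; exact not_not.mpr hm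
        simp only [hm, hm', if_true, if_false]
        simp only [mul_one, pow_two, mul_add, add_mul, mul_sub, mul_assoc, hx', neg_mul]
        abel
      · have hm' : Odd (m + 1 + 1) := by
          rw [Nat.odd_add_one]; exact hm
        simp only [hm, hm', if_true, if_false]
        simp only [mul_one, pow_two, mul_add, add_mul, mul_sub, mul_assoc, hx', neg_mul, sub_zero]
        abel

theorem e_mem (m : ℕ) : e k n m ∈ OLam k n := Algebra.subset_adjoin ⟨m, rfl⟩

theorem parity_esymm (l : List (Fin n)) (m : ℕ) :
    parity (esymm k n l m) = (-1 : k) ^ m • esymm k n l m := by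
  induction l generalizing m with
  | nil => cases m <;> simp [esymm_zero, esymm_nil_succ]
  | cons a l ih =>
    cases m with
    | zero => simp [esymm_zero]
    | succ m => simp [esymm_cons_succ, ih, pow_succ]

theorem parity_mem {f : OPol k n} (hf : f ∈ OLam k n) : parity f ∈ OLam k n := by
  induction hf using Algebra.adjoin_induction with
  | mem f hf =>
    obtain ⟨m, rfl⟩ := hf
    rw [e, parity_esymm]
    exact Subalgebra.smul_mem _ (e_mem m) _
  | algebraMap r => simp
  | add f g _ _ hf hg => simpa using add_mem hf hg
  | mul f g _ _ hf hg => simpa using mul_mem hf hg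

theorem d_mem {f : OPol k n} (hf : f ∈ OLam k n) : d f ∈ OLam k n := by
  induction hf using Algebra.adjoin_induction with
  | mem f hf =>
    obtain ⟨m, rfl⟩ := hf
    rw [e, d_esymm _ (List.nodup_finRange n)]
    refine sub_mem (mul_mem (e_mem 1) (e_mem m)) ?_
    split_ifs
    exacts [e_mem _, zero_mem _]
  | algebraMap r => simp
  | add f g _ _ hf hg => simpa using add_mem hf hg
  | mul f g hf' hg' hf hg =>
    rw [d_mul]
    exact add_mem (mul_mem hf hg') (mul_mem (parity_mem hf') hg)

variable (k n) in
/-- The differential on `OΛ_n`. -/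
def dOLam : OLam k n →ₗ[k] OLam k n :=
  d.restrict (p := Subalgebra.toSubmodule (OLam k n)) (q := Subalgebra.toSubmodule (OLam k n))
    fun _ => d_mem

/-- The (untwisted) odd Schur polynomial
`s_λ = w_0 θ ∂_{w_0} (x̃^δ x̃^λ)` in `OPol_n`, where `x̃_i = θ(x_i)` and
`δ = (n-1, n-2, …, 1, 0)`. It is meant for partitions `λ` with at most `n` rows. -/
def schur (k : Type*) [CommRing k] (n : ℕ) (lam : YoungDiagram) : OPol k n :=
  longest (twist (divDiffLongest
    (monomial (fun i => twist (x i)) (fun i => (i.rev : ℕ)) *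
      monomial (fun i => twist (x i)) (fun i => lam.rowLen i))))

end Sym

/-! ### The inverse limit -/

section Lim

variable {k : Type*} [CommRing k]

/-- The map `OPol_{n+1} → OPol_n` with `x_{n+1} ↦ 0` and `x_i ↦ x_i` for `i ≤ n`. -/
def proj (n : ℕ) : OPol k (n + 1) →ₐ[k] OPol k n :=
  lift (Fin.lastCases 0 (fun i => x i)) fun i j h => by
    induction i using Fin.lastCases with
    | last => simp
    | cast i =>
      induction j using Fin.lastCases with
      | last => simp
      | cast j =>
        simp only [Fin.lastCases_castSucc]
        exact x_anticomm (by simpa using h)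

theorem proj_esymm (n : ℕ) (l : List (Fin n)) (m : ℕ) :
    proj n (esymm k (n + 1) (l.map Fin.castSucc ++ [Fin.last n]) m) = esymm k n l m := by
  induction l generalizing m with
  | nil =>
    rcases m with _ | _ | m <;>
      simp [esymm_cons_succ, esymm_nil_succ, esymm_zero, proj]
  | cons a l ih =>
    cases m with
    | zero => simp [esymm_zero]
    | succ m =>
      rw [List.map_cons, List.cons_append, esymm_cons_succ, map_add, map_mul, ih, ih,
        esymm_cons_succ]
      simp [proj]

/-- The map `proj n` restricts to a map `OΛ_{n+1} → OΛ_n`, with `e_m ↦ e_m`. -/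
theorem proj_mem (n : ℕ) {f : OPol k (n + 1)} (hf : f ∈ OLam k (n + 1)) :
    proj n f ∈ OLam k n := by
  induction hf using Algebra.adjoin_induction with
  | mem f hf =>
    obtain ⟨m, rfl⟩ := hf
    rw [e, List.finRange_succ_last, proj_esymm]
    exact e_mem m
  | algebraMap r => simp
  | add f g _ _ hf hg => simpa using add_mem hf hg
  | mul f g _ _ hf hg => simpa using mul_mem hf hg

/-- The homogeneous polynomials of degree `m` in the variables. -/
def homog (k : Type*) [CommRing k] (n m : ℕ) : Submodule k (OPol k n) :=
  Submodule.span k (Set.range x) ^ m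

/-- The degree `m` part of `lim_n OΛ_n`: the compatible sequences of odd symmetric polynomials
that are homogeneous of degree `m`. -/
def OLamLimDeg (k : Type*) [CommRing k] (m : ℕ) : Submodule k (∀ n, OPol k n) where
  carrier := {f | (∀ n, f n ∈ OLam k n) ∧ (∀ n, f n ∈ homog k n m) ∧
    ∀ n, proj n (f (n + 1)) = f n}
  zero_mem' := ⟨fun _ => zero_mem _, fun _ => zero_mem _, fun _ => map_zero _⟩
  add_mem' := fun hf hg => ⟨fun n => add_mem (hf.1 n) (hg.1 n),
    fun n => add_mem (hf.2.1 n) (hg.2.1 n), fun n => by simp [hf.2.2 n, hg.2.2 n]⟩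
  smul_mem' := fun r f hf => ⟨fun n => Subalgebra.smul_mem _ (hf.1 n) r,
    fun n => Submodule.smul_mem _ r (hf.2.1 n), fun n => by simp [hf.2.2 n]⟩

theorem one_mem_lim : (1 : ∀ n, OPol k n) ∈ ⨆ m, OLamLimDeg k m :=
  Submodule.mem_iSup_of_mem 0 ⟨fun _ => one_mem _, fun n => by
    rw [homog, pow_zero]; exact Submodule.one_le.mp le_rfl, fun n => by simp⟩

theorem mul_mem_lim {f g : ∀ n, OPol k n} (hf : f ∈ ⨆ m, OLamLimDeg k m)
    (hg : g ∈ ⨆ m, OLamLimDeg k m) : f * g ∈ ⨆ m, OLamLimDeg k m := by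
  induction hf using Submodule.iSup_induction' with
  | zero => simp
  | add f f' _ _ hf hf' => rw [add_mul]; exact add_mem hf hf'
  | mem a f hf =>
    induction hg using Submodule.iSup_induction' with
    | zero => simp
    | add g g' _ _ hg hg' => rw [mul_add]; exact add_mem hg hg'
    | mem b g hg =>
      refine Submodule.mem_iSup_of_mem (a + b) ⟨fun n => mul_mem (hf.1 n) (hg.1 n), fun n => ?_,
        fun n => by simp [hf.2.2 n, hg.2.2 n]⟩
      rw [homog, pow_add]
      exact Submodule.mul_mem_mul (hf.2.1 n) (hg.2.1 n)

/-- The inverse limit `OΛ` of the graded algebras `OΛ_n` along the maps `proj`, as a subalgebra of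
the product of the `OPol_n`. As usual for symmetric functions, the limit is the limit of graded
algebras, that is, the direct sum over all degrees `m` of the limits of the degree `m` parts. -/
def OLamLim (k : Type*) [CommRing k] : Subalgebra k (∀ n, OPol k n) :=
  (⨆ m, OLamLimDeg k m).toSubalgebra one_mem_lim fun _ _ => mul_mem_lim

theorem parity_homog {n m : ℕ} {f : OPol k n} (hf : f ∈ homog k n m) :
    parity f ∈ homog k n m := by
  have h : (homog k n m).map (parity (k := k) (n := n)).toLinearMap ≤ homog k n m := by
    rw [homog, Submodule.map_pow]
    refine pow_le_pow_left' ?_ m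
    rw [Submodule.map_span, Submodule.span_le]
    rintro _ ⟨_, ⟨i, rfl⟩, rfl⟩
    simpa using Submodule.subset_span (Set.mem_range_self i)
  exact h ⟨f, hf, rfl⟩

theorem d_homog {n m : ℕ} {f : OPol k n} (hf : f ∈ homog k n m) : d f ∈ homog k n (m + 1) := by
  induction m generalizing f with
  | zero =>
    rw [homog, pow_zero] at hf
    obtain ⟨r, rfl⟩ := Submodule.mem_one.mp hf
    simp
  | succ m ih =>
    rw [homog, pow_succ] at hf
    induction hf using Submodule.mul_induction_on' with
    | add f _ g _ hf hg => simpa using add_mem hf hg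
    | mem_mul_mem f hf g hg =>
      rw [d_mul]
      refine add_mem ?_ ?_
      · rw [homog, pow_succ]
        exact Submodule.mul_mem_mul (ih hf) hg
      · have h2 : d g ∈ Submodule.span k (Set.range x) ^ 2 := by
          induction hg using Submodule.span_induction with
          | mem g hg =>
            obtain ⟨i, rfl⟩ := hg
            rw [d_x, pow_two, pow_two]
            exact Submodule.mul_mem_mul (Submodule.subset_span ⟨i, rfl⟩)
              (Submodule.subset_span ⟨i, rfl⟩)
          | zero => simp
          | add f g _ _ hf hg => simpa using add_mem hf hg
          | smul r f _ hf => simpa using Submodule.smul_mem _ r hf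
        rw [homog, add_assoc, pow_add]
        exact Submodule.mul_mem_mul (parity_homog hf) h2

theorem proj_parity (n : ℕ) (f : OPol k (n + 1)) : proj n (parity f) = parity (proj n f) := by
  induction f using induction with
  | hc r => simp
  | hx i => induction i using Fin.lastCases <;> simp [proj]
  | hadd f g hf hg => simp [hf, hg]
  | hmul f g hf hg => simp [hf, hg]

theorem proj_d (n : ℕ) (f : OPol k (n + 1)) : proj n (d f) = d (proj n f) := by
  induction f using induction with
  | hc r => simp
  | hx i => induction i using Fin.lastCases <;> simp [proj]
  | hadd f g hf hg => simp [hf, hg]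
  | hmul f g hf hg => simp [d_mul, hf, hg, proj_parity]

variable (k) in
/-- The componentwise differential on sequences. -/
def dSeq : (∀ n, OPol k n) →ₗ[k] (∀ n, OPol k n) :=
  LinearMap.pi fun n => d ∘ₗ LinearMap.proj n

theorem dSeq_mem {f : ∀ n, OPol k n} (hf : f ∈ ⨆ m, OLamLimDeg k m) :
    dSeq k f ∈ ⨆ m, OLamLimDeg k m := by
  induction hf using Submodule.iSup_induction' with
  | zero => simp
  | add f g _ _ hf hg => simpa using add_mem hf hg
  | mem m f hf =>
    exact Submodule.mem_iSup_of_mem (m + 1) ⟨fun n => d_mem (hf.1 n),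
      fun n => d_homog (hf.2.1 n), fun n => by simp [dSeq, proj_d, hf.2.2 n]⟩

variable (k) in
/-- The differential on `OΛ`, induced by the differentials on the `OΛ_n`. -/
def dOLamLim : OLamLim k →ₗ[k] OLamLim k :=
  (dSeq k).restrict (p := Subalgebra.toSubmodule (OLamLim k))
    (q := Subalgebra.toSubmodule (OLamLim k)) fun _ => dSeq_mem

/-- The odd Schur function `s_λ` as a sequence: its `n`-th entry is the odd Schur polynomial `s_λ`
in `n` variables if `λ` has at most `n` rows, and `0` otherwise. -/
def schurSeq (k : Type*) [CommRing k] (lam : YoungDiagram) : ∀ n, OPol k n :=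
  fun n => if lam.colLen 0 ≤ n then schur k n lam else 0

end Lim

/-! ### Cohomology and Lima partitions -/

section Cohomology

variable {k M : Type*} [CommRing k] [AddCommGroup M] [Module k M]

/-- The cohomology `ker D / im D` of a module with differential `D`. -/
abbrev Cohomology (D : M →ₗ[k] M) : Type _ :=
  LinearMap.ker D ⧸ (LinearMap.range D).submoduleOf (LinearMap.ker D)

/-- The class of a cocycle. -/
def cohClass (D : M →ₗ[k] M) (z : LinearMap.ker D) : Cohomology D :=
  Submodule.Quotient.mk z

end Cohomology

theorem dOLam_dOLam {k : Type*} [CommRing k] {n : ℕ} (f : OLam k n) :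
    dOLam k n (dOLam k n f) = 0 := Subtype.ext (d_d _)

theorem dOLamLim_dOLamLim {k : Type*} [CommRing k] (f : OLamLim k) :
    dOLamLim k (dOLamLim k f) = 0 := Subtype.ext (funext fun _ => d_d _)

/-- A Lima partition: all parts are even and every value occurs an even number of times. -/
def IsLima (lam : YoungDiagram) : Prop :=
  (∀ p ∈ lam.rowLens, Even p) ∧ ∀ p, Even (lam.rowLens.count p)

end OddSym

/-! The differential of an odd Schur polynomial is a signed sum over boxes: number rows and columns
from 0 and let the content be column minus row; then $d s_\lambda=\sum\pm s_{\lambda+\square}$ over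
the addable boxes of odd content (`d_schurS`). Once this is known, the cohomology is found by a
matching of partitions.

For the formula, $d$ is transported through $w_0\theta$ to the odd derivation `dTwist` with
$\widetilde x_i\mapsto\widetilde x_i^2$. It satisfies a commutation rule with every $\partial_i$
(`isTwistedDiff_dTwist`). From this rule and the odd nil-Hecke relations alone, `dTwist` passes
$\partial_{w_0}$ up to a sign, with a correction $-\sum_j\widetilde x_j$ exactly when $n$ is even
(`IsTwistedDiff.mul_long`). On a monomial, `dTwist` raises each odd exponent by one. Applied to
$\widetilde x^{\delta+\lambda}$ and corrected in this way, it raises precisely the exponents in rows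
$j$ with $\lambda_j+j$ odd, for either parity of $n$. If the result is not a partition, two
neighbouring exponents of $\delta+\lambda$ agree and $\partial_{w_0}$ kills the monomial.

That the Schur polynomials form a basis of $\mathrm{O\Lambda}_n$ rests on the odd Pieri rule
(`pieri_schurS`): the twisted $e_m$ are killed by all $\partial_i$, so multiplication by them
commutes with $\partial_{w_0}$. The span of the Schur polynomials is therefore stable under the
$e_m$. Solving the rule for its term of largest weight gives an induction (`partition_induction`)
that proves membership in $\mathrm{O\Lambda}_n$, homogeneity, stability under $x_{n+1}\mapsto0$, and
the leading monomial $\pm\widetilde x^{\lambda}$, hence linear independence over any commutative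
ring.

For the matching, a Lima partition has only addable and removable boxes of even content, so
$s_\lambda$ is a cocycle that never occurs in a coboundary. Any other partition has a first pair of
rows $2i,2i+1$ whose lengths are not equal and even; toggling a box at the end of row $2i$ makes
that row odd or even. Call a partition low if this row is odd. Adding the toggled box has odd
content, and any other box of odd content leaves a low partition low. Modulo low basis vectors the
differential is thus a bijection up to units from low partitions to their partners, and
`exists_basis_cohomology` concludes. Toggling never opens a new row, so the argument works verbatim
in $n$ variables. -/

namespace OddSym

/-! ### Monomials in anticommuting elements -/

section Mono

variable {R : Type*} [Ring R] {n : ℕ}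

/-- The product `z_1^{a_1} ⋯ z_n^{a_n}`, in this order. -/
def mono (z : Fin n → R) (a : Fin n → ℕ) : R := (List.ofFn fun i => z i ^ a i).prod

theorem mono_succ (z : Fin (n + 1) → R) (a : Fin (n + 1) → ℕ) :
    mono z a = z 0 ^ a 0 * mono (fun i => z i.succ) (fun i => a i.succ) := by
  simp [mono, List.ofFn_succ]

@[simp] theorem mono_zero_exp (z : Fin n → R) : mono z 0 = 1 := by
  induction n with
  | zero => simp [mono]
  | succ n ih =>
    rw [mono_succ, Pi.zero_apply, pow_zero, one_mul]
    exact ih _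

theorem mono_eq_finRange (z : Fin n → R) (a : Fin n → ℕ) :
    mono z a = ((List.finRange n).map fun i => z i ^ a i).prod := by
  rw [mono, List.ofFn_eq_map]

/-- Pairwise anticommuting families. -/
def Anticomm (z : Fin n → R) : Prop := ∀ i j, i ≠ j → z i * z j = -(z j * z i)

theorem neg_one_pow_mul_comm (N : ℕ) (f : R) : f * (-1) ^ N = (-1) ^ N * f := by
  rcases neg_one_pow_eq_or R N with h | h <;> simp [h]

theorem mul_pow_anticomm {u v : R} (h : u * v = -(v * u)) (a : ℕ) :
    u * v ^ a = (-1) ^ a * (v ^ a * u) := by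
  induction a with
  | zero => simp
  | succ a ih =>
    rw [pow_succ, ← mul_assoc, ih, mul_assoc, mul_assoc, h, pow_succ]
    simp [mul_assoc]

theorem pow_mul_pow_anticomm {u v : R} (h : u * v = -(v * u)) (a b : ℕ) :
    u ^ b * v ^ a = (-1) ^ (a * b) * (v ^ a * u ^ b) := by
  induction b with
  | zero => simp
  | succ b ih =>
    rw [pow_succ, mul_assoc, mul_pow_anticomm h, ← mul_assoc, neg_one_pow_mul_comm, mul_assoc,
      ← mul_assoc (u ^ b), ih, Nat.mul_succ, pow_add]
    simp only [← mul_assoc]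
    rw [← pow_add, ← pow_add, add_comm]

theorem mono_mul_pow_anticomm (z : Fin n → R) (a : Fin n → ℕ) (v : R)
    (h : ∀ i, z i * v = -(v * z i)) (b : ℕ) :
    mono z a * v ^ b = (-1) ^ (b * ∑ i, a i) * (v ^ b * mono z a) := by
  induction n with
  | zero => simp [mono]
  | succ n ih =>
    rw [mono_succ, mul_assoc, ih _ _ fun i => h i.succ, ← mul_assoc, neg_one_pow_mul_comm, mul_assoc,
      ← mul_assoc (z 0 ^ a 0), pow_mul_pow_anticomm (h 0), Fin.sum_univ_succ, mul_add, pow_add]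
    simp only [← mul_assoc]
    rw [← pow_add, ← pow_add, add_comm]

/-- The exponent of the sign in the product of two monomials. -/
def sgnExp (a b : Fin n → ℕ) : ℕ := ∑ i, b i * ∑ j ∈ Finset.Ioi i, a j

theorem mono_mul_mono {z : Fin n → R} (hz : Anticomm z) (a b : Fin n → ℕ) :
    mono z a * mono z b = (-1) ^ sgnExp a b * mono z (a + b) := by
  induction n with
  | zero => simp [mono, sgnExp]
  | succ n ih =>
    have h0 : sgnExp a b = b 0 * ∑ i : Fin n, a i.succ +
        sgnExp (fun i : Fin n => a i.succ) (fun i => b i.succ) := by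
      simp only [sgnExp, Fin.sum_univ_succ, Fin.Ioi_zero_eq_map, Fin.Ioi_succ, Finset.sum_map]
      rfl
    have h1 := ih (z := fun i => z i.succ) (fun i j h => hz _ _ ((Fin.succ_injective n).ne h))
      (fun i => a i.succ) (fun i => b i.succ)
    rw [mono_succ z a, mono_succ z b, mono_succ z (a + b), mul_assoc,
      ← mul_assoc (mono _ _) (z 0 ^ b 0),
      mono_mul_pow_anticomm _ _ _ fun i => hz _ _ (Fin.succ_ne_zero i)]
    rw [mul_assoc, mul_assoc (z 0 ^ b 0), h1, h0, pow_add, Pi.add_apply, pow_add]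
    simp only [← mul_assoc, neg_one_pow_mul_comm _ (z 0 ^ a 0)]
    congr 1
    simp only [mul_assoc]
    rw [neg_one_pow_mul_comm _ (z 0 ^ b 0), ← mul_assoc (z 0 ^ a 0) ((-1) ^ _),
      neg_one_pow_mul_comm _ (z 0 ^ a 0)]
    simp only [mul_assoc]

theorem map_mono {S : Type*} [Ring S] (f : R →+* S) (z : Fin n → R) (a : Fin n → ℕ) :
    f (mono z a) = mono (fun i => f (z i)) a := by
  simp [mono, map_list_prod, List.map_ofFn, Function.comp_def]

theorem mono_single (z : Fin n → R) (i : Fin n) : mono z (Pi.single i 1) = z i := by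
  induction n with
  | zero => exact i.elim0
  | succ n ih =>
    rw [mono_succ]
    cases i using Fin.cases with
    | zero =>
      have : (fun i : Fin n => (Pi.single 0 1 : Fin (n + 1) → ℕ) i.succ) = 0 := by
        ext i; simp
      rw [this]; simp
    | succ i =>
      have : (fun j : Fin n => (Pi.single i.succ 1 : Fin (n + 1) → ℕ) j.succ) =
          Pi.single i 1 := by
        ext j; simp [Pi.single_apply]
      rw [this, ih]
      simp

theorem sum_pi_single_one (s : Finset (Fin n)) (i : Fin n) :
    ∑ j ∈ s, (Pi.single i 1 : Fin n → ℕ) j = if i ∈ s then 1 else 0 := by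
  simp [Pi.single_apply]

theorem mul_mono {z : Fin n → R} (hz : Anticomm z) (i : Fin n) (a : Fin n → ℕ) :
    z i * mono z a = (-1) ^ (∑ j ∈ Finset.Iio i, a j) * mono z (a + Pi.single i 1) := by
  rw [← mono_single z i, mono_mul_mono hz, add_comm]
  congr 2
  have : ∀ j, a j * ∑ l ∈ Finset.Ioi j, (Pi.single i 1 : Fin n → ℕ) l =
      if j ∈ Finset.Iio i then a j else 0 := fun j => by
    rw [sum_pi_single_one]
    by_cases h : j < i <;> simp [h]
  simp only [sgnExp, this, ← Finset.sum_filter, Finset.mem_Iio, Finset.filter_gt_eq_Iio]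

end Mono

/-! ### Twisted variables and the monomial basis of the skew polynomials -/

section OPol

variable {k : Type*} [CommRing k] {n : ℕ}

theorem x_mul_x {i j : Fin n} (h : i ≠ j) : (x i * x j : OPol k n) = -(x j * x i) :=
  eq_neg_of_add_eq_zero_left (x_anticomm h)

theorem anticomm_x : Anticomm (x : Fin n → OPol k n) := fun _ _ h => x_mul_x h

/-- The twisted variables `x̃_i`. -/
def y (i : Fin n) : OPol k n := twist (x i)

theorem y_eq (i : Fin n) : (y i : OPol k n) = (-1) ^ (i : ℕ) * x i := by
  simp [y, twist, Algebra.smul_def]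

theorem y_eq_smul (i : Fin n) : (y i : OPol k n) = (-1 : k) ^ (i : ℕ) • x i := by
  simp [y, twist]

theorem x_eq_smul (i : Fin n) : (x i : OPol k n) = (-1 : k) ^ (i : ℕ) • y i := by
  rw [y_eq_smul, smul_smul, ← mul_pow]; simp

theorem y_mul_y {i j : Fin n} (h : i ≠ j) : (y i * y j : OPol k n) = -(y j * y i) := by
  rw [y, y, ← map_mul, x_mul_x h, map_neg, map_mul]

theorem anticomm_y : Anticomm (y : Fin n → OPol k n) := fun _ _ h => y_mul_y h

theorem algHom_ext {A : Type*} [Ring A] [Algebra k A] (F G : OPol k n →ₐ[k] A)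
    (hx : ∀ i, F (x i) = G (x i)) : F = G := by
  ext f
  induction f using induction with
  | hc r => simp
  | hx i => exact hx i
  | hadd f g hf hg => rw [map_add, map_add, hf, hg]
  | hmul f g hf hg => rw [map_mul, map_mul, hf, hg]

/-- The action of a variable on the free module on exponents. -/
noncomputable def regRepAux (i : Fin n) : Module.End k ((Fin n → ℕ) →₀ k) :=
  Finsupp.lsum k fun a => (-1 : k) ^ (∑ j ∈ Finset.Iio i, a j) •
    Finsupp.lsingle (a + Pi.single i 1)

theorem regRepAux_single (i : Fin n) (a : Fin n → ℕ) (r : k) :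
    regRepAux i (Finsupp.single a r) =
      (-1 : k) ^ (∑ j ∈ Finset.Iio i, a j) • Finsupp.single (a + Pi.single i 1) r := by
  simp [regRepAux]

/-- For i < j the sign of x_j counts the exponent of x_i, while the sign of x_i does not see x_j.
The two orders therefore differ by exactly one sign. -/
theorem regRepAux_anticomm (i j : Fin n) (h : i ≠ j) :
    (regRepAux i * regRepAux j + regRepAux j * regRepAux i :
      Module.End k ((Fin n → ℕ) →₀ k)) = 0 := by
  wlog hij : i < j generalizing i j
  · rw [add_comm]; exact this j i h.symm (lt_of_le_of_ne (not_lt.mp hij) h.symm)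
  refine Finsupp.lhom_ext fun a r => ?_
  simp only [LinearMap.add_apply, Module.End.mul_apply, regRepAux_single, map_smul, smul_smul,
    LinearMap.zero_apply, Pi.add_apply, Finset.sum_add_distrib, sum_pi_single_one,
    Finset.mem_Iio, hij, hij.not_gt, if_true, if_false, add_right_comm a (Pi.single j 1)]
  rw [← add_smul, add_zero, pow_add, pow_one, ← mul_assoc, mul_neg_one,
    mul_comm ((-1 : k) ^ ∑ l ∈ Finset.Iio i, a l), add_neg_cancel, zero_smul]

/-- `OPol_n` acting on the free module on exponents. -/
noncomputable def regRep : OPol k n →ₐ[k] Module.End k ((Fin n → ℕ) →₀ k) :=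
  lift (k := k) (A := Module.End k ((Fin n → ℕ) →₀ k)) regRepAux regRepAux_anticomm

theorem regRep_mono (a : Fin n → ℕ) :
    regRep (mono x a : OPol k n) (Finsupp.single 0 1) = Finsupp.single a 1 := by
  induction h : ∑ i, a i generalizing a with
  | zero =>
    obtain rfl : a = 0 := by
      ext i
      exact (Finset.sum_eq_zero_iff.mp h) i (Finset.mem_univ i)
    simp
  | succ N ih =>
    obtain ⟨i, hi⟩ : ∃ i, a i ≠ 0 := by
      by_contra! h'
      simp [h'] at h
    obtain ⟨b, rfl⟩ : ∃ b : Fin n → ℕ, a = b + Pi.single i 1 := by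
      refine ⟨a - Pi.single i 1, (tsub_add_cancel_of_le ?_).symm⟩
      intro j
      by_cases hj : j = i
      · subst hj; simpa using Nat.one_le_iff_ne_zero.mpr hi
      · simp [hj]
    have hb : ∑ i, b i = N := by simpa [Finset.sum_add_distrib] using h
    have h1 := mul_mono (anticomm_x (k := k)) i b
    have h2 : (mono x (b + Pi.single i 1) : OPol k n) =
        (-1 : k) ^ (∑ j ∈ Finset.Iio i, b j) • (x i * mono x b) := by
      rw [h1, Algebra.smul_def, map_pow, map_neg, map_one, ← mul_assoc, ← pow_add,
        Even.neg_one_pow ⟨_, rfl⟩, one_mul]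
    rw [h2, map_smul, map_mul, LinearMap.smul_apply, Module.End.mul_apply, ih b hb]
    simp only [regRep, lift_x, regRepAux_single, smul_smul, ← mul_pow]
    simp

/-- The relations alone do not show that ordered monomials stay independent. The action on a free
module does: the monomial of exponent a sends the basis vector of 0 to that of a. -/
theorem linearIndependent_mono :
    LinearIndependent k (fun a : Fin n → ℕ => (mono x a : OPol k n)) := by
  have h : LinearIndependent k (((LinearMap.applyₗ (Finsupp.single (0 : Fin n → ℕ) (1 : k))) ∘ₗ
      regRep.toLinearMap) ∘ (fun a : Fin n → ℕ => (mono x a : OPol k n))) := by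
    have : (((LinearMap.applyₗ (Finsupp.single (0 : Fin n → ℕ) (1 : k))) ∘ₗ
      regRep.toLinearMap) ∘ (fun a : Fin n → ℕ => (mono x a : OPol k n))) =
      fun a => Finsupp.single a (1 : k) := funext fun a => regRep_mono a
    rw [this]
    exact (Finsupp.basisSingleOne (R := k) (ι := Fin n → ℕ)).linearIndependent
  exact h.of_comp _

theorem mono_y (a : Fin n → ℕ) :
    (mono y a : OPol k n) = (-1 : k) ^ (∑ i : Fin n, (i : ℕ) * a i) • mono x a := by
  have : ∀ (m : ℕ) (z : Fin m → OPol k n) (c : Fin m → ℕ) (a : Fin m → ℕ),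
      mono (fun i => (-1 : k) ^ c i • z i) a = (-1 : k) ^ (∑ i, c i * a i) • mono z a := by
    intro m
    induction m with
    | zero => simp [mono]
    | succ m ih =>
      intro z c a
      rw [mono_succ, mono_succ z, ih, Fin.sum_univ_succ, smul_pow, smul_mul_smul_comm, pow_add,
        pow_mul]
  have h := this n x (fun i => i) a
  rw [← h]
  congr 1
  ext i
  exact y_eq_smul i

end OPol

/-! ### Relations between odd divided differences -/

section DivDiff

variable {k : Type*} [CommRing k] {n : ℕ}

theorem skewDer_one (w : Equiv.Perm (Fin n)) (y : Fin n → OPol k n)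
    (h : ∀ i j, i ≠ j → (y i * x j - x (w i) * y j) + (y j * x i - x (w j) * y i) = 0) :
    skewDer w y h 1 = 0 := by
  have := skewDer_mul w y h 1 1
  simpa using this

/-- The odd divided difference attached to the transposition of two arbitrary variables. -/
def dd (a b : Fin n) : OPol k n →ₗ[k] OPol k n :=
  skewDer (Equiv.swap a b) (fun j => if j = a ∨ j = b then 1 else 0) (by
    have key : ∀ i j : Fin n, (i = a ∨ i = b) → i ≠ j → (j = a ∨ j = b) →
        Equiv.swap a b i = j := by
      rintro i j (rfl | rfl) h (rfl | rfl) <;> simp_all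
    have key' : ∀ j : Fin n, ¬ (j = a ∨ j = b) → Equiv.swap a b j = j := fun j h => by
      rw [not_or] at h
      exact Equiv.swap_apply_of_ne_of_ne h.1 h.2
    intro i j hij
    by_cases h1 : i = a ∨ i = b <;> by_cases h2 : j = a ∨ j = b
    · simp [h1, h2, key i j h1 hij h2, key j i h2 hij.symm h1]
    · simp [h1, h2, key' j h2]
    · simp [h1, h2, key' i h1]
    · simp [h1, h2])

/-- The signed transposition `σ` with `∂(f g) = ∂(f) g + σ(f) ∂(g)`. -/
def sig (a b : Fin n) : OPol k n →ₐ[k] OPol k n := signedPerm (fun _ => -1) (Equiv.swap a b)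

theorem sig_x (a b j : Fin n) : sig a b (x j : OPol k n) = -x (Equiv.swap a b j) := by
  simp [sig]

@[simp] theorem dd_one (a b : Fin n) : dd a b (1 : OPol k n) = 0 := skewDer_one _ _ _

theorem dd_x (a b j : Fin n) : dd a b (x j : OPol k n) = if j = a ∨ j = b then 1 else 0 :=
  skewDer_x _ _ _ _

theorem dd_mul (a b : Fin n) (f g : OPol k n) :
    dd a b (f * g) = dd a b f * g + sig a b f * dd a b g := by
  have h : sig a b f = signedPerm (fun _ => 1) (Equiv.swap a b) (parity f) := by
    have : sig (k := k) a b = (signedPerm (fun _ => 1) (Equiv.swap a b)).comp parity :=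
      algHom_ext _ _ fun i => by simp [sig]
    rw [this]; rfl
  rw [h]
  exact skewDer_mul _ _ _ _ _

theorem dd_comm (a b : Fin n) : (dd a b : OPol k n →ₗ[k] OPol k n) = dd b a := by
  unfold dd
  congr 1
  · exact Equiv.swap_comm a b
  · simp only [or_comm]

theorem divDiff_eq_dd {i : ℕ} (h : i + 1 < n) :
    (divDiff i : OPol k n →ₗ[k] OPol k n) = dd ⟨i, by omega⟩ ⟨i + 1, h⟩ := by
  simp only [divDiff, dif_pos h, dd, Fin.ext_iff]

theorem sig_sig (a b c d : Fin n) (f : OPol k n) :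
    sig c d (sig a b f) = sig (Equiv.swap c d a) (Equiv.swap c d b) (sig c d f) := by
  have : (sig c d).comp (sig a b) =
      (sig (k := k) (Equiv.swap c d a) (Equiv.swap c d b)).comp (sig c d) :=
    algHom_ext _ _ fun i => by
      simp [sig_x, Equiv.swap_apply_apply, Equiv.Perm.mul_apply]
  exact DFunLike.congr_fun this f

theorem sig_sig_self (a b : Fin n) (f : OPol k n) : sig a b (sig a b f) = f := by
  have : (sig a b).comp (sig a b) = AlgHom.id k (OPol k n) :=
    algHom_ext _ _ fun i => by simp [sig_x]
  exact DFunLike.congr_fun this f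

/-- Conjugation relabels the indices, and the sign comes from `sig` being odd on variables. The
relabelled pair need not be adjacent, so `dd` has to be available for arbitrary pairs. -/
theorem sig_dd (a b c d : Fin n) (f : OPol k n) :
    sig c d (dd a b f) = -dd (Equiv.swap c d a) (Equiv.swap c d b) (sig c d f) := by
  induction f using induction with
  | hc r => simp [Algebra.algebraMap_eq_smul_one]
  | hx i =>
    rw [dd_x, sig_x, map_neg, neg_neg, dd_x]
    simp only [EmbeddingLike.apply_eq_iff_eq]
    split_ifs <;> simp
  | hadd f g hf hg => simp only [map_add, hf, hg]; abel
  | hmul f g hf hg =>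
    rw [dd_mul, map_add, map_mul, map_mul, map_mul, hf, hg, dd_mul, sig_sig]
    simp only [neg_mul, mul_neg, neg_add]

theorem dd_dd_x (a b c d j : Fin n) : dd a b (dd c d (x j : OPol k n)) = 0 := by
  rw [dd_x]; split_ifs <;> simp

theorem dd_dd_self (a b : Fin n) (f : OPol k n) : dd a b (dd a b f) = 0 := by
  induction f using induction with
  | hc r => simp [Algebra.algebraMap_eq_smul_one]
  | hx i => exact dd_dd_x _ _ _ _ _
  | hadd f g hf hg => simp only [map_add, hf, hg, add_zero]
  | hmul f g hf hg =>
    have h := sig_dd a b a b f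
    rw [Equiv.swap_apply_left, Equiv.swap_apply_right, dd_comm b a] at h
    simp only [dd_mul, map_add, hf, hg, h]
    simp

theorem dd_dd_disjoint {a b c d : Fin n} (hac : a ≠ c) (had : a ≠ d) (hbc : b ≠ c) (hbd : b ≠ d)
    (f : OPol k n) : dd a b (dd c d f) = -dd c d (dd a b f) := by
  induction f using induction with
  | hc r => simp [Algebra.algebraMap_eq_smul_one]
  | hx i => simp only [dd_dd_x, neg_zero]
  | hadd f g hf hg => simp only [map_add, hf, hg]; abel
  | hmul f g hf hg =>
    have h := sig_dd c d a b f
    have h' := sig_dd a b c d f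
    have h'' := sig_sig c d a b f
    rw [Equiv.swap_apply_of_ne_of_ne hac.symm hbc.symm,
      Equiv.swap_apply_of_ne_of_ne had.symm hbd.symm] at h h''
    rw [Equiv.swap_apply_of_ne_of_ne hac had, Equiv.swap_apply_of_ne_of_ne hbc hbd] at h'
    simp only [dd_mul, map_add, hf, hg, h, h', h'']
    simp only [neg_mul, mul_neg]
    abel

/-- In the Leibniz expansion on a product, the three composites of signed transpositions are the
same 3-cycle, and by `sig_dd` the mixed terms cancel in pairs. On variables every double difference
vanishes. -/
theorem dd_cyclic {a b c : Fin n} (hab : a ≠ b) (hac : a ≠ c) (hbc : b ≠ c) (f : OPol k n) :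
    dd b c (dd a b f) + dd a b (dd a c f) + dd a c (dd b c f) = 0 := by
  induction f using induction with
  | hc r => simp [Algebra.algebraMap_eq_smul_one]
  | hx i => simp only [dd_dd_x, add_zero]
  | hadd f g hf hg =>
    have := congrArg₂ (· + ·) hf hg
    simp only [add_zero] at this
    rw [← this]
    simp only [map_add]
    abel
  | hmul f g hf hg =>
    have e1 := sig_dd a b b c f
    have e2 := sig_dd a c a b f
    have e3 := sig_dd b c a c f
    have s1 := sig_sig a b b c f
    have s2 := sig_sig a c a b f
    have s3 := sig_sig b c a c f
    simp only [Equiv.swap_apply_left, Equiv.swap_apply_right,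
      Equiv.swap_apply_of_ne_of_ne hab hac, Equiv.swap_apply_of_ne_of_ne hac.symm hbc.symm,
      Equiv.swap_apply_of_ne_of_ne hab.symm hbc] at e1 e2 e3 s1 s2 s3
    rw [dd_comm b a] at e3
    have hf' : dd b c (dd a b f) = -dd a b (dd a c f) - dd a c (dd b c f) := by
      rw [← sub_eq_zero, ← hf]; abel
    have hg' : dd b c (dd a b g) = -dd a b (dd a c g) - dd a c (dd b c g) := by
      rw [← sub_eq_zero, ← hg]; abel
    simp only [dd_mul, map_add, hf', hg', e1, e2, e3, s2, ← s1]
    simp only [neg_mul, mul_neg, sub_mul, mul_sub]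
    abel

/-- Moving `sig a b` to the left everywhere turns this into the image of `dd_cyclic` under `sig a
b`. It matches the mixed terms of the braid relation in which two differences hit the first factor.
-/
theorem dd_braid_aux {a b c : Fin n} (hab : a ≠ b) (hac : a ≠ c) (hbc : b ≠ c) (f : OPol k n) :
    sig a b (dd b c (dd a b f)) + dd a b (dd b c (sig a b f)) = dd b c (sig a b (dd b c f)) := by
  have h1 : ∀ g : OPol k n, dd b c (sig a b g) = -sig a b (dd a c g) := fun g => by
    rw [sig_dd, Equiv.swap_apply_left, Equiv.swap_apply_of_ne_of_ne hac.symm hbc.symm, neg_neg]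
  have h2 : ∀ g : OPol k n, dd a b (sig a b g) = -sig a b (dd a b g) := fun g => by
    rw [sig_dd, Equiv.swap_apply_left, Equiv.swap_apply_right, dd_comm b a, neg_neg]
  rw [h1, h1, map_neg, h2, neg_neg, eq_neg_iff_add_eq_zero, ← map_add, ← map_add,
    dd_cyclic hab hac hbc, map_zero]

/-- Both sides vanish on variables. On a product the terms are compared according to the differences
falling on g: one difference needs `dd_braid_aux` (also with a and c exchanged), two need `g1` and
`g2`, three need the braid relation `g3` for the signed transpositions. -/
theorem dd_braid {a b c : Fin n} (hab : a ≠ b) (hac : a ≠ c) (hbc : b ≠ c) (f : OPol k n) :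
    dd a b (dd b c (dd a b f)) = dd b c (dd a b (dd b c f)) := by
  induction f using induction with
  | hc r => simp [Algebra.algebraMap_eq_smul_one]
  | hx i => simp only [dd_dd_x, map_zero]
  | hadd f g hf hg => simp only [map_add, hf, hg]
  | hmul f g hf hg =>
    have e1 := dd_braid_aux hab hac hbc f
    have e2 := dd_braid_aux hbc.symm hac.symm hab.symm f
    have h1 : ∀ g : OPol k n, dd b c (sig a b g) = -sig a b (dd a c g) := fun g => by
      rw [sig_dd, Equiv.swap_apply_left, Equiv.swap_apply_of_ne_of_ne hac.symm hbc.symm, neg_neg]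
    have h2 : ∀ g : OPol k n, dd a b (sig b c g) = -sig b c (dd a c g) := fun g => by
      rw [sig_dd, Equiv.swap_apply_right, Equiv.swap_apply_of_ne_of_ne hab hac, neg_neg]
    have h3 : ∀ g : OPol k n, dd a c (sig a b g) = -sig a b (dd b c g) := fun g => by
      rw [sig_dd, Equiv.swap_apply_right, Equiv.swap_apply_of_ne_of_ne hac.symm hbc.symm, neg_neg]
    have h4 : ∀ g : OPol k n, dd a c (sig b c g) = -sig b c (dd a b g) := fun g => by
      rw [sig_dd, Equiv.swap_apply_left, Equiv.swap_apply_of_ne_of_ne hab hac, neg_neg]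
    have g1 : dd a b (sig b c (sig a b f)) = sig b c (sig a b (dd b c f)) := by
      rw [h2, h3, map_neg, neg_neg]
    have g2 : dd b c (sig a b (sig b c f)) = sig a b (sig b c (dd a b f)) := by
      rw [h1, h4, map_neg, neg_neg]
    have g3 : sig a b (sig b c (sig a b f)) = sig b c (sig a b (sig b c f)) := by
      rw [sig_sig b c a b, sig_sig a b b c, sig_sig_self, sig_sig_self]
      simp only [Equiv.swap_apply_left, Equiv.swap_apply_right,
        Equiv.swap_apply_of_ne_of_ne hab hac, Equiv.swap_apply_of_ne_of_ne hac.symm hbc.symm]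
    have c1 : sig c b = (sig b c : OPol k n →ₐ[k] OPol k n) := by
      unfold sig; rw [Equiv.swap_comm]
    rw [dd_comm c b, dd_comm b a, c1] at e2
    simp only [dd_mul, map_add, dd_dd_self, hf, hg, ← e1, ← e2, g1, g2, g3]
    simp only [add_mul, mul_zero]
    abel

end DivDiff

/-! ### Words in odd nil-Hecke generators -/

section Words

variable {A : Type*} [Ring A]

/-- The descending product `p_{m-1} ⋯ p_0`. -/
def down (p : ℕ → A) : ℕ → A
  | 0 => 1
  | m + 1 => p m * down p m

/-- The product for the longest element of the symmetric group on `m` letters. -/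
def long (p : ℕ → A) : ℕ → A
  | 0 => 1
  | m + 1 => long p m * down p m

/-- The odd nil-Coxeter relations. -/
structure IsOddNil (p : ℕ → A) : Prop where
  sq : ∀ i, p i * p i = 0
  far : ∀ i j, i + 1 < j → p j * p i = -(p i * p j)
  braid : ∀ i, p i * p (i + 1) * p i = p (i + 1) * p i * p (i + 1)

variable {p : ℕ → A}

theorem IsOddNil.mul_down (hp : IsOddNil p) {l m : ℕ} (h : m < l) :
    p l * down p m = (-1) ^ m * (down p m * p l) := by
  induction m with
  | zero => simp [down]
  | succ m ih =>
    rw [down, ← mul_assoc, hp.far m l h, neg_mul, mul_assoc, ih (by omega), ← mul_assoc (p m),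
      neg_one_pow_mul_comm, pow_succ]
    simp [mul_assoc]

theorem IsOddNil.down_mul_zero (hp : IsOddNil p) (m : ℕ) : down p (m + 1) * p 0 = 0 := by
  induction m with
  | zero => simpa [down] using hp.sq 0
  | succ m ih => rw [down, mul_assoc, ih, mul_zero]

/-- The generator passes the low factors up to sign, the braid relation lowers its index by one, and
the result passes the remaining high factors up to sign. -/
theorem IsOddNil.down_mul_succ (hp : IsOddNil p) {j m : ℕ} (h : j + 1 < m) :
    down p m * p (j + 1) = (-1) ^ m * (p j * down p m) := by
  induction m with
  | zero => omega
  | succ m ih =>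
    rcases Nat.lt_succ_iff_lt_or_eq.mp h with h | rfl
    · rw [down, mul_assoc, ih h, ← mul_assoc, neg_one_pow_mul_comm, mul_assoc, ← mul_assoc (p m),
        hp.far j m h, pow_succ]
      simp [mul_assoc]
    · have h1 : down p j * p (j + 1) = (-1) ^ j * (p (j + 1) * down p j) := by
        rw [hp.mul_down (Nat.lt_succ_self j), ← mul_assoc, ← pow_add, Even.neg_one_pow ⟨_, rfl⟩,
          one_mul]
      have h2 : p (j + 1) * (p j * (p (j + 1) * down p j)) =
          p j * (p (j + 1) * (p j * down p j)) := by
        have := congrArg (· * down p j) (hp.braid j)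
        simp only [mul_assoc] at this
        exact this.symm
      rw [down, down, mul_assoc, mul_assoc, h1, ← mul_assoc (p j), neg_one_pow_mul_comm, mul_assoc,
        ← mul_assoc (p (j + 1)), neg_one_pow_mul_comm, mul_assoc, h2, pow_add, pow_add]
      simp

/-- Each crossing of a descending block lowers the index, until `p 0` meets a block that it
annihilates. -/
theorem IsOddNil.long_mul (hp : IsOddNil p) {N j : ℕ} (h : j + 1 < N) : long p N * p j = 0 := by
  induction N generalizing j with
  | zero => omega
  | succ N ih =>
    rw [long, mul_assoc]
    cases j with
    | zero =>
      obtain ⟨N, rfl⟩ : ∃ M, N = M + 1 := ⟨N - 1, by omega⟩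
      rw [hp.down_mul_zero, mul_zero]
    | succ j =>
      rw [hp.down_mul_succ (by omega), ← mul_assoc, neg_one_pow_mul_comm, mul_assoc,
        ← mul_assoc (long p N), ih (by omega), zero_mul, mul_zero]

/-- The relations between the `p_i` and multiplication operators `Y_j`, for `i + 1 < n`. -/
structure IsOddHecke (n : ℕ) (p Y : ℕ → A) : Prop extends IsOddNil p where
  ε : ∀ i, i + 1 < n → Y (i + 1) * p i = p i * Y i - (-1) ^ i
  add : ∀ i, i + 1 < n → (Y i + Y (i + 1)) * p i = p i * (Y i + Y (i + 1))
  comm : ∀ i j, i + 1 < n → j ≠ i → j ≠ i + 1 → Y j * p i = -(p i * Y j)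

/-- The commutation relation of a twisted differential with the `p_i`, for `i + 1 < n`. -/
def IsTwistedDiff (n : ℕ) (p Y : ℕ → A) (Δ : A) : Prop :=
  ∀ i, i + 1 < n → Δ * p i = -(p i * (Δ - Y i - Y (i + 1)))

variable {Y : ℕ → A} {n : ℕ} {Δ : A}

theorem IsOddHecke.sum_mul (h : IsOddHecke n p Y) {i : ℕ} (hi : i + 1 < n) (s : Finset ℕ)
    (hs : ∀ j ∈ s, j ≠ i ∧ j ≠ i + 1) : (∑ j ∈ s, Y j) * p i = -(p i * ∑ j ∈ s, Y j) := by
  rw [Finset.sum_mul, Finset.mul_sum, ← Finset.sum_neg_distrib]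
  exact Finset.sum_congr rfl fun j hj => h.comm i j hi (hs j hj).1 (hs j hj).2

/-- In the total sum, Y_i + Y_{i+1} commutes with p_i and the rest anticommutes. This duality
exchanges the corrected and the uncorrected case in `IsTwistedDiff.mul_long`. -/
theorem IsTwistedDiff.dual (h : IsOddHecke n p Y) (hΔ : IsTwistedDiff n p Y Δ) :
    IsTwistedDiff n p Y ((∑ j ∈ Finset.range n, Y j) - Δ) := by
  intro i hi
  have h1 : ∑ j ∈ Finset.range n, Y j =
      (∑ j ∈ (Finset.range n).filter (fun j => j ≠ i ∧ j ≠ i + 1), Y j) + (Y i + Y (i + 1)) := by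
    rw [← Finset.sum_filter_add_sum_filter_not (Finset.range n) (fun j => j ≠ i ∧ j ≠ i + 1)]
    congr 1
    have : (Finset.range n).filter (fun j => ¬(j ≠ i ∧ j ≠ i + 1)) = {i, i + 1} := by
      ext j
      simp only [Finset.mem_filter, Finset.mem_range, Finset.mem_insert, Finset.mem_singleton]
      omega
    rw [this, Finset.sum_pair (by omega)]
  have h2 := h.sum_mul hi ((Finset.range n).filter (fun j => j ≠ i ∧ j ≠ i + 1))
    (fun j hj => (Finset.mem_filter.mp hj).2)
  rw [h1, sub_mul, add_mul, h2, h.add i hi, hΔ i hi]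
  noncomm_ring

/-- The descending word is crossed two letters at a time, so that the signs cancel and the tail of
Y's grows by two. Crossing a single letter leaves a constant term, and the vanishing assumption on Q
is there to kill it. -/
theorem IsTwistedDiff.mul_down_aux (h : IsOddHecke n p Y) (hΔ : IsTwistedDiff n p Y Δ) (t : ℕ)
    (ht : 2 * t < n) (Q : A) (hQ : ∀ j, j + 1 < 2 * t → Q * p j = 0) :
    Q * (Δ - ∑ j ∈ Finset.Ico (2 * t) n, Y j) * down p (2 * t) =
      Q * down p (2 * t) * (Δ - ∑ j ∈ Finset.range n, Y j) := by
  induction t generalizing Q with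
  | zero => simp [down]
  | succ t ih =>
    have e : 2 * (t + 1) = 2 * t + 1 + 1 := by ring
    rw [e] at ht hQ ⊢
    have h1 : ∑ j ∈ Finset.Ico (2 * t + 1 + 1) n, Y j =
        Y (2 * t + 1 + 1) + ∑ j ∈ Finset.Ico (2 * t + 1 + 1 + 1) n, Y j :=
      Finset.sum_eq_sum_Ico_succ_bot (by omega) _
    have h2 : ∑ j ∈ Finset.Ico (2 * t) n, Y j =
        Y (2 * t) + (Y (2 * t + 1) + ∑ j ∈ Finset.Ico (2 * t + 1 + 1) n, Y j) := by
      rw [Finset.sum_eq_sum_Ico_succ_bot (by omega), Finset.sum_eq_sum_Ico_succ_bot (by omega)]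
    have h3 := h.sum_mul (i := 2 * t + 1) (by omega) (Finset.Ico (2 * t + 1 + 1 + 1) n)
      (fun j hj => by rw [Finset.mem_Ico] at hj; omega)
    have h4 := h.sum_mul (i := 2 * t) (by omega) (Finset.Ico (2 * t + 1 + 1) n)
      (fun j hj => by rw [Finset.mem_Ico] at hj; omega)
    -- The enlarged prefix is still annihilated: p_j with j + 1 < 2t is far from both new letters.
    have h5 := ih (by omega) (Q * p (2 * t + 1) * p (2 * t)) (fun j hj => by
      rw [mul_assoc, mul_assoc, h.far j (2 * t) hj, mul_neg, ← mul_assoc (p (2 * t + 1)),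
        h.far j (2 * t + 1) (by omega), neg_mul, neg_neg, ← mul_assoc, ← mul_assoc,
        hQ j (by omega), zero_mul, zero_mul])
    have h6 : (Δ - ∑ j ∈ Finset.Ico (2 * t + 1 + 1) n, Y j) * p (2 * t + 1) =
        -(p (2 * t + 1) * (Δ - ∑ j ∈ Finset.Ico (2 * t + 1 + 1) n, Y j)) + (-1) ^ (2 * t + 1) := by
      rw [h1, sub_mul, add_mul, h3, h.ε _ (by omega), hΔ _ (by omega)]
      noncomm_ring
    have h7 : (Δ - ∑ j ∈ Finset.Ico (2 * t + 1 + 1) n, Y j) * p (2 * t) =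
        -(p (2 * t) * (Δ - ∑ j ∈ Finset.Ico (2 * t) n, Y j)) := by
      rw [h2, sub_mul, h4, hΔ _ (by omega)]
      noncomm_ring
    -- The constant left by crossing p_{2t+1} is multiplied by Q p_{2t}, which is zero.
    have h8 := hQ (2 * t) (by omega)
    calc _ = Q * ((Δ - ∑ j ∈ Finset.Ico (2 * t + 1 + 1) n, Y j) * p (2 * t + 1)) * p (2 * t) *
          down p (2 * t) := by simp only [down, mul_assoc]
      _ = -(Q * p (2 * t + 1) * ((Δ - ∑ j ∈ Finset.Ico (2 * t + 1 + 1) n, Y j) * p (2 * t)) *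
          down p (2 * t)) - Q * p (2 * t) * down p (2 * t) := by
        rw [h6, Odd.neg_one_pow ⟨t, rfl⟩]; noncomm_ring
      _ = Q * p (2 * t + 1) * p (2 * t) * (Δ - ∑ j ∈ Finset.Ico (2 * t) n, Y j) *
          down p (2 * t) := by
        rw [h7, h8]; noncomm_ring
      _ = _ := by rw [h5]; simp only [down, mul_assoc]

theorem IsOddHecke.mono (h : IsOddHecke n p Y) {m : ℕ} (hm : m ≤ n) : IsOddHecke m p Y :=
  { h with
    ε := fun i hi => h.ε i (by omega)
    add := fun i hi => h.add i (by omega)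
    comm := fun i j hi => h.comm i j (by omega) }

/-- The blocks of the longest word are crossed one by one, with the earlier blocks serving as the
prefix Q of `mul_down_aux`. The correction term switches on and off with the parity of N. -/
theorem IsTwistedDiff.mul_long (h : IsOddHecke n p Y) (hΔ : IsTwistedDiff n p Y Δ) {N : ℕ}
    (hN : N ≤ n) : ∃ u : ℤˣ, Δ * long p N =
      u • (long p N * (Δ - if Even N then ∑ j ∈ Finset.range N, Y j else 0)) := by
  induction N with
  | zero => exact ⟨1, by simp [long]⟩
  | succ N ih =>
    obtain ⟨u, hu⟩ := ih (by omega)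
    have h' := h.mono hN
    have hΔ' : IsTwistedDiff (N + 1) p Y Δ := fun i hi => hΔ i (by omega)
    have hl : ∀ j, j + 1 < N → long p N * p j = 0 := fun j hj => h.long_mul hj
    rcases Nat.even_or_odd' N with ⟨t, rfl | rfl⟩
    · refine ⟨u, ?_⟩
      -- From even to odd: for the dual of Δ the two sums become the present correction and no
      -- correction, up to a common sign.
      have e1 := (hΔ'.dual h').mul_down_aux h' t (by omega) (long p (2 * t)) hl
      have e2 : (∑ j ∈ Finset.range (2 * t + 1), Y j) - Δ - ∑ j ∈ Finset.Ico (2 * t) (2 * t + 1), Y j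
          = -(Δ - ∑ j ∈ Finset.range (2 * t), Y j) := by
        simp only [Finset.sum_range_succ, Nat.Ico_succ_singleton, Finset.sum_singleton]
        abel
      have e3 : (∑ j ∈ Finset.range (2 * t + 1), Y j) - Δ - ∑ j ∈ Finset.range (2 * t + 1), Y j =
          -Δ := by simp
      rw [e2, e3, mul_neg, mul_neg, neg_mul, neg_inj] at e1
      rw [if_pos (even_two_mul t)] at hu
      rw [if_neg (by simp), long, ← mul_assoc, hu, smul_mul_assoc, e1, sub_zero]
    · refine ⟨-u, ?_⟩
      -- From odd to even: the block has odd length, so its top letter is split off and crossed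
      -- separately. This produces the two missing Y's.
      have e1 := hΔ'.mul_down_aux h' t (by omega) (long p (2 * t + 1) * p (2 * t)) (fun j hj => by
        rw [mul_assoc, h.far j _ hj, mul_neg, ← mul_assoc, hl j (by omega), zero_mul, neg_zero])
      have e2 : ∑ j ∈ Finset.Ico (2 * t) (2 * t + 1 + 1), Y j = Y (2 * t) + Y (2 * t + 1) := by
        rw [Finset.sum_eq_sum_Ico_succ_bot (by omega), Finset.sum_eq_sum_Ico_succ_bot (by omega)]
        simp
      rw [if_neg (by simp), sub_zero] at hu
      rw [if_pos ⟨t + 1, by ring⟩, long, ← mul_assoc, hu, smul_mul_assoc, down, mul_assoc,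
        ← mul_assoc Δ, hΔ' _ (by omega), Units.neg_smul, ← smul_neg]
      congr 1
      rw [e2] at e1
      calc _ = -(long p (2 * t + 1) * p (2 * t) * (Δ - (Y (2 * t) + Y (2 * t + 1))) *
            down p (2 * t)) := by rw [sub_sub]; noncomm_ring
        _ = _ := by rw [e1]; simp only [mul_assoc]

end Words

/-! ### The twisted differential and its commutation with divided differences -/

section Twisted

variable {k : Type*} [CommRing k] {n : ℕ}

theorem induction_y {P : OPol k n → Prop} (hc : ∀ r : k, P (algebraMap k _ r))
    (hy : ∀ i, P (y i)) (hadd : ∀ f g, P f → P g → P (f + g))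
    (hmul : ∀ f g, P f → P g → P (f * g)) (f : OPol k n) : P f := by
  induction f using induction with
  | hc r => exact hc r
  | hx i =>
    rw [x_eq_smul, Algebra.smul_def]
    exact hmul _ _ (hc _) (hy i)
  | hadd f g hf hg => exact hadd f g hf hg
  | hmul f g hf hg => exact hmul f g hf hg

/-- The odd derivation with `x_i ↦ (-1)^{i-1} x_i ^ 2`. -/
def dTwist : OPol k n →ₗ[k] OPol k n :=
  skewDer 1 (fun j => (-1 : k) ^ (j : ℕ) • x j ^ 2) fun i j h => by
    simp [sq_comm h, sq_comm h.symm]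

theorem dTwist_mul (f g : OPol k n) : dTwist (f * g) = dTwist f * g + parity f * dTwist g := by
  have := skewDer_mul (k := k) (n := n) 1 (fun j => (-1 : k) ^ (j : ℕ) • x j ^ 2)
    (fun i j h => by simp [sq_comm h, sq_comm h.symm]) f g
  rw [signedPerm_one] at this
  exact this

@[simp] theorem dTwist_one : dTwist (1 : OPol k n) = 0 := skewDer_one _ _ _

theorem dTwist_y (i : Fin n) : dTwist (y i : OPol k n) = y i ^ 2 := by
  rw [y_eq_smul, map_smul, dTwist, skewDer_x, smul_pow, smul_smul, ← pow_mul, ← pow_add,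
    mul_two]

theorem parity_y (i : Fin n) : parity (y i : OPol k n) = -y i := by
  rw [y_eq_smul, map_smul, parity_x, smul_neg]

theorem dd_y (a b j : Fin n) :
    dd a b (y j : OPol k n) = if j = a ∨ j = b then (-1) ^ (j : ℕ) else 0 := by
  rw [y_eq, ← map_one (algebraMap k _), ← map_neg, ← map_pow, ← Algebra.smul_def, map_smul, dd_x]
  split_ifs
  · rw [Algebra.smul_def, mul_one]
  · simp

theorem sig_y (a b j : Fin n) :
    sig a b (y j : OPol k n) =
      -((-1 : k) ^ (j : ℕ) * (-1) ^ (Equiv.swap a b j : ℕ)) • y (Equiv.swap a b j) := by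
  rw [y_eq_smul, map_smul, sig_x, y_eq_smul, smul_neg, neg_smul, smul_smul, mul_assoc, ← mul_pow]
  simp

theorem sig_parity (a b : Fin n) (f : OPol k n) : sig a b (parity f) = parity (sig a b f) := by
  have : (sig a b).comp parity = (parity (k := k)).comp (sig a b) :=
    algHom_ext _ _ fun i => by simp [sig_x]
  exact DFunLike.congr_fun this f

theorem dd_parity (a b : Fin n) (f : OPol k n) : dd a b (parity f) = -parity (dd a b f) := by
  induction f using induction with
  | hc r => simp [Algebra.algebraMap_eq_smul_one]
  | hx i => rw [parity_x, map_neg, dd_x]; split_ifs <;> simp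
  | hadd f g hf hg => simp only [map_add, hf, hg]; abel
  | hmul f g hf hg =>
    simp only [map_mul, dd_mul, hf, hg, map_add, sig_parity]; noncomm_ring

variable {a b : Fin n} (hab : (b : ℕ) = a + 1)
include hab

theorem sig_y_left : sig a b (y a : OPol k n) = y b := by
  rw [sig_y, Equiv.swap_apply_left, hab, pow_succ, mul_neg_one, mul_neg, neg_neg, ← mul_pow]
  simp

theorem sig_y_right : sig a b (y b : OPol k n) = y a := by
  rw [sig_y, Equiv.swap_apply_right, hab, pow_succ, mul_neg_one, neg_mul, neg_neg, ← mul_pow]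
  simp

omit hab in
theorem sig_y_of_ne {j : Fin n} (ha : j ≠ a) (hb : j ≠ b) : sig a b (y j : OPol k n) = -y j := by
  rw [sig_y, Equiv.swap_apply_of_ne_of_ne ha hb, ← mul_pow]
  simp

theorem dd_y_mul_left (f : OPol k n) :
    dd a b (y a * f) = (-1) ^ (a : ℕ) * f + y b * dd a b f := by
  rw [dd_mul, dd_y, if_pos (Or.inl rfl), sig_y_left hab]

theorem dd_y_mul_right (f : OPol k n) :
    dd a b (y b * f) = -((-1) ^ (a : ℕ) * f) + y a * dd a b f := by
  rw [dd_mul, dd_y, if_pos (Or.inr rfl), sig_y_right hab, hab, pow_succ]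
  simp

omit hab in
theorem dd_y_mul_of_ne {j : Fin n} (ha : j ≠ a) (hb : j ≠ b) (f : OPol k n) :
    dd a b (y j * f) = -(y j * dd a b f) := by
  rw [dd_mul, dd_y, if_neg (by tauto), sig_y_of_ne ha hb]
  simp

/-- This is the defect that appears in the Leibniz step of `dTwist_dd`. Its last term supplies
exactly what is needed to move y_a + y_b past the twisted first factor. -/
theorem sig_dTwist_aux (f : OPol k n) :
    sig a b (dTwist f) + dTwist (sig a b f) =
      (y a + y b) * sig a b f - sig a b (parity f) * (y a + y b) := by
  have hne : a ≠ b := fun h => by rw [h] at hab; omega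
  induction f using induction_y with
  | hc r => simp [Algebra.algebraMap_eq_smul_one]
  | hy i =>
    have h1 := y_mul_y (k := k) hne
    by_cases ha : i = a
    · subst ha
      rw [dTwist_y, parity_y, map_neg, map_pow, sig_y_left hab, dTwist_y, add_mul, neg_mul,
        mul_add, h1]
      noncomm_ring
    by_cases hb : i = b
    · subst hb
      rw [dTwist_y, parity_y, map_neg, map_pow, sig_y_right hab, dTwist_y, add_mul, neg_mul,
        mul_add, h1]
      noncomm_ring
    · rw [dTwist_y, parity_y, map_neg, map_pow, sig_y_of_ne ha hb, map_neg, dTwist_y, neg_neg,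
        mul_neg, add_mul, mul_add, y_mul_y ha, y_mul_y hb]
      noncomm_ring
  | hadd f g hf hg =>
    simp only [map_add]
    rw [show ∀ p q r s : OPol k n, p + q + (r + s) = (p + r) + (q + s) by intros; abel, hf, hg]
    noncomm_ring
  | hmul f g hf hg =>
    have e : parity (sig a b f) = sig a b (parity f) := (sig_parity a b f).symm
    have : sig a b (dTwist (f * g)) + dTwist (sig a b (f * g)) =
        (sig a b (dTwist f) + dTwist (sig a b f)) * sig a b g +
          sig a b (parity f) * (sig a b (dTwist g) + dTwist (sig a b g)) := by
      simp only [dTwist_mul, map_mul, map_add, e]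
      noncomm_ring
    rw [this, hf, hg, map_mul, map_mul, map_mul]
    noncomm_ring

/-- Both sides are determined by a Leibniz rule once `sig_dTwist_aux` is known, so the identity
reduces to the variables, where ∂(y_a²) = ±(y_a + y_b). -/
theorem dTwist_dd (f : OPol k n) :
    dTwist (dd a b f) + dd a b (dTwist f) = (y a + y b) * dd a b f := by
  have hne : a ≠ b := fun h => by rw [h] at hab; omega
  induction f using induction_y with
  | hc r => simp [Algebra.algebraMap_eq_smul_one]
  | hy i =>
    have h0 : ∀ N : ℕ, dTwist ((-1 : OPol k n) ^ N) = 0 := fun N => by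
      rcases neg_one_pow_eq_or (OPol k n) N with h | h <;> simp [h]
    rw [dTwist_y, dd_y, pow_two]
    by_cases ha : i = a
    · subst ha
      rw [if_pos (Or.inl rfl), h0, dd_y_mul_left hab, dd_y, if_pos (Or.inl rfl),
        neg_one_pow_mul_comm, neg_one_pow_mul_comm]
      noncomm_ring
    by_cases hb : i = b
    · subst hb
      rw [if_pos (Or.inr rfl), h0, dd_y_mul_right hab, dd_y, if_pos (Or.inr rfl),
        neg_one_pow_mul_comm, neg_one_pow_mul_comm, hab, pow_succ]
      noncomm_ring
    · rw [if_neg (by tauto), dd_y_mul_of_ne ha hb, dd_y, if_neg (by tauto)]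
      simp
  | hadd f g hf hg =>
    simp only [map_add, mul_add]
    rw [show ∀ p q r s : OPol k n, p + q + (r + s) = (p + r) + (q + s) by intros; abel, hf, hg]
  | hmul f g hf hg =>
    have h1 := sig_dTwist_aux (k := k) hab f
    have : dTwist (dd a b (f * g)) + dd a b (dTwist (f * g)) =
        (dTwist (dd a b f) + dd a b (dTwist f)) * g +
          (sig a b (dTwist f) + dTwist (sig a b f)) * dd a b g +
          sig a b (parity f) * (dTwist (dd a b g) + dd a b (dTwist g)) := by
      simp only [dTwist_mul, dd_mul, map_add, dd_parity, sig_parity]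
      noncomm_ring
    rw [this, hf, hg, h1, dd_mul]
    noncomm_ring

end Twisted

/-! ### The odd nil-Hecke relations as operators on skew polynomials -/

section Hecke

variable (k : Type*) [CommRing k] (n : ℕ)

/-- The odd divided differences as elements of the endomorphism ring. -/
def dOp (i : ℕ) : Module.End k (OPol k n) := divDiff i

/-- Multiplication by the twisted variables; zero out of range. -/
def yOp (j : ℕ) : Module.End k (OPol k n) :=
  if h : j < n then LinearMap.mulLeft k (y ⟨j, h⟩) else 0

variable {k n}

theorem dOp_apply {i : ℕ} (h : i + 1 < n) (f : OPol k n) :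
    dOp k n i f = dd ⟨i, by omega⟩ ⟨i + 1, h⟩ f := by
  rw [dOp, divDiff_eq_dd h]

theorem dOp_of_not_lt {i : ℕ} (h : ¬ i + 1 < n) : dOp k n i = 0 := by
  simp [dOp, divDiff, h]

theorem yOp_apply {j : ℕ} (h : j < n) (f : OPol k n) : yOp k n j f = y ⟨j, h⟩ * f := by
  simp [yOp, h]

theorem isOddNil_dOp : IsOddNil (dOp k n) where
  sq i := by
    ext f
    by_cases h : i + 1 < n
    · simp [Module.End.mul_apply, dOp_apply h, dd_dd_self]
    · simp [dOp_of_not_lt h]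
  far i j hij := by
    ext f
    by_cases h : j + 1 < n
    · have h' : i + 1 < n := by omega
      simp only [Module.End.mul_apply, dOp_apply h, dOp_apply h', LinearMap.neg_apply]
      exact dd_dd_disjoint (by simp; omega) (by simp; omega) (by simp; omega) (by simp; omega) f
    · simp [dOp_of_not_lt h]
  braid i := by
    ext f
    by_cases h : i + 1 + 1 < n
    · have h' : i + 1 < n := by omega
      simp only [Module.End.mul_apply, dOp_apply h, dOp_apply h']
      exact dd_braid (by simp) (by simp; omega) (by simp) f
    · simp [dOp_of_not_lt h]

theorem isOddHecke_dOp : IsOddHecke n (dOp k n) (yOp k n) where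
  toIsOddNil := isOddNil_dOp
  ε i h := by
    ext f
    have h' : ∀ N, ((-1 : Module.End k (OPol k n)) ^ N) f = (-1) ^ N * f := fun N => by
      induction N with
      | zero => simp
      | succ N ih =>
        rw [pow_succ', Module.End.mul_apply, ih, pow_succ', LinearMap.neg_apply]
        simp
    simp only [Module.End.mul_apply, LinearMap.sub_apply, dOp_apply h, yOp_apply h,
      yOp_apply (Nat.lt_of_succ_lt h), h', dd_y_mul_left (a := ⟨i, Nat.lt_of_succ_lt h⟩) (b := ⟨i + 1, h⟩) rfl]
    simp
  add i h := by
    ext f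
    simp only [Module.End.mul_apply, LinearMap.add_apply, map_add, dOp_apply h, yOp_apply h,
      yOp_apply (Nat.lt_of_succ_lt h), dd_y_mul_left (a := ⟨i, Nat.lt_of_succ_lt h⟩) (b := ⟨i + 1, h⟩) rfl,
      dd_y_mul_right (a := ⟨i, Nat.lt_of_succ_lt h⟩) (b := ⟨i + 1, h⟩) rfl]
    abel
  comm i j h hi hi' := by
    ext f
    by_cases hj : j < n
    · simp only [Module.End.mul_apply, LinearMap.neg_apply, dOp_apply h, yOp_apply hj]
      rw [dd_y_mul_of_ne (by simpa using hi) (by simpa using hi'), neg_neg]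
    · simp [yOp, hj]

theorem isTwistedDiff_dTwist :
    IsTwistedDiff n (dOp k n) (yOp k n) (dTwist : Module.End k (OPol k n)) := by
  intro i h
  have h1 := (isOddHecke_dOp (k := k) (n := n)).add i h
  have h2 : (dTwist : Module.End k (OPol k n)) * dOp k n i + dOp k n i * dTwist =
      (yOp k n i + yOp k n (i + 1)) * dOp k n i := by
    ext f
    simp only [Module.End.mul_apply, LinearMap.add_apply, dOp_apply h, yOp_apply h,
      yOp_apply (Nat.lt_of_succ_lt h)]
    rw [dTwist_dd (a := ⟨i, Nat.lt_of_succ_lt h⟩) (b := ⟨i + 1, h⟩) rfl, add_mul]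
  rw [h1, ← eq_sub_iff_add_eq] at h2
  rw [h2, sub_sub, mul_sub, neg_sub]

theorem divDiffLongest_eq : (divDiffLongest : Module.End k (OPol k n)) = long (dOp k n) n := by
  have h1 : ∀ m, ((List.range m).reverse.map fun i => (divDiff i : Module.End k (OPol k n))).prod =
      down (dOp k n) m := by
    intro m
    induction m with
    | zero => rfl
    | succ m ih => 
      rw [List.range_succ, List.reverse_append, List.map_append, List.prod_append, ih, down]
      simp [dOp]
  have h2 : ∀ m, ((List.range m).map fun m =>
      ((List.range (m + 1)).reverse.map fun i => (divDiff i : Module.End k (OPol k n))).prod).prod =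
      long (dOp k n) (m + 1) := by
    intro m
    induction m with
    | zero => simp [long, down]
    | succ m ih => 
      rw [List.range_succ, List.map_append, List.prod_append, ih, List.map_singleton,
        List.prod_singleton, h1, long, long, long]
  rw [divDiffLongest, h2]
  cases n with
  | zero => simp [long, down]
  | succ n => rfl

end Hecke

/-! ### The longest divided difference on monomials; twisted elementary polynomials -/

section Longest

variable {k : Type*} [CommRing k] {n : ℕ}

theorem map_neg_one_pow_mul (F : OPol k n →ₗ[k] OPol k n) (N : ℕ) (f : OPol k n) :
    F ((-1) ^ N * f) = (-1) ^ N * F f := by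
  rcases neg_one_pow_eq_or (OPol k n) N with h | h <;> simp [h]

theorem neg_one_pow_mul_self (N : ℕ) (f : OPol k n) : (-1) ^ N * ((-1) ^ N * f) = f := by
  rw [← mul_assoc, ← pow_add, Even.neg_one_pow ⟨_, rfl⟩, one_mul]

theorem mono_y_add_single (i : Fin n) (a : Fin n → ℕ) : (mono y (a + Pi.single i 1) : OPol k n) =
    (-1) ^ (∑ j ∈ Finset.Iio i, a j) * (y i * mono y a) := by
  rw [mul_mono anticomm_y, neg_one_pow_mul_self]

theorem exists_add_single {i : Fin n} {a : Fin n → ℕ} (h : a i ≠ 0) :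
    ∃ b : Fin n → ℕ, a = b + Pi.single i 1 := by
  refine ⟨a - Pi.single i 1, (tsub_add_cancel_of_le fun j => ?_).symm⟩
  by_cases hj : j = i
  · subst hj; simpa using Nat.one_le_iff_ne_zero.mpr h
  · simp [hj]

/-- Variables other than y_a, y_b pass ∂ up to sign. So does the product y_a y_b, because the two
constants it creates cancel. Stripping these off reduces the monomial to 1. -/
theorem dd_mono_eq_zero {a b : Fin n} (hab : (b : ℕ) = a + 1) {β : Fin n → ℕ} (h : β a = β b) :
    dd a b (mono y β : OPol k n) = 0 := by
  have hne : a ≠ b := fun h => by rw [h] at hab; omega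
  induction hN : ∑ i, β i using Nat.strong_induction_on generalizing β with
  | _ N ih =>
  by_cases h1 : ∃ j, j ≠ a ∧ j ≠ b ∧ β j ≠ 0
  · obtain ⟨j, ha, hb, hj⟩ := h1
    obtain ⟨β, rfl⟩ := exists_add_single hj
    rw [mono_y_add_single, map_neg_one_pow_mul, dd_y_mul_of_ne ha hb, ih (∑ i, β i) _ _ rfl]
    · simp
    · rw [← hN]; simp [Finset.sum_add_distrib]
    · simpa [ha.symm, hb.symm] using h
  push Not at h1
  by_cases h2 : β a = 0
  · have : β = 0 := by
      ext j
      by_cases ha : j = a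
      · rw [ha, h2]; rfl
      by_cases hb : j = b
      · rw [hb, ← h, h2]; rfl
      exact h1 j ha hb
    rw [this, mono_zero_exp, dd_one]
  · obtain ⟨γ, rfl⟩ := exists_add_single h2
    have h3 : γ b ≠ 0 := by
      simp [hne.symm] at h
      omega
    obtain ⟨γ, rfl⟩ := exists_add_single h3
    rw [mono_y_add_single, map_neg_one_pow_mul, mono_y_add_single, ← mul_assoc (y a),
      neg_one_pow_mul_comm, mul_assoc, map_neg_one_pow_mul, dd_y_mul_left hab, dd_y_mul_right hab,
      ih (∑ i, γ i) _ _ rfl, mul_zero, add_zero, mul_neg, ← mul_assoc (y b), neg_one_pow_mul_comm]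
    · simp [mul_assoc]
    · rw [← hN]; simp [Finset.sum_add_distrib]
    · simpa [hne, hne.symm] using h

theorem dd_mono_add_single {a b : Fin n} (hab : (b : ℕ) = a + 1) {β : Fin n → ℕ}
    (h : β a = β b) : dd a b (mono y (β + Pi.single a 1) : OPol k n) =
      (-1) ^ ((∑ j ∈ Finset.Iio a, β j) + a) * mono y β := by
  rw [mono_y_add_single, map_neg_one_pow_mul, dd_y_mul_left hab, dd_mono_eq_zero hab h, mul_zero,
    add_zero, pow_add, mul_assoc]

/-- Raising the exponent of y_a by one exhibits the monomial, up to sign, as a value of ∂_a, and the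
longest word annihilates the image of ∂_a. -/
theorem divDiffLongest_mono_eq_zero {a b : Fin n} (hab : (b : ℕ) = a + 1) {β : Fin n → ℕ}
    (h : β a = β b) : divDiffLongest (mono y β : OPol k n) = 0 := by
  have hlt : (a : ℕ) + 1 < n := hab ▸ b.2
  have h1 : (mono y β : OPol k n) = (-1) ^ ((∑ j ∈ Finset.Iio a, β j) + a) *
      dOp k n a (mono y (β + Pi.single a 1)) := by
    have hb : b = ⟨a + 1, hlt⟩ := Fin.ext hab
    rw [dOp_apply hlt, ← hb, Fin.eta, dd_mono_add_single hab h, neg_one_pow_mul_self]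
  have h2 := congrArg (fun F : Module.End k (OPol k n) => F (mono y (β + Pi.single a 1)))
    ((isOddNil_dOp (k := k) (n := n)).long_mul hlt)
  rw [h1, map_neg_one_pow_mul, divDiffLongest_eq]
  simp only [Module.End.mul_apply, LinearMap.zero_apply] at h2
  rw [h2, mul_zero]

variable (k n) in
/-- The monomial `x̃^β` for an infinite exponent sequence `β`, cut off after `n` terms. -/
def ym (β : ℕ → ℕ) : OPol k n := mono y (fun i : Fin n => β i)

theorem sum_Iio_fin (a : Fin n) (β : ℕ → ℕ) :
    ∑ j ∈ Finset.Iio a, β j = ∑ j ∈ Finset.range a, β j := by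
  rw [← Nat.Iio_eq_range, ← Fin.map_valEmbedding_Iio, Finset.sum_map]
  rfl

/-- Each ∂_i meets exponents at positions i and i + 1 that differ by one and levels them, so the
staircase drops by one step from the left. After m letters it is the next smaller staircase. -/
theorem down_ym {m i : ℕ} (hm : m < n) (hi : i ≤ m) :
    down (dOp k n) i (ym k n fun j => m - j) =
      (-1) ^ (∑ l ∈ Finset.range i, ∑ j ∈ Finset.range l, (m - j)) *
        ym k n (fun j => if j < i then m - 1 - j else m - j) := by
  induction i with
  | zero => simp [down]
  | succ i ih =>
    have hin : i + 1 < n := by omega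
    have h1 : (fun j : Fin n => if (j : ℕ) < i then m - 1 - j else m - j) =
        (fun j : Fin n => if (j : ℕ) < i + 1 then m - 1 - j else m - j) +
          Pi.single ⟨i, by omega⟩ 1 := by
      ext j
      simp only [Pi.add_apply, Pi.single_apply, Fin.ext_iff]
      split_ifs <;> omega
    rw [down, Module.End.mul_apply, ih (by omega), map_neg_one_pow_mul, ym, h1, dOp_apply hin,
      dd_mono_add_single rfl (by simp; omega), ← mul_assoc, ← pow_add, Finset.sum_range_succ, ym,
      sum_Iio_fin _ (fun j => if j < i + 1 then m - 1 - j else m - j)]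
    congr 3
    have : ∀ j ∈ Finset.range i, (if j < i + 1 then m - 1 - j else m - j) + 1 = m - j := by
      intro j hj
      rw [Finset.mem_range] at hj
      rw [if_pos (by omega)]
      omega
    rw [← Finset.sum_congr rfl this, Finset.sum_add_distrib]
    simp

/-- With the order of summation exchanged, the j-th term is (m - j)(m - j - 1), a product of
consecutive integers. -/
theorem even_sum_staircase (m : ℕ) :
    Even (∑ l ∈ Finset.range m, ∑ j ∈ Finset.range l, (m - j)) := by
  rw [Finset.sum_comm' (t' := Finset.range m) (s' := fun j => Finset.Ico (j + 1) m)
    (fun i j => by simp only [Finset.mem_range, Finset.mem_Ico]; omega)]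
  refine Finset.even_sum _ fun j hj => ?_
  rw [Finset.sum_const, Nat.card_Ico, smul_eq_mul, mul_comm, ← Nat.sub_sub]
  exact Nat.even_mul_pred_self _

theorem long_ym {N : ℕ} (hN : N ≤ n) : long (dOp k n) N (ym k n fun j => N - 1 - j) = 1 := by
  induction N with
  | zero =>
    simp only [long, ym, Module.End.one_apply, zero_tsub]
    exact mono_zero_exp _
  | succ N ih =>
    rw [long, Module.End.mul_apply, Nat.add_sub_cancel, down_ym hN le_rfl,
      (even_sum_staircase N).neg_one_pow, one_mul, ← ih (by omega)]
    congr 2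
    ext j
    split_ifs <;> omega

theorem divDiffLongest_delta : divDiffLongest (ym k n fun j => n - 1 - j) = 1 := by
  rw [divDiffLongest_eq, long_ym le_rfl]

/-- The twisted Leibniz term contains ∂_i g, so each letter of the longest word is linear for right
multiplication by g. -/
theorem long_mul_right {g : OPol k n} (hg : ∀ i, dOp k n i g = 0) (f : OPol k n) :
    divDiffLongest (f * g) = divDiffLongest f * g := by
  have h1 : ∀ i f, dOp k n i (f * g) = dOp k n i f * g := fun i f => by
    by_cases h : i + 1 < n
    · have := hg i
      rw [dOp_apply h] at this ⊢
      rw [dOp_apply h, dd_mul, this, mul_zero, add_zero]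
    · simp [dOp_of_not_lt h]
  have h2 : ∀ m f, down (dOp k n) m (f * g) = down (dOp k n) m f * g := fun m => by
    induction m with
    | zero => simp [down]
    | succ m ih => intro f; simp only [down, Module.End.mul_apply, ih, h1]
  have h3 : ∀ m f, long (dOp k n) m (f * g) = long (dOp k n) m f * g := fun m => by
    induction m with
    | zero => simp [long]
    | succ m ih => intro f; simp only [long, Module.End.mul_apply, ih, h2]
  rw [divDiffLongest_eq, h3]

theorem twist_twist (f : OPol k n) : twist (twist f) = f := by
  have : twist.comp twist = AlgHom.id k (OPol k n) := algHom_ext _ _ fun i => by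
    change twist (y i) = x i
    rw [y_eq_smul, map_smul]
    exact (x_eq_smul i).symm
  exact DFunLike.congr_fun this f

theorem longest_longest (f : OPol k n) : longest (longest f) = f := by
  have : longest.comp longest = AlgHom.id k (OPol k n) := algHom_ext _ _ fun i => by
    simp [longest]
  exact DFunLike.congr_fun this f

/-! ### Elementary symmetric polynomials -/

theorem twist_esymm_cons (a : Fin n) (l : List (Fin n)) (m : ℕ) :
    twist (esymm k n (a :: l) (m + 1)) =
      twist (esymm k n l (m + 1)) + y a * twist (esymm k n l m) := by
  rw [esymm_cons_succ, map_add, map_mul, y]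

theorem dd_twist_esymm_cons {a b c : Fin n} {l : List (Fin n)} (ha : c ≠ a) (hb : c ≠ b)
    (h : ∀ m, dd a b (twist (esymm k n l m)) = 0) (m : ℕ) :
    dd a b (twist (esymm k n (c :: l) m)) = 0 := by
  cases m with
  | zero => simp [esymm_zero]
  | succ m => rw [twist_esymm_cons, map_add, dd_y_mul_of_ne ha hb, h, h]; simp

/-- The two letters enter only through y_a + y_b and y_a y_b. The twist gives adjacent variables
opposite signs, so ∂ kills the sum; it also kills the product. -/
theorem dd_twist_esymm_cons_cons {a b : Fin n} (hab : (b : ℕ) = a + 1) {l : List (Fin n)}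
    (h : ∀ m, dd a b (twist (esymm k n l m)) = 0) (m : ℕ) :
    dd a b (twist (esymm k n (a :: b :: l) m)) = 0 := by
  rcases m with _ | _ | m
  · simp [esymm_zero]
  · rw [twist_esymm_cons, twist_esymm_cons, map_add, map_add, dd_y_mul_left hab,
      dd_y_mul_right hab, h, h, esymm_zero, esymm_zero]
    simp
  · rw [twist_esymm_cons, twist_esymm_cons, twist_esymm_cons, map_add, map_add, dd_y_mul_left hab,
      dd_y_mul_right hab, map_add, dd_y_mul_right hab, h, h, h]
    simp only [mul_zero, add_zero, zero_add, mul_add, mul_neg, ← mul_assoc, neg_one_pow_mul_comm]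
    abel

theorem dd_twist_e {a b : Fin n} (hab : (b : ℕ) = a + 1) (m : ℕ) :
    dd a b (twist (e k n m)) = 0 := by
  have hd : ∀ j (hj : j < n), (List.finRange n).drop j = ⟨j, hj⟩ :: (List.finRange n).drop (j + 1) :=
    fun j hj => by rw [List.drop_eq_getElem_cons (by simpa using hj)]; simp
  -- The list of variables is built from its end: `h1` treats the suffixes lying after b, and `h2`
  -- adds the pair a, b and then the earlier letters.
  have h1 : ∀ t m, (a : ℕ) + 2 + t ≤ n →
      dd a b (twist (esymm k n ((List.finRange n).drop (n - t)) m)) = 0 := by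
    intro t
    induction t with
    | zero =>
      intro m _
      rw [List.drop_of_length_le (by simp)]
      cases m <;> simp [esymm_zero, esymm_nil_succ]
    | succ t ih =>
      intro m ht
      rw [hd _ (by omega)]
      refine dd_twist_esymm_cons (by simp [Fin.ext_iff]; omega) (by simp [Fin.ext_iff]; omega)
        (fun m => ?_) m
      have := ih m (by omega)
      rwa [show n - t = n - (t + 1) + 1 by omega] at this
  have h2 : ∀ (t m : ℕ), t ≤ (a : ℕ) →
      dd a b (twist (esymm k n ((List.finRange n).drop (a - t)) m)) = 0 := by
    intro t
    induction t with
    | zero =>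
      intro m _
      have hb := b.2
      rw [Nat.sub_zero, hd _ a.2, hd _ (by omega)]
      rw [show (⟨a + 1, by omega⟩ : Fin n) = b from Fin.ext hab.symm]
      refine dd_twist_esymm_cons_cons hab (fun m => ?_) m
      have := h1 (n - (a + 2)) m (by omega)
      rwa [show n - (n - ((a : ℕ) + 2)) = a + 1 + 1 by omega] at this
    | succ t ih =>
      intro m ht
      rw [hd _ (by omega)]
      refine dd_twist_esymm_cons (by simp [Fin.ext_iff]; omega) (by simp [Fin.ext_iff]; omega)
        (fun m => ?_) m
      have := ih m (by omega)
      rwa [show (a : ℕ) - t = a - (t + 1) + 1 by omega] at this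
  have := h2 a m le_rfl
  rwa [Nat.sub_self, List.drop_zero] at this

theorem dOp_twist_e (m i : ℕ) : dOp k n i (twist (e k n m)) = 0 := by
  by_cases h : i + 1 < n
  · rw [dOp_apply h, dd_twist_e rfl]
  · simp [dOp_of_not_lt h]

theorem esymm_append_singleton (l : List (Fin n)) (a : Fin n) (m : ℕ) :
    esymm k n (l ++ [a]) (m + 1) = esymm k n l (m + 1) + esymm k n l m * x a := by
  induction l generalizing m with
  | nil => cases m <;> simp [esymm_cons_succ, esymm_zero, esymm_nil_succ]
  | cons b l ih =>
    rw [List.cons_append, esymm_cons_succ, ih, esymm_cons_succ]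
    cases m with
    | zero => simp [esymm_zero]; abel
    | succ m => rw [ih, esymm_cons_succ]; noncomm_ring

theorem esymm_mul_x {a : Fin n} {l : List (Fin n)} (h : a ∉ l) (m : ℕ) :
    esymm k n l m * x a = (-1) ^ m * (x a * esymm k n l m) := by
  induction l generalizing m with
  | nil => cases m <;> simp [esymm_zero, esymm_nil_succ]
  | cons b l ih =>
    simp only [List.mem_cons, not_or] at h
    cases m with
    | zero => simp [esymm_zero]
    | succ m =>
      rw [esymm_cons_succ, add_mul, ih h.2, mul_assoc, ih h.2, ← mul_assoc (x b),
        neg_one_pow_mul_comm, mul_assoc, ← mul_assoc (x b), x_mul_x (Ne.symm h.1), pow_succ]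
      noncomm_ring

/-- The sign of the reversal of `m` letters. -/
def revSign (m : ℕ) : ℕ := ∑ i ∈ Finset.range m, i

theorem esymm_reverse {l : List (Fin n)} (h : l.Nodup) (m : ℕ) :
    esymm k n l.reverse m = (-1) ^ revSign m * esymm k n l m := by
  induction l generalizing m with
  | nil => cases m <;> simp [esymm_zero, esymm_nil_succ, revSign]
  | cons a l ih =>
    rw [List.nodup_cons] at h
    cases m with
    | zero => simp [esymm_zero, revSign]
    | succ m =>
      rw [List.reverse_cons, esymm_append_singleton, ih h.2, ih h.2, esymm_cons_succ, mul_add,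
        mul_assoc, esymm_mul_x h.1, revSign, revSign, Finset.sum_range_succ, pow_add]
      simp only [mul_assoc]

theorem longest_e (m : ℕ) : longest (e k n m) = (-1) ^ revSign m * e k n m := by
  rw [e, ← esymm_reverse (List.nodup_finRange n)]
  have h1 : (List.finRange n).reverse = (List.finRange n).map Fin.rev := by
    rw [List.finRange_reverse]
  have h2 : ∀ l : List (Fin n), longest (esymm k n l m) = esymm k n (l.map Fin.rev) m := by
    intro l
    induction l generalizing m with
    | nil => cases m <;> simp [esymm_zero, esymm_nil_succ]
    | cons a l ih =>
      cases m with
      | zero => simp [esymm_zero]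
      | succ m =>
        rw [esymm_cons_succ, map_add, map_mul, ih, ih, List.map_cons, esymm_cons_succ]
        simp [longest]
  rw [h1, h2]

/-- The indicator sequence of a set of positions. -/
def ind (A : Finset ℕ) (j : ℕ) : ℕ := if j ∈ A then 1 else 0

theorem prod_sublist {R : Type*} [Ring R] (z : Fin n → R) {s l : List (Fin n)} (h : s.Sublist l)
    (hl : l.Nodup) : (s.map z).prod = (l.map fun i => z i ^ s.count i).prod := by
  induction h with
  | slnil => simp
  | @cons s l a h ih =>
    rw [List.nodup_cons] at hl
    have : s.count a = 0 := List.count_eq_zero_of_not_mem fun ha => hl.1 (h.subset ha)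
    rw [ih hl.2, List.map_cons, List.prod_cons, this, pow_zero, one_mul]
  | @cons_cons s l a h ih =>
    rw [List.nodup_cons] at hl
    have h0 : s.count a = 0 := List.count_eq_zero_of_not_mem fun ha => hl.1 (h.subset ha)
    rw [List.map_cons, List.prod_cons, ih hl.2, List.map_cons, List.prod_cons]
    rw [List.count_cons_self, h0, zero_add, pow_one]
    congr 2
    refine List.map_congr_left fun i hi => ?_
    rw [List.count_cons_of_ne]
    rintro rfl
    exact hl.1 hi

theorem e_eq_sum (m : ℕ) :
    e k n m = ∑ A ∈ Finset.powersetCard m (Finset.range n), mono x (fun i : Fin n => ind A i) := by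
  have h1 : Finset.range n = Finset.univ.map (Fin.valEmbedding (n := n)) := by
    ext j; simp
  have h2 : e k n m =
      ((Multiset.powersetCard m ((List.finRange n : List (Fin n)) : Multiset (Fin n))).map
        fun s => (mono x fun i => s.count i : OPol k n)).sum := by
    rw [Multiset.powersetCard_coe, Multiset.map_coe, Multiset.sum_coe, e, esymm, List.map_map]
    congr 1
    refine List.map_congr_left fun s hs => ?_
    rw [List.mem_sublistsLen] at hs
    rw [prod_sublist x hs.1 (List.nodup_finRange n), Function.comp_apply, mono_eq_finRange]
    simp
  rw [h1, Finset.powersetCard_map, Finset.sum_map, h2]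
  have h3 : ((List.finRange n : List (Fin n)) : Multiset (Fin n)) = Finset.univ.val := rfl
  rw [h3, ← Finset.map_val_val_powersetCard, Multiset.map_map]
  refine congrArg Multiset.sum (Multiset.map_congr rfl fun A _ => ?_)
  simp only [Function.comp_apply]
  congr 1
  ext i
  rw [Multiset.count_eq_of_nodup A.nodup]
  have : (∃ a ∈ A, (a : ℕ) = i) ↔ i ∈ A :=
    ⟨by rintro ⟨a, ha, h⟩; rwa [← Fin.ext h], fun h => ⟨i, h, rfl⟩⟩
  simp [ind, this]

theorem twist_e_eq_sum (m : ℕ) :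
    twist (e k n m) = ∑ A ∈ Finset.powersetCard m (Finset.range n), ym k n (ind A) := by
  rw [e_eq_sum, map_sum]
  exact Finset.sum_congr rfl fun A _ => map_mono (twist (k := k) (n := n)).toRingHom x _

end Longest

/-! ### Combinatorics of row length sequences -/

section Comb

/-- A weight on exponent sequences for which `A ↦ ind A` is maximal at initial segments. -/
def wt (n : ℕ) (r : ℕ → ℕ) : ℕ := ∑ j ∈ Finset.range n, (n - j) * r j

theorem wt_add (n : ℕ) (r s : ℕ → ℕ) : wt n (r + s) = wt n r + wt n s := by
  simp [wt, mul_add, Finset.sum_add_distrib]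

theorem wt_ind {n : ℕ} {A : Finset ℕ} (hA : A ⊆ Finset.range n) :
    wt n (ind A) = ∑ j ∈ A, (n - j) := by
  simp only [wt, ind, mul_ite, mul_one, mul_zero, ← Finset.sum_filter]
  rw [Finset.filter_mem_eq_inter, Finset.inter_eq_right.mpr hA]

theorem sum_range_ind {n : ℕ} {A : Finset ℕ} (hA : A ⊆ Finset.range n) :
    ∑ j ∈ Finset.range n, ind A j = A.card := by
  simp only [ind, ← Finset.sum_filter]
  rw [Finset.filter_mem_eq_inter, Finset.inter_eq_right.mpr hA]
  simp

/-- Positions of A outside the initial segment weigh at most n - m each, while the equally many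
missing positions inside it weigh at least n - m + 1. -/
theorem wt_ind_lt {n m : ℕ} (hm : m ≤ n) {A : Finset ℕ}
    (hA : A ∈ Finset.powersetCard m (Finset.range n)) (hne : A ≠ Finset.range m) :
    wt n (ind A) < wt n (ind (Finset.range m)) := by
  rw [Finset.mem_powersetCard] at hA
  rw [wt_ind hA.1, wt_ind (Finset.range_subset_range.mpr hm),
    ← Finset.sum_inter_add_sum_sdiff A (Finset.range m),
    ← Finset.sum_inter_add_sum_sdiff (Finset.range m) A, Finset.inter_comm]
  have hc : (A \ Finset.range m).card = (Finset.range m \ A).card :=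
    Finset.card_sdiff_comm (by simp [hA.2])
  have hpos : 0 < (Finset.range m \ A).card := by
    rw [← hc, Finset.card_pos, Finset.nonempty_iff_ne_empty, Ne, Finset.sdiff_eq_empty_iff_subset]
    exact fun h => hne (Finset.eq_of_subset_of_card_le h (by simp [hA.2]))
  have h1 : ∑ j ∈ A \ Finset.range m, (n - j) ≤ (A \ Finset.range m).card * (n - m) := by
    rw [← smul_eq_mul]
    refine Finset.sum_le_card_nsmul _ _ _ fun j hj => ?_
    simp only [Finset.mem_sdiff, Finset.mem_range] at hj
    omega
  have h2 : (Finset.range m \ A).card * (n - m + 1) ≤ ∑ j ∈ Finset.range m \ A, (n - j) := by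
    rw [← smul_eq_mul]
    refine Finset.card_nsmul_le_sum _ _ _ fun j hj => ?_
    simp only [Finset.mem_sdiff, Finset.mem_range] at hj
    omega
  rw [hc] at h1
  rw [mul_add] at h2
  omega

/-- Induction over partitions with at most `n` rows, following the Pieri rule. -/
theorem partition_induction (n : ℕ) {P : (ℕ → ℕ) → Prop} (h0 : P 0)
    (hs : ∀ ν m, 0 < m → m ≤ n → Antitone ν → (∀ j, m ≤ j → ν j = 0) → P ν →
      (∀ A ∈ Finset.powersetCard m (Finset.range n), A ≠ Finset.range m →
        Antitone (ν + ind A) → P (ν + ind A)) → P (ν + ind (Finset.range m)))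
    {r : ℕ → ℕ} (hr : Antitone r) (hn : ∀ j, n ≤ j → r j = 0) : P r := by
  induction hw : wt n r using Nat.strong_induction_on generalizing r with
  | _ w ih =>
  have hex : ∃ j, r j = 0 := ⟨n, hn n le_rfl⟩
  classical
  obtain ⟨m, hm, hmin⟩ : ∃ m, r m = 0 ∧ ∀ j < m, r j ≠ 0 :=
    ⟨Nat.find hex, Nat.find_spec hex, fun j hj => Nat.find_min hex hj⟩
  have hz : ∀ j, m ≤ j → r j = 0 := fun j hj => Nat.le_zero.mp (hm ▸ hr hj)
  have hmn : m ≤ n := by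
    by_contra! h
    exact hmin n h (hn n le_rfl)
  rcases Nat.eq_zero_or_pos m with rfl | hpos
  · have : r = 0 := funext fun j => hz j (Nat.zero_le j)
    rwa [this]
  -- Here ν is r with its first column removed, m being the number of nonempty rows. Thus r is the
  -- heaviest term of the Pieri product of ν with e_m.
  let ν : ℕ → ℕ := fun j => r j - 1
  have hν : r = ν + ind (Finset.range m) := by
    ext j
    by_cases hj : j < m
    · have := hmin j hj
      simp only [Pi.add_apply, ν, ind, Finset.mem_range, hj, if_true]
      omega
    · have := hz j (not_lt.mp hj)
      simp only [Pi.add_apply, ν, ind, Finset.mem_range, hj, if_false]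
      omega
  have hνa : Antitone ν := fun i j hij => Nat.sub_le_sub_right (hr hij) 1
  have hνz : ∀ j, m ≤ j → ν j = 0 := fun j hj => by simp [ν, hz j hj]
  have hwr : wt n r = wt n ν + wt n (ind (Finset.range m)) := by
    conv_lhs => rw [hν]
    rw [wt_add]
  have hwpos : 0 < wt n (ind (Finset.range m)) := by
    rw [wt_ind (Finset.range_subset_range.mpr hmn)]
    exact Finset.sum_pos (fun j hj => by rw [Finset.mem_range] at hj; omega) ⟨0, by simpa using hpos⟩
  rw [hν]
  refine hs ν m hpos hmn hνa hνz (ih _ (by omega) hνa (fun j hj => hνz j (hmn.trans hj)) rfl) ?_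
  intro A hA hne hanti
  refine ih _ ?_ hanti (fun j hj => ?_) rfl
  · rw [← hw, hwr, wt_add]
    exact Nat.add_lt_add_left (wt_ind_lt hmn hA hne) _
  · rw [Finset.mem_powersetCard] at hA
    have : j ∉ A := fun h => by have := Finset.mem_range.mp (hA.1 h); omega
    simp [hνz j (hmn.trans hj), ind, this]

/-- Adding at most one box per row can break monotonicity only by one. A defect of exactly one
becomes a repeated exponent after adding δ. -/
theorem exists_of_not_antitone {ν : ℕ → ℕ} (hν : Antitone ν) {A : Finset ℕ}
    (h : ¬ Antitone (ν + ind A)) : ∃ j, j + 1 ∈ A ∧ (ν + ind A) j + 1 = (ν + ind A) (j + 1) := by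
  contrapose! h
  refine antitone_nat_of_succ_le fun j => ?_
  have h1 := hν (Nat.le_succ j)
  have h2 := h j
  simp only [Pi.add_apply, ind, Nat.succ_eq_add_one] at *
  split_ifs at * <;> grind

end Comb

/-! ### Odd Schur polynomials -/

section Schur

variable (k : Type*) [CommRing k] (n : ℕ)

/-- The twisted odd Schur polynomial `∂_{w_0}(x̃^δ x̃^r)`. -/
def schurA (r : ℕ → ℕ) : OPol k n := divDiffLongest (ym k n (fun j => n - 1 - j) * ym k n r)

/-- The odd Schur polynomial of an arbitrary exponent sequence. -/
def schurS (r : ℕ → ℕ) : OPol k n := longest (twist (schurA k n r))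

/-- The exponent of the sign in the Pieri rule. -/
def pieriSign (r : ℕ → ℕ) (A : Finset ℕ) : ℕ :=
  ∑ i ∈ Finset.range n, ind A i * ∑ j ∈ Finset.Ioo i n, r j

variable {k n}

theorem schur_eq (lam : YoungDiagram) : schur k n lam = schurS k n lam.rowLen := by
  have : ∀ i : Fin n, (i.rev : ℕ) = n - 1 - i := fun i => by rw [Fin.val_rev]; omega
  simp only [schur, this]
  rfl

theorem pieriSign_succ {r : ℕ → ℕ} (hr : r n = 0) {A : Finset ℕ} (hA : n ∉ A) :
    pieriSign (n + 1) r A = pieriSign n r A := by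
  rw [pieriSign, Finset.sum_range_succ, ind, if_neg hA, zero_mul, add_zero]
  refine Finset.sum_congr rfl fun i hi => ?_
  congr 1
  refine (Finset.sum_subset (fun j hj => ?_) fun j hj hj' => ?_).symm
  · rw [Finset.mem_Ioo] at *; omega
  · rw [Finset.mem_Ioo] at *
    obtain rfl : j = n := by omega
    exact hr

theorem sgnExp_eq (r s : ℕ → ℕ) : sgnExp (fun i : Fin n => r i) (fun i => s i) =
    ∑ i ∈ Finset.range n, s i * ∑ j ∈ Finset.Ioo i n, r j := by
  rw [Finset.sum_range, sgnExp]
  refine Finset.sum_congr rfl fun i _ => ?_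
  rw [← Fin.map_valEmbedding_Ioi, Finset.sum_map]
  rfl

theorem ym_mul_ym (r s : ℕ → ℕ) : ym k n r * ym k n s =
    (-1) ^ (∑ i ∈ Finset.range n, s i * ∑ j ∈ Finset.Ioo i n, r j) * ym k n (r + s) := by
  rw [← sgnExp_eq]
  exact mono_mul_mono anticomm_y _ _

/-- The twisted e_m can be taken inside ∂_{w_0}, where it is a plain sum of squarefree monomials.
Terms that are not partitions are kept here; they vanish by `schurA_add_ind_eq_zero`. -/
theorem pieri_schurA (r : ℕ → ℕ) (m : ℕ) : schurA k n r * twist (e k n m) =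
    ∑ A ∈ Finset.powersetCard m (Finset.range n),
      (-1) ^ pieriSign n r A * schurA k n (r + ind A) := by
  rw [schurA, ← long_mul_right (dOp_twist_e m), twist_e_eq_sum, Finset.mul_sum, map_sum]
  refine Finset.sum_congr rfl fun A _ => ?_
  rw [mul_assoc, ym_mul_ym, ← mul_assoc, neg_one_pow_mul_comm, mul_assoc, map_neg_one_pow_mul]
  rfl

theorem pieri_schurS (r : ℕ → ℕ) (m : ℕ) : schurS k n r * e k n m =
    (-1) ^ revSign m * ∑ A ∈ Finset.powersetCard m (Finset.range n),
      (-1) ^ pieriSign n r A * schurS k n (r + ind A) := by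
  have h := congrArg (fun f => longest (twist f)) (pieri_schurA (k := k) (n := n) r m)
  simp only [map_mul, twist_twist, longest_e, map_sum, map_pow, map_neg, map_one] at h
  simp only [schurS]
  rw [← h, ← mul_assoc (longest _), neg_one_pow_mul_comm, mul_assoc, neg_one_pow_mul_self]

theorem schurA_eq_zero {r : ℕ → ℕ} {j : ℕ} (hj : j + 1 < n) (h : r j + 1 = r (j + 1)) :
    schurA k n r = 0 := by
  rw [schurA, ym_mul_ym, map_neg_one_pow_mul, ym,
    divDiffLongest_mono_eq_zero (a := ⟨j, by omega⟩) (b := ⟨j + 1, hj⟩) rfl, mul_zero]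
  simp only [Pi.add_apply]
  omega

theorem schurA_add_ind_eq_zero {ν : ℕ → ℕ} (hν : Antitone ν) {A : Finset ℕ}
    (hA : A ⊆ Finset.range n) (h : ¬ Antitone (ν + ind A)) : schurA k n (ν + ind A) = 0 := by
  obtain ⟨j, hj, hj'⟩ := exists_of_not_antitone hν h
  exact schurA_eq_zero (Finset.mem_range.mp (hA hj)) hj'

theorem schurS_add_ind_eq_zero {ν : ℕ → ℕ} (hν : Antitone ν) {A : Finset ℕ}
    (hA : A ⊆ Finset.range n) (h : ¬ Antitone (ν + ind A)) : schurS k n (ν + ind A) = 0 := by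
  rw [schurS, schurA_add_ind_eq_zero hν hA h, map_zero, map_zero]

theorem schurA_zero : schurA k n 0 = 1 := by
  have h : ym k n 0 = 1 := mono_zero_exp _
  rw [schurA, h, mul_one, divDiffLongest_delta]

theorem schurS_zero : schurS k n 0 = 1 := by rw [schurS, schurA_zero, map_one, map_one]

theorem range_mem_powersetCard {m n : ℕ} (h : m ≤ n) :
    Finset.range m ∈ Finset.powersetCard m (Finset.range n) := by
  simpa [Finset.mem_powersetCard] using h

/-- The Pieri rule solved for the leading Schur polynomial. -/
theorem schurA_rec (ν : ℕ → ℕ) {m : ℕ} (hm : m ≤ n) : schurA k n (ν + ind (Finset.range m)) =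
    (-1) ^ pieriSign n ν (Finset.range m) * (schurA k n ν * twist (e k n m) -
      ∑ A ∈ (Finset.powersetCard m (Finset.range n)).erase (Finset.range m),
        (-1) ^ pieriSign n ν A * schurA k n (ν + ind A)) := by
  rw [pieri_schurA, ← Finset.add_sum_erase _ _ (range_mem_powersetCard hm), add_sub_cancel_right,
    neg_one_pow_mul_self]

theorem schurS_rec (ν : ℕ → ℕ) {m : ℕ} (hm : m ≤ n) : schurS k n (ν + ind (Finset.range m)) =
    (-1) ^ pieriSign n ν (Finset.range m) * ((-1) ^ revSign m * (schurS k n ν * e k n m) -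
      ∑ A ∈ (Finset.powersetCard m (Finset.range n)).erase (Finset.range m),
        (-1) ^ pieriSign n ν A * schurS k n (ν + ind A)) := by
  rw [pieri_schurS, neg_one_pow_mul_self, ← Finset.add_sum_erase _ _ (range_mem_powersetCard hm),
    add_sub_cancel_right, neg_one_pow_mul_self]

theorem sign_mem {M : Submodule k (OPol k n)} {f : OPol k n} (N : ℕ) (h : f ∈ M) :
    (-1) ^ N * f ∈ M := by
  rcases neg_one_pow_eq_or (OPol k n) N with h' | h' <;> simpa [h'] using h

theorem schurS_mem_OLam {r : ℕ → ℕ} (hr : Antitone r) (hn : ∀ j, n ≤ j → r j = 0) :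
    schurS k n r ∈ OLam k n := by
  have hsign : ∀ N : ℕ, (-1 : OPol k n) ^ N ∈ OLam k n := fun N =>
    pow_mem (neg_mem (one_mem _)) N
  refine partition_induction n (P := fun r => schurS k n r ∈ OLam k n) ?_ ?_ hr hn
  · rw [schurS_zero]; exact one_mem _
  · intro ν m _ hm hν _ ih ihA
    rw [schurS_rec ν hm]
    refine mul_mem (hsign _) (sub_mem (mul_mem (hsign _) (mul_mem ih (e_mem m)))
      (sum_mem fun A hA => mul_mem (hsign _) ?_))
    rw [Finset.mem_erase] at hA
    by_cases h : Antitone (ν + ind A)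
    · exact ihA A hA.2 hA.1 h
    · rw [schurS_add_ind_eq_zero hν (Finset.mem_powersetCard.mp hA.2).1 h]
      exact zero_mem _

theorem x_mem_homog (i : Fin n) : x i ∈ homog k n 1 := by
  rw [homog, pow_one]; exact Submodule.subset_span ⟨i, rfl⟩

theorem one_mem_homog : (1 : OPol k n) ∈ homog k n 0 := by
  rw [homog, pow_zero]; exact Submodule.one_le.mp le_rfl

theorem mul_mem_homog {f g : OPol k n} {a b : ℕ} (hf : f ∈ homog k n a) (hg : g ∈ homog k n b) :
    f * g ∈ homog k n (a + b) := by
  rw [homog, pow_add]; exact Submodule.mul_mem_mul hf hg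

theorem esymm_mem_homog (l : List (Fin n)) (m : ℕ) : esymm k n l m ∈ homog k n m := by
  induction l generalizing m with
  | nil =>
    cases m
    · rw [esymm_zero]; exact one_mem_homog
    · rw [esymm_nil_succ]; exact zero_mem _
  | cons a l ih =>
    cases m with
    | zero => rw [esymm_zero]; exact one_mem_homog
    | succ m =>
      rw [esymm_cons_succ]
      refine add_mem (ih _) ?_
      rw [add_comm]
      exact mul_mem_homog (x_mem_homog a) (ih m)

theorem schurS_mem_homog {r : ℕ → ℕ} (hr : Antitone r) (hn : ∀ j, n ≤ j → r j = 0) :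
    schurS k n r ∈ homog k n (∑ j ∈ Finset.range n, r j) := by
  refine partition_induction n
    (P := fun r => schurS k n r ∈ homog k n (∑ j ∈ Finset.range n, r j)) ?_ ?_ hr hn
  · rw [schurS_zero]; simpa using one_mem_homog
  · intro ν m _ hm hν _ ih ihA
    have hsum : ∀ A ∈ Finset.powersetCard m (Finset.range n),
        ∑ j ∈ Finset.range n, (ν + ind A) j = (∑ j ∈ Finset.range n, ν j) + m := fun A hA => by
      rw [Finset.mem_powersetCard] at hA
      simp only [Pi.add_apply]
      rw [Finset.sum_add_distrib, sum_range_ind hA.1, hA.2]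
    rw [schurS_rec ν hm, hsum _ (range_mem_powersetCard hm)]
    refine sign_mem _ (sub_mem (sign_mem _ (mul_mem_homog ih (esymm_mem_homog _ m)))
      (sum_mem fun A hA => sign_mem _ ?_))
    rw [Finset.mem_erase] at hA
    by_cases h : Antitone (ν + ind A)
    · rw [← hsum A hA.2]
      exact ihA A hA.2 hA.1 h
    · rw [schurS_add_ind_eq_zero hν (Finset.mem_powersetCard.mp hA.2).1 h]
      exact zero_mem _

theorem proj_e (m : ℕ) : proj n (e k (n + 1) m) = e k n m := by
  rw [e, List.finRange_succ_last, proj_esymm]; rfl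

theorem e_eq_zero {m : ℕ} (h : n < m) : e k n m = 0 := by
  rw [e_eq_sum, Finset.powersetCard_eq_empty.mpr (by simpa using h), Finset.sum_empty]

/-- The solved Pieri rule has the same shape and signs in n and n + 1 variables, and e_m projects to
e_m. The extra terms add a box in row n and project to zero by induction. -/
theorem proj_schurS {r : ℕ → ℕ} (hr : Antitone r) (hn : ∀ j, n + 1 ≤ j → r j = 0) :
    proj n (schurS k (n + 1) r) = if r n = 0 then schurS k n r else 0 := by
  refine partition_induction (n + 1)
    (P := fun r => proj n (schurS k (n + 1) r) = if r n = 0 then schurS k n r else 0) ?_ ?_ hr hn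
  · simp [schurS_zero]
  · intro ν m hpos hm hν hνz ih ihA
    have hother : ∀ A ∈ Finset.powersetCard m (Finset.range (n + 1)), A ≠ Finset.range m →
        ν n = 0 → proj n (schurS k (n + 1) (ν + ind A)) =
          if n ∈ A then 0 else schurS k n (ν + ind A) := by
      intro A hA hne hνn
      by_cases h : Antitone (ν + ind A)
      · rw [ihA A hA hne h]
        by_cases hnA : n ∈ A <;> simp [ind, hnA, hνn]
      · rw [schurS_add_ind_eq_zero hν (Finset.mem_powersetCard.mp hA).1 h, map_zero]
        split_ifs with hnA
        · rfl
        · rw [schurS_add_ind_eq_zero hν _ h]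
          intro j hj
          have h1 := Finset.mem_range.mp ((Finset.mem_powersetCard.mp hA).1 hj)
          have h2 : j ≠ n := fun h => hnA (h ▸ hj)
          rw [Finset.mem_range]
          omega
    -- If the first column has full length n + 1, the leading term is the only one and the
    -- projection of e_{n+1} vanishes.
    rcases Nat.lt_succ_iff_lt_or_eq.mp (Nat.lt_succ_of_le hm) with hm | rfl
    · have hm' : m ≤ n := by omega
      have hνn : ν n = 0 := hνz n hm'
      have hval : (ν + ind (Finset.range m)) n = 0 := by simp [hνn, ind, hm']
      rw [if_pos hval]
      rw [hνn, if_pos rfl] at ih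
      rw [schurS_rec ν hm.le, schurS_rec ν hm', pieriSign_succ hνn (by simpa using hm')]
      simp only [map_mul, map_sub, map_pow, map_neg, map_one, map_sum, ih, proj_e]
      congr 2
      symm
      refine Finset.sum_subset_zero_on_sdiff ?_ ?_ ?_
      · refine Finset.erase_subset_erase _ (Finset.powersetCard_mono ?_)
        exact Finset.range_subset_range.mpr (Nat.le_succ n)
      · intro A hA
        rw [Finset.mem_sdiff, Finset.mem_erase, Finset.mem_erase] at hA
        have hnA : n ∈ A := by
          by_contra hnA
          refine hA.2 ⟨hA.1.1, Finset.mem_powersetCard.mpr ⟨fun j hj => ?_,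
            (Finset.mem_powersetCard.mp hA.1.2).2⟩⟩
          have h1 := Finset.mem_range.mp ((Finset.mem_powersetCard.mp hA.1.2).1 hj)
          have h2 : j ≠ n := fun h => hnA (h ▸ hj)
          rw [Finset.mem_range]
          omega
        rw [hother A hA.1.2 hA.1.1 hνn, if_pos hnA, mul_zero]
      · intro A hA
        rw [Finset.mem_erase] at hA
        have hnA : n ∉ A := fun h => by
          simpa using (Finset.mem_powersetCard.mp hA.2).1 h
        have hA' : A ∈ Finset.powersetCard m (Finset.range (n + 1)) :=
          Finset.powersetCard_mono (Finset.range_subset_range.mpr (Nat.le_succ n)) hA.2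
        rw [hother A hA' hA.1 hνn, if_neg hnA, pieriSign_succ hνn hnA]
    · have hval : (ν + ind (Finset.range (n + 1))) n ≠ 0 := by simp [ind]
      rw [if_neg hval, schurS_rec ν le_rfl]
      have : (Finset.powersetCard (n + 1) (Finset.range (n + 1))).erase (Finset.range (n + 1)) =
          ∅ := by
        have := Finset.powersetCard_self (Finset.range (n + 1))
        rw [Finset.card_range] at this
        rw [this]; simp
      rw [this, Finset.sum_empty, sub_zero, map_mul, map_mul, map_mul, proj_e,
        e_eq_zero (Nat.lt_succ_self n)]
      simp

end Schur

/-! ### Leading monomials and linear independence of odd Schur polynomials -/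

open Polynomial in
theorem mono_C_mul_X_pow {R : Type*} [Ring R] {n : ℕ} (z : Fin n → R) (c a : Fin n → ℕ) :
    mono (fun i => C (z i) * (X : R[X]) ^ c i) a = C (mono z a) * X ^ (∑ i, c i * a i) := by
  induction n with
  | zero => simp [mono]
  | succ n ih =>
    rw [mono_succ, mono_succ z, ih, Fin.sum_univ_succ, pow_add, C_mul,
      (commute_X_pow (C (z 0)) (c 0)).symm.mul_pow, pow_mul, C_pow]
    rw [mul_assoc, ← mul_assoc ((X ^ c 0) ^ a 0), ← pow_mul, X_pow_mul (n := c 0 * a 0)]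
    simp only [mul_assoc]

section Leading

open Polynomial

variable {k : Type*} [CommRing k] {n : ℕ}

/-- The homomorphism recording the weight `wt` as a power of a central variable. -/
noncomputable def weightHom : OPol k n →ₐ[k] (OPol k n)[X] :=
  lift (fun i => C (x i) * X ^ (n - (i : ℕ))) fun i j h => by
    rw [mul_assoc, ← mul_assoc (X ^ _), X_pow_mul, mul_assoc, ← pow_add, ← mul_assoc, ← C_mul,
      mul_assoc (C (x j)), ← mul_assoc (X ^ _) (C (x i)), X_pow_mul, mul_assoc, ← pow_add,
      ← mul_assoc (C (x j)), ← C_mul, add_comm (n - (j : ℕ)), ← add_mul, ← C_add, x_anticomm h,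
      C_0, zero_mul]

theorem weightHom_ym (β : ℕ → ℕ) :
    weightHom (ym k n β) = C (ym k n β) * X ^ wt n β := by
  have h1 : ∀ i : Fin n, weightHom (y i : OPol k n) = C (y i) * X ^ (n - (i : ℕ)) := fun i => by
    rw [y_eq, map_mul, map_pow, map_neg, map_one, weightHom, lift_x, C_mul, C_pow, C_neg, C_1,
      mul_assoc]
  have h2 := map_mono (weightHom (k := k) (n := n)).toRingHom y (fun i : Fin n => β i)
  change weightHom (ym k n β) = mono (fun i => weightHom (y i)) _ at h2
  rw [h2]
  simp only [h1]
  rw [mono_C_mul_X_pow, wt, Finset.sum_range]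
  rfl

/-- The polynomial `p` has degree at most `w`, with coefficient `f` in degree `w`. -/
def HasLead {R : Type*} [Ring R] (p : R[X]) (w : ℕ) (f : R) : Prop :=
  p.natDegree ≤ w ∧ p.coeff w = f

theorem HasLead.mul {R : Type*} [Ring R] {p q : R[X]} {v w : ℕ} {f g : R} (hp : HasLead p v f)
    (hq : HasLead q w g) : HasLead (p * q) (v + w) (f * g) :=
  ⟨natDegree_mul_le_of_le hp.1 hq.1,
    by rw [coeff_mul_add_eq_of_natDegree_le hp.1 hq.1, hp.2, hq.2]⟩

theorem HasLead.add {R : Type*} [Ring R] {p q : R[X]} {w : ℕ} {f g : R} (hp : HasLead p w f)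
    (hq : HasLead q w g) : HasLead (p + q) w (f + g) :=
  ⟨natDegree_add_le_of_degree_le hp.1 hq.1, by rw [coeff_add, hp.2, hq.2]⟩

theorem HasLead.neg {R : Type*} [Ring R] {p : R[X]} {w : ℕ} {f : R} (hp : HasLead p w f) :
    HasLead (-p) w (-f) := ⟨by rw [natDegree_neg]; exact hp.1, by rw [coeff_neg, hp.2]⟩

theorem HasLead.sign {R : Type*} [Ring R] {p : R[X]} {w : ℕ} {f : R} (hp : HasLead p w f)
    (N : ℕ) : HasLead ((-1) ^ N * p) w ((-1) ^ N * f) := by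
  rcases Nat.even_or_odd N with h | h
  · simpa [h.neg_one_pow] using hp
  · simpa [h.neg_one_pow] using hp.neg

theorem HasLead.sum_zero {R ι : Type*} [Ring R] {s : Finset ι} {p : ι → R[X]} {w : ℕ}
    (hp : ∀ i ∈ s, HasLead (p i) w 0) : HasLead (∑ i ∈ s, p i) w 0 :=
  ⟨natDegree_sum_le_of_forall_le _ _ fun i hi => (hp i hi).1,
    by rw [finsetSum_coeff]; exact Finset.sum_eq_zero fun i hi => (hp i hi).2⟩

theorem HasLead.of_lt {R : Type*} [Ring R] {p : R[X]} {v w : ℕ} {f : R} (hp : HasLead p v f)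
    (h : v < w) : HasLead p w 0 :=
  ⟨hp.1.trans h.le, coeff_eq_zero_of_natDegree_lt (hp.1.trans_lt h)⟩

theorem hasLead_ym (β : ℕ → ℕ) : HasLead (weightHom (ym k n β)) (wt n β) (ym k n β) := by
  rw [weightHom_ym]
  exact ⟨natDegree_C_mul_X_pow_le _ _, by simp⟩

theorem hasLead_twist_e {m : ℕ} (hm : m ≤ n) : HasLead (weightHom (twist (e k n m)))
    (wt n (ind (Finset.range m))) (ym k n (ind (Finset.range m))) := by
  rw [twist_e_eq_sum, ← Finset.add_sum_erase _ _ (range_mem_powersetCard hm), map_add, map_sum,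
    ← add_zero (ym k n (ind (Finset.range m)))]
  conv => arg 1; rw [add_zero]
  refine (hasLead_ym _).add (HasLead.sum_zero fun A hA => ?_)
  rw [Finset.mem_erase] at hA
  exact (hasLead_ym _).of_lt (wt_ind_lt hm hA.2 hA.1)

theorem weightHom_sign (N : ℕ) (f : OPol k n) :
    weightHom ((-1) ^ N * f) = (-1) ^ N * weightHom f := by simp

/-- In the solved Pieri rule the product of leading monomials gives ± the monomial of exponent r,
and all subtracted Schur polynomials have smaller weight by `wt_ind_lt`. -/
theorem hasLead_schurA {r : ℕ → ℕ} (hr : Antitone r) (hn : ∀ j, n ≤ j → r j = 0) :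
    ∃ N : ℕ, HasLead (weightHom (schurA k n r)) (wt n r) ((-1) ^ N * ym k n r) := by
  refine partition_induction n (P := fun r =>
    ∃ N : ℕ, HasLead (weightHom (schurA k n r)) (wt n r) ((-1) ^ N * ym k n r)) ?_ ?_ hr hn
  · refine ⟨0, ?_⟩
    have h : ym k n 0 = 1 := mono_zero_exp _
    rw [schurA_zero, pow_zero, one_mul, ← h]
    exact hasLead_ym 0
  · rintro ν m _ hm hν _ ⟨N, ih⟩ ihA
    refine ⟨?_, ?_⟩
    rotate_left
    · rw [schurA_rec ν hm, weightHom_sign, map_sub, map_mul, map_sum, wt_add]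
      have h1 := ih.mul (hasLead_twist_e hm)
      have h2 : HasLead (∑ A ∈ (Finset.powersetCard m (Finset.range n)).erase (Finset.range m),
          weightHom ((-1) ^ pieriSign n ν A * schurA k n (ν + ind A)))
          (wt n ν + wt n (ind (Finset.range m))) 0 := by
        refine HasLead.sum_zero fun A hA => ?_
        rw [Finset.mem_erase] at hA
        rw [weightHom_sign]
        by_cases h : Antitone (ν + ind A)
        · obtain ⟨N', hN'⟩ := ihA A hA.2 hA.1 h
          refine (hN'.sign _).of_lt ?_
          rw [wt_add]
          exact Nat.add_lt_add_left (wt_ind_lt hm hA.2 hA.1) _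
        · rw [schurA_add_ind_eq_zero hν (Finset.mem_powersetCard.mp hA.2).1 h]
          simp [HasLead]
      have h3 := (h1.add h2.neg).sign (pieriSign n ν (Finset.range m))
      rw [mul_assoc, ym_mul_ym, neg_zero, add_zero, ← mul_assoc ((-1) ^ N), ← mul_assoc, ← pow_add,
        ← pow_add, ← sub_eq_add_neg] at h3
      exact h3

theorem neg_one_pow_mul_eq_smul (N : ℕ) (f : OPol k n) :
    (-1) ^ N * f = ((-1 : kˣ) ^ N) • f := by
  rcases Nat.even_or_odd N with h | h <;> simp [h.neg_one_pow]

theorem linearIndependent_ym {ι : Type*} {rows : ι → ℕ → ℕ} (hinj : Function.Injective rows)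
    (hz : ∀ i j, n ≤ j → rows i j = 0) (N : ι → ℕ) :
    LinearIndependent k (fun i => (-1) ^ N i * ym k n (rows i)) := by
  have h1 : Function.Injective (fun i => fun j : Fin n => rows i j) := fun i i' h => by
    apply hinj
    ext j
    by_cases hj : j < n
    · exact congrFun h ⟨j, hj⟩
    · rw [hz i j (not_lt.mp hj), hz i' j (not_lt.mp hj)]
  have h2 := ((linearIndependent_mono (k := k) (n := n)).comp _ h1).units_smul
    (fun i => (-1 : kˣ) ^ N i * (-1) ^ (∑ j : Fin n, (j : ℕ) * rows i j))
  convert h2 using 1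
  ext i
  rw [neg_one_pow_mul_eq_smul, ym, mono_y, Pi.smul_apply', Function.comp_apply, mul_smul]
  congr 1

/-- In a relation, the part of maximal weight among the nonzero terms is a relation between distinct
monomials. Leading coefficients are signs, so no assumption on the ring is needed. -/
theorem linearIndependent_schurA {ι : Type*} {rows : ι → ℕ → ℕ} (hinj : Function.Injective rows)
    (hanti : ∀ i, Antitone (rows i)) (hz : ∀ i j, n ≤ j → rows i j = 0) :
    LinearIndependent k (fun i => schurA k n (rows i)) := by
  classical
  choose N hN using fun i => hasLead_schurA (k := k) (hanti i) (hz i)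
  have hli := linearIndependent_ym (k := k) hinj hz N
  rw [linearIndependent_iff'] at hli ⊢
  intro s c hc
  by_contra! hex
  obtain ⟨i₁, hi₁, hne₁⟩ := hex
  obtain ⟨i₀, hi₀, hmax⟩ := (s.filter fun i => c i ≠ 0).exists_max_image (fun i => wt n (rows i))
    ⟨i₁, Finset.mem_filter.mpr ⟨hi₁, hne₁⟩⟩
  rw [Finset.mem_filter] at hi₀
  set W := wt n (rows i₀) with hW
  have h1 := hli s (fun i => if wt n (rows i) = W then c i else 0) ?_ i₀ hi₀.1
  · rw [if_pos hW.symm] at h1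
    exact hi₀.2 h1
  · have h2 := congrArg (fun f => (weightHom f).coeff W) hc
    simp only [map_sum, map_smul, map_zero, finsetSum_coeff, coeff_smul, coeff_zero] at h2
    rw [← h2]
    refine Finset.sum_congr rfl fun i hi => ?_
    split_ifs with h
    · rw [← h, (hN i).2]
    · rw [zero_smul]
      by_cases hci : c i = 0
      · rw [hci, zero_smul]
      · have := hmax i (Finset.mem_filter.mpr ⟨hi, hci⟩)
        rw [((hN i).of_lt (lt_of_le_of_ne this h)).2, smul_zero]

theorem linearIndependent_schurS {ι : Type*} {rows : ι → ℕ → ℕ} (hinj : Function.Injective rows)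
    (hanti : ∀ i, Antitone (rows i)) (hz : ∀ i j, n ≤ j → rows i j = 0) :
    LinearIndependent k (fun i => schurS k n (rows i)) := by
  refine (linearIndependent_schurA hinj hanti hz).map'
    ((longest (k := k) (n := n)).comp twist).toLinearMap (LinearMap.ker_eq_bot_of_injective ?_)
  intro f g h
  have h' := congrArg (fun f => twist (longest f)) h
  simpa [longest_longest, twist_twist] using h'

end Leading

/-! ### Odd Schur polynomials span the odd symmetric polynomials -/

section Span

variable {k : Type*} [CommRing k] {n : ℕ}

/-- By the Pieri rule the span is stable under right multiplication by the generators, and it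
contains 1 as the Schur polynomial of the empty partition. -/
theorem mem_span_schurS {f : OPol k n} (hf : f ∈ OLam k n) :
    f ∈ Submodule.span k (schurS k n '' {r | Antitone r ∧ ∀ j, n ≤ j → r j = 0}) := by
  set V := Submodule.span k (schurS k n '' {r | Antitone r ∧ ∀ j, n ≤ j → r j = 0}) with hV
  have hmul : ∀ g ∈ OLam k n, ∀ v ∈ V, v * g ∈ V := by
    intro g hg
    induction hg using Algebra.adjoin_induction with
    | mem g hg =>
      obtain ⟨m, rfl⟩ := hg
      intro v hv
      induction hv using Submodule.span_induction with
      | mem v hv =>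
        obtain ⟨r, ⟨hr, hz⟩, rfl⟩ := hv
        rw [pieri_schurS]
        refine sign_mem _ (sum_mem fun A hA => sign_mem _ ?_)
        have hA' := (Finset.mem_powersetCard.mp hA).1
        by_cases h : Antitone (r + ind A)
        · refine Submodule.subset_span ⟨_, ⟨h, fun j hj => ?_⟩, rfl⟩
          have : j ∉ A := fun h => by have := Finset.mem_range.mp (hA' h); omega
          simp [hz j hj, ind, this]
        · rw [schurS_add_ind_eq_zero hr hA' h]
          exact zero_mem _
      | zero => simp
      | add f g _ _ hf hg => rw [add_mul]; exact add_mem hf hg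
      | smul c f _ hf => rw [smul_mul_assoc]; exact Submodule.smul_mem _ _ hf
    | algebraMap c =>
      intro v hv
      rw [← Algebra.commutes, ← Algebra.smul_def]
      exact Submodule.smul_mem _ _ hv
    | add f g _ _ hf hg => intro v hv; rw [mul_add]; exact add_mem (hf v hv) (hg v hv)
    | mul f g _ _ hf hg => intro v hv; rw [← mul_assoc]; exact hg _ (hf v hv)
  have h1 : (1 : OPol k n) ∈ V :=
    Submodule.subset_span ⟨0, ⟨fun _ _ _ => le_rfl, fun _ _ => rfl⟩, schurS_zero⟩
  simpa using hmul f hf 1 h1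

end Span

/-! ### The differential of an odd Schur polynomial -/

section Differential

variable {k : Type*} [CommRing k] {n : ℕ}

/-- The map w_0 θ sends twisted variables to variables, so it carries the derivation squaring the
former to the derivation squaring the latter. -/
theorem d_longest_twist (f : OPol k n) : d (longest (twist f)) = longest (twist (dTwist f)) := by
  have hp : ∀ f : OPol k n, parity (longest (twist f)) = longest (twist (parity f)) := fun f => by
    have : parity.comp (longest.comp twist) = (longest.comp twist).comp (parity (k := k) (n := n)) :=
      algHom_ext _ _ fun i => by simp [longest, twist]
    exact DFunLike.congr_fun this f
  induction f using induction_y with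
  | hc r => simp [Algebra.algebraMap_eq_smul_one]
  | hy i =>
    rw [dTwist_y, map_pow, map_pow, y, twist_twist]
    simp [longest]
  | hadd f g hf hg => simp only [map_add, hf, hg]
  | hmul f g hf hg => simp only [map_mul, d_mul, dTwist_mul, hf, hg, hp, map_add]

theorem dTwist_pow_y (i : Fin n) (a : ℕ) :
    dTwist (y i ^ a : OPol k n) = if Odd a then y i * y i ^ a else 0 := by
  induction a with
  | zero => simp
  | succ a ih =>
    rw [pow_succ', dTwist_mul, dTwist_y, ih, parity_y]
    by_cases h : Odd a
    · simp [h, Nat.odd_add_one, pow_two, mul_assoc]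
    · simp [h, Nat.odd_add_one, pow_two, mul_assoc]

theorem dTwist_list (a : Fin n → ℕ) {l : List (Fin n)} (hl : l.Nodup) :
    dTwist ((l.map fun i => (y i : OPol k n) ^ a i).prod) =
      (l.map fun j => if Odd (a j) then y j * (l.map fun i => (y i : OPol k n) ^ a i).prod
        else 0).sum := by
  induction l with
  | nil => simp
  | cons b l ih =>
    rw [List.nodup_cons] at hl
    simp only [List.map_cons, List.prod_cons, List.sum_cons]
    rw [dTwist_mul, dTwist_pow_y, ih hl.2]
    congr 1
    · split_ifs
      · rw [mul_assoc]
      · rw [zero_mul]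
    · rw [← List.sum_map_mul_left]
      congr 1
      refine List.map_congr_left fun j hj => ?_
      have hne : j ≠ b := fun h => hl.1 (h ▸ hj)
      split_ifs
      · rw [map_pow, parity_y, ← mul_assoc, ← mul_assoc, mul_pow_anticomm (y_mul_y hne),
          neg_pow]
        simp only [mul_assoc]
      · rw [mul_zero]

/-- A power of y_j has differential zero or y_j times itself according to parity. The Leibniz sign
equals the sign for moving y_j to the front, so no signs remain. -/
theorem dTwist_mono (a : Fin n → ℕ) : dTwist (mono y a : OPol k n) =
    ∑ j, if Odd (a j) then y j * mono y a else 0 := by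
  rw [mono_eq_finRange, dTwist_list a (List.nodup_finRange n), ← List.sum_ofFn, List.ofFn_eq_map]

theorem sum_single_ind (r : ℕ → ℕ) (j : Fin n) :
    (fun i : Fin n => (r + ind {(j : ℕ)}) i) = (fun i : Fin n => r i) + Pi.single j 1 := by
  ext i
  simp [ind, Pi.single_apply, Fin.ext_iff]

theorem y_mul_ym_mul_ym (s r : ℕ → ℕ) (j : Fin n) : ∃ N : ℕ,
    y j * (ym k n s * ym k n r) = (-1) ^ N * (ym k n s * ym k n (r + ind {(j : ℕ)})) := by
  have h1 := mul_mono (anticomm_y (k := k)) j (fun i : Fin n => (s + r) i)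
  rw [← sum_single_ind] at h1
  have h2 : y j * ym k n (s + r) = (-1) ^ (∑ i ∈ Finset.Iio j, (s + r) i) *
    ym k n (s + r + ind {(j : ℕ)}) := h1
  rw [ym_mul_ym, ym_mul_ym, ← add_assoc, ← mul_assoc, neg_one_pow_mul_comm, mul_assoc, h2]
  generalize (∑ i ∈ Finset.range n, r i * ∑ j ∈ Finset.Ioo i n, s j) = P
  generalize (∑ i ∈ Finset.Iio j, (s + r) i) = Q
  generalize (∑ i ∈ Finset.range n, (r + ind {(j : ℕ)}) i * ∑ j ∈ Finset.Ioo i n, s j) = R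
  refine ⟨P + Q + R, ?_⟩
  rw [pow_add, pow_add, mul_assoc, neg_one_pow_mul_self, mul_assoc]

/-- The differential adds boxes of odd content, with coefficients `±1`. -/
theorem d_schurS (r : ℕ → ℕ) : ∃ c : ℕ → k, (∀ j, Even (r j + j) → c j = 0) ∧
    (∀ j, Odd (r j + j) → IsUnit (c j)) ∧
    d (schurS k n r) = ∑ j ∈ Finset.range n, c j • schurS k n (r + ind {j}) := by
  obtain ⟨u, hu⟩ := (isTwistedDiff_dTwist (k := k) (n := n)).mul_long isOddHecke_dOp le_rfl
  choose N hN using y_mul_ym_mul_ym (k := k) (n := n) (fun j => n - 1 - j) r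
  set f := ym k n (fun j => n - 1 - j) * ym k n r with hf
  have h1 : dTwist f = ∑ j : Fin n, if Odd (n - 1 - (j : ℕ) + r j) then y j * f else 0 := by
    rw [hf, ym_mul_ym, map_neg_one_pow_mul]
    conv_lhs => rw [ym, dTwist_mono]
    rw [Finset.mul_sum]
    refine Finset.sum_congr rfl fun j _ => ?_
    rw [mul_ite, mul_zero, ← mul_assoc, ← neg_one_pow_mul_comm, mul_assoc]
    rfl
  have h2 : (if Even n then ∑ j ∈ Finset.range n, yOp k n j else 0) f =
      ∑ j : Fin n, if Even n then y j * f else 0 := by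
    split_ifs
    · rw [LinearMap.sum_apply, Finset.sum_range]
      exact Finset.sum_congr rfl fun j _ => yOp_apply j.2 f
    · simp
  -- For odd n the odd exponents of δ + r survive. For even n the correction cancels these and
  -- leaves the even exponents with sign -1. Either way the surviving rows have r_j + j odd.
  have h3 : dTwist f - (if Even n then ∑ j ∈ Finset.range n, yOp k n j else 0) f =
      ∑ j : Fin n, (if Odd (r j + j) then (if Even n then (-1 : k) else 1) else 0) • (y j * f) := by
    rw [h1, h2, ← Finset.sum_sub_distrib]
    refine Finset.sum_congr rfl fun j _ => ?_
    have hj := j.2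
    have hpar : Odd (n - 1 - (j : ℕ) + r j) ↔ (Odd (r j + j) ↔ ¬ Even n) := by
      have e : n - 1 - (j : ℕ) + r j + 2 * j + 1 = n + (r j + j) := by omega
      have e' := congrArg Even e
      simp only [Nat.even_add, Nat.even_add_one, ← Nat.not_even_iff_odd,
        even_two_mul, eq_iff_iff] at e' ⊢
      tauto
    by_cases hn : Even n <;> by_cases ho : Odd (r j + j) <;> simp [hpar, hn, ho]
  have h4 : dTwist (divDiffLongest f) = u • ∑ j : Fin n,
      (if Odd (r j + j) then (if Even n then (-1 : k) else 1) else 0) •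
        ((-1) ^ N j * schurA k n (r + ind {(j : ℕ)})) := by
    have := congrArg (fun F : Module.End k (OPol k n) => F f) hu
    simp only [Module.End.mul_apply] at this
    rw [divDiffLongest_eq, this]
    change u • long (dOp k n) n _ = _
    rw [LinearMap.sub_apply, h3, map_sum]
    congr 1
    refine Finset.sum_congr rfl fun j _ => ?_
    rw [map_smul, hN, map_neg_one_pow_mul, ← divDiffLongest_eq]
    rfl
  refine ⟨fun j => if Odd (r j + j) then ((u : ℤ) : k) * ((if Even n then (-1 : k) else 1) *
    (-1) ^ (if h : j < n then N ⟨j, h⟩ else 0)) else 0, fun j hj => ?_, fun j hj => ?_, ?_⟩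
  · beta_reduce
    rw [if_neg (Nat.not_odd_iff_even.mpr hj)]
  · beta_reduce
    rw [if_pos hj]
    refine IsUnit.mul (u.isUnit.map (Int.castRingHom k)) (IsUnit.mul ?_ ?_)
    · split_ifs
      exacts [isUnit_one.neg, isUnit_one]
    · exact (isUnit_one.neg).pow _
  · rw [schurS, d_longest_twist, schurA, ← hf, h4, Finset.sum_range, Units.smul_def, map_zsmul,
      map_zsmul, map_sum, map_sum, Finset.smul_sum]
    refine Finset.sum_congr rfl fun j _ => ?_
    beta_reduce
    rw [dif_pos j.2, map_smul, map_smul, map_mul, map_mul, ← schurS]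
    simp only [map_pow, map_neg, map_one]
    rw [← Int.cast_smul_eq_zsmul k, smul_smul]
    have e : ∀ (N : ℕ) (g : OPol k n), (-1) ^ N * g = (-1 : k) ^ N • g := fun N g => by
      rcases Nat.even_or_odd N with h | h <;> simp [h.neg_one_pow]
    rw [e, smul_smul]
    split_ifs <;> simp

end Differential

/-! ### Cohomology of a complex with a matching on a basis -/

section Cohomology

variable {k M ι κ : Type*} [CommRing k] [AddCommGroup M] [Module k M]

/-- If, up to basis vectors in `L`, the differential sends each `b j`, `j ∈ L`, to a unit multiple
of `b (τ j)`, and the basis vectors outside `L ∪ τ L` are cocycles that never occur in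
coboundaries, then these form a basis of the cohomology. -/
theorem exists_basis_cohomology (b : Module.Basis ι k M) (D : M →ₗ[k] M) (hD : ∀ f, D (D f) = 0)
    (c : κ → ι) (hc : Function.Injective c) (L : Set ι) (τ : ι → ι)
    (h0 : ∀ i, D (b (c i)) = 0) (h1 : ∀ f i, b.repr (D f) (c i) = 0)
    (h2 : ∀ j ∈ L, ∃ u : k, IsUnit u ∧ D (b j) - u • b (τ j) ∈ Submodule.span k (b '' L))
    (hτ : Set.InjOn τ L) (hτL : ∀ j ∈ L, τ j ∉ L)
    (hcov : ∀ i, i ∈ Set.range c ∨ i ∈ L ∨ i ∈ τ '' L) :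
    ∃ B : Module.Basis κ k (Cohomology D), ∀ i, ∃ z : LinearMap.ker D,
      (z : M) = b (c i) ∧ B i = cohClass D z := by
  classical
  let z : κ → LinearMap.ker D := fun i => ⟨b (c i), h0 i⟩
  have hsum : ∀ (s : Finset κ) (a : κ → k),
      ((∑ i ∈ s, a i • z i : LinearMap.ker D) : M) = ∑ i ∈ s, a i • b (c i) := fun s a => by
    simp [z]
  have hli : LinearIndependent k (fun i => cohClass D (z i)) := by
    rw [linearIndependent_iff']
    intro s a ha i hi
    have h3 : cohClass D (∑ i ∈ s, a i • z i) = 0 := by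
      rw [← ha]
      exact map_sum ((LinearMap.range D).submoduleOf (LinearMap.ker D)).mkQ _ _
    rw [cohClass, Submodule.Quotient.mk_eq_zero] at h3
    obtain ⟨f, hf⟩ := h3
    have h4 := h1 f i
    rw [hf, Submodule.subtype_apply, hsum] at h4
    simp only [map_sum, map_smul, Module.Basis.repr_self, Finsupp.coe_finsetSum, Finset.sum_apply,
      Finsupp.smul_apply, Finsupp.single_apply, hc.eq_iff, smul_eq_mul, mul_ite, mul_one,
      mul_zero, Finset.sum_ite_eq', hi, if_true] at h4
    exact h4
  have hspanL : ∀ f ∈ Submodule.span k (b '' L), ∀ j ∈ L, b.repr f (τ j) = 0 := by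
    intro f hf j hj
    have := (Module.Basis.mem_span_image b).mp hf
    by_contra h
    exact hτL j hj (this (Finsupp.mem_support_iff.mpr h))
  -- The coefficient of D f at τ j sees only the matched term, since the error terms lie in the span
  -- of L and τ j is not in L. So D is injective on this span, with no triangularity or finiteness
  -- needed.
  have hDL : ∀ f ∈ Submodule.span k (b '' L), D f = 0 → f = 0 := by
    intro f hf hDf
    have hsupp := (Module.Basis.mem_span_image b).mp hf
    choose! u hu hu' using h2
    have hf' : f = ∑ j ∈ (b.repr f).support, b.repr f j • b j := by
      conv_lhs => rw [← b.linearCombination_repr f]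
      rfl
    apply b.repr.injective
    rw [map_zero]
    ext j
    by_cases hj : j ∈ L
    · have h3 : b.repr (D f) (τ j) = b.repr f j * u j := by
        conv_lhs => rw [hf']
        simp only [map_sum, map_smul, Finsupp.coe_finsetSum, Finset.sum_apply, Finsupp.smul_apply,
          smul_eq_mul]
        have h4 : ∀ i ∈ (b.repr f).support, b.repr f i * b.repr (D (b i)) (τ j) =
            if i = j then b.repr f j * u j else 0 := by
          intro i hi
          have hiL : i ∈ L := hsupp hi
          have h5 := hspanL _ (hu' i hiL) j hj
          rw [map_sub, map_smul, Finsupp.sub_apply, sub_eq_zero] at h5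
          rw [h5, Module.Basis.repr_self, Finsupp.smul_apply, Finsupp.single_apply]
          by_cases hij : i = j
          · simp [hij]
          · rw [if_neg (fun h => hij (hτ hiL hj h)), if_neg hij, smul_zero, mul_zero]
        rw [Finset.sum_congr rfl h4, Finset.sum_ite_eq']
        split_ifs with h
        · rfl
        · rw [Finsupp.notMem_support_iff.mp h, zero_mul]
      rw [hDf, map_zero, Finsupp.zero_apply] at h3
      exact (hu j hj).mul_left_eq_zero.mp h3.symm
    · by_contra h
      exact hj (hsupp (Finsupp.mem_support_iff.mpr h))
  -- Since the coefficients are units, each b (τ j) is a coboundary modulo the span of L.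
  have hdec : ∀ f : M, f ∈ Submodule.span k (Set.range fun i => b (c i)) ⊔
      (Submodule.span k (b '' L) ⊔ LinearMap.range D) := by
    intro f
    have : f ∈ Submodule.span k (Set.range b) := by rw [b.span_eq]; trivial
    refine Submodule.span_le.mpr ?_ this
    rintro _ ⟨i, rfl⟩
    rcases hcov i with ⟨i, rfl⟩ | hi | ⟨j, hj, rfl⟩
    · exact Submodule.mem_sup_left (Submodule.subset_span ⟨i, rfl⟩)
    · exact Submodule.mem_sup_right (Submodule.mem_sup_left (Submodule.subset_span ⟨i, hi, rfl⟩))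
    · refine Submodule.mem_sup_right ?_
      obtain ⟨u, ⟨u, rfl⟩, hu⟩ := h2 j hj
      have : b (τ j) = (↑u⁻¹ : k) • (-(D (b j) - (u : k) • b (τ j)) + D (b j)) := by
        rw [neg_sub, sub_add_cancel, smul_smul, Units.inv_mul, one_smul]
      change b (τ j) ∈ Submodule.span k (b '' L) ⊔ LinearMap.range D
      rw [this]
      exact Submodule.smul_mem _ _ (add_mem (Submodule.mem_sup_left (neg_mem hu))
        (Submodule.mem_sup_right ⟨_, rfl⟩))
  have hspan : ⊤ ≤ Submodule.span k (Set.range fun i => cohClass D (z i)) := by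
    rintro q -
    obtain ⟨w, rfl⟩ := Submodule.Quotient.mk_surjective _ q
    obtain ⟨p, hp, q, hq, hpq⟩ := Submodule.mem_sup.mp (hdec w)
    obtain ⟨l, hl, _, ⟨f, rfl⟩, hlq⟩ := Submodule.mem_sup.mp hq
    have hDp : D p = 0 := by
      have : Submodule.span k (Set.range fun i => b (c i)) ≤ LinearMap.ker D := by
        rw [Submodule.span_le]
        rintro _ ⟨i, rfl⟩
        exact h0 i
      exact this hp
    -- For a cocycle, the component in the span of L is itself a cocycle and hence zero.
    have hl0 : l = 0 := by
      apply hDL l hl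
      have hw : D (w : M) = 0 := w.2
      rw [← hpq, ← hlq, map_add, map_add, hDp, hD] at hw
      simpa using hw
    rw [hl0, zero_add] at hlq
    have hpz : ∀ p ∈ Submodule.span k (Set.range fun i => b (c i)), ∃ y ∈
        Submodule.span k (Set.range z), ((y : LinearMap.ker D) : M) = p := by
      intro p hp
      have : Set.range (fun i => b (c i)) = (LinearMap.ker D).subtype '' Set.range z := by
        rw [← Set.range_comp]; rfl
      rw [this, Submodule.span_image] at hp
      exact hp
    obtain ⟨y, hy, hyp⟩ := hpz p hp
    have hwy : (Submodule.Quotient.mk w : Cohomology D) = Submodule.Quotient.mk y := by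
      rw [Submodule.Quotient.eq]
      refine ⟨f, ?_⟩
      rw [map_sub, Submodule.subtype_apply, Submodule.subtype_apply, hyp, ← hpq, ← hlq]
      simp
    rw [hwy]
    have h5 : Set.range (fun i => cohClass D (z i)) =
        ((LinearMap.range D).submoduleOf (LinearMap.ker D)).mkQ '' Set.range z := by
      rw [← Set.range_comp]; rfl
    rw [h5, Submodule.span_image]
    exact ⟨y, hy, rfl⟩
  exact ⟨Module.Basis.mk hli hspan, fun i => ⟨z i, rfl, by simp⟩⟩

/-! ### The matching of partitions -/

/-- Row lengths of a partition subdivided into `2 × 2` squares. -/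
def EvenRows (r : ℕ → ℕ) : Prop := ∀ i, Even (r (2 * i)) ∧ r (2 * i) = r (2 * i + 1)

/-- The first pair of rows where the partition fails to be subdivided into squares is the `i`-th,
and the box to be toggled is missing in row `2 * i`. -/
def IsLowAt (r : ℕ → ℕ) (i : ℕ) : Prop :=
  (∀ i' < i, Even (r (2 * i')) ∧ r (2 * i') = r (2 * i' + 1)) ∧ Odd (r (2 * i))

theorem IsLowAt.unique {r : ℕ → ℕ} {i j : ℕ} (hi : IsLowAt r i) (hj : IsLowAt r j) : i = j := by
  rcases lt_trichotomy i j with h | h | h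
  · exact absurd (hj.1 i h).1 (Nat.not_even_iff_odd.mpr hi.2)
  · exact h
  · exact absurd (hi.1 j h).1 (Nat.not_even_iff_odd.mpr hj.2)

theorem ind_singleton (j l : ℕ) : ind {j} l = if l = j then 1 else 0 := by simp [ind]

theorem lt_of_antitone_add {r : ℕ → ℕ} {j : ℕ} (h : Antitone (r + ind {j + 1})) :
    r (j + 1) < r j := by
  have := h (Nat.le_succ j)
  simp only [Pi.add_apply, ind_singleton, Nat.succ_eq_add_one] at this
  simpa using this

theorem antitone_add_of_lt {r : ℕ → ℕ} (hr : Antitone r) {j : ℕ}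
    (h : ∀ l, j = l + 1 → r j < r l) : Antitone (r + ind {j}) := by
  refine antitone_nat_of_succ_le fun l => ?_
  have h1 := hr (Nat.le_succ l)
  have h2 := h l
  simp only [Pi.add_apply, ind_singleton, Nat.succ_eq_add_one] at *
  split_ifs with h3 h4 <;> grind

/-- Row pairs before the first defect are unaffected by adding a box of odd content. -/
theorem le_of_odd_box {r : ℕ → ℕ} {i j : ℕ}
    (hi : ∀ i' < i, Even (r (2 * i')) ∧ r (2 * i') = r (2 * i' + 1))
    (hodd : Odd (r j + j)) (hanti : Antitone (r + ind {j})) : 2 * i ≤ j := by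
  by_contra! h
  rcases Nat.even_or_odd' j with ⟨t, rfl | rfl⟩
  · have h1 := (hi t (by omega)).1
    rw [Nat.odd_add] at hodd
    exact Nat.not_even_iff_odd.mpr (hodd.mpr (even_two_mul t)) h1
  · have h1 := (hi t (by omega)).2
    have := lt_of_antitone_add hanti
    omega

theorem EvenRows.not_box {r : ℕ → ℕ} (h : EvenRows r) {j : ℕ} (hodd : Odd (r j + j)) :
    ¬ Antitone (r + ind {j}) := fun hanti => by
  -- All row pairs are free of defects, so the bound may be used with i = j + 1, which is absurd.
  have := le_of_odd_box (i := j + 1) (fun i' _ => h i') hodd hanti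
  omega

/-- The last box added would be the lower right corner of a 2 × 2 square, which has even content. -/
theorem not_evenRows_add_box {r : ℕ → ℕ} (hr : Antitone r) {j : ℕ} (hodd : Odd (r j + j)) :
    ¬ EvenRows (r + ind {j}) := fun h => by
  rcases Nat.even_or_odd' j with ⟨t, rfl | rfl⟩
  · have h1 := (h t).2
    have h2 := hr (Nat.le_succ (2 * t))
    simp [ind_singleton] at h1 h2
    omega
  · have h1 := (h t).1
    have h2 := (h t).2
    simp only [Pi.add_apply, ind_singleton] at h1 h2
    rw [if_neg (by omega), if_pos trivial, add_zero] at h2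
    rw [if_neg (by omega), add_zero, h2] at h1
    rw [← add_assoc, Nat.odd_add_one, Nat.not_odd_iff_even] at hodd
    have h3 : Even (r (2 * t + 1)) := by
      rw [Nat.even_add] at hodd
      exact hodd.mpr (even_two_mul t)
    rw [Nat.even_add_one] at h1
    exact h1 h3

/-- Such a box lies strictly below row 2i, and being low at i depends only on rows up to 2i. -/
theorem IsLowAt.add_box {r : ℕ → ℕ} {i j : ℕ} (h : IsLowAt r i) (hodd : Odd (r j + j))
    (hanti : Antitone (r + ind {j})) (hj : j ≠ 2 * i) : IsLowAt (r + ind {j}) i := by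
  have hle := le_of_odd_box h.1 hodd hanti
  have h1 : ∀ l, l ≤ 2 * i → (r + ind {j}) l = r l := fun l hl => by
    simp only [Pi.add_apply, ind_singleton]
    rw [if_neg (by omega), add_zero]
  refine ⟨fun i' hi' => ?_, ?_⟩
  · rw [h1 _ (by omega), h1 _ (by omega)]
    exact h.1 i' hi'
  · rw [h1 _ le_rfl]
    exact h.2

/-- The row above has even length and row 2i has odd length, so there is room for the box. -/
theorem IsLowAt.antitone {r : ℕ → ℕ} (hr : Antitone r) {i : ℕ} (h : IsLowAt r i) :
    Antitone (r + ind {2 * i}) := by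
  refine antitone_add_of_lt hr fun l hl => ?_
  obtain ⟨t, rfl⟩ : ∃ t, i = t + 1 := ⟨i - 1, by omega⟩
  obtain rfl : l = 2 * t + 1 := by omega
  have h1 := h.1 t (Nat.lt_succ_self t)
  refine lt_of_le_of_ne (hr (by omega)) fun he => ?_
  have h2 := h.2
  rw [he, ← h1.2] at h2
  exact Nat.not_even_iff_odd.mpr h2 h1.1

theorem IsLowAt.not_isLowAt_add {r : ℕ → ℕ} (hr : Antitone r) {i : ℕ} (h : IsLowAt r i) (j : ℕ) :
    ¬ IsLowAt (r + ind {2 * i}) j := fun hj => by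
  have h1 : ∀ l, l ≠ 2 * i → (r + ind {2 * i}) l = r l := fun l hl => by
    simp [ind_singleton, hl]
  have h2 : (r + ind {2 * i}) (2 * i) = r (2 * i) + 1 := by simp [ind_singleton]
  have hodd := h.2
  rcases lt_trichotomy i j with hij | rfl | hij
  · have h3 := (hj.1 i hij).2
    rw [h2, h1 _ (by omega)] at h3
    have := hr (Nat.le_succ (2 * i))
    simp only [Nat.succ_eq_add_one] at this
    omega
  · have h3 := hj.2
    rw [h2, Nat.odd_add_one] at h3
    exact h3 hodd
  · have h3 := hj.2
    rw [h1 _ (by omega)] at h3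
    exact Nat.not_even_iff_odd.mpr h3 (h.1 j hij).1

/-- After the toggle, row 2i is strictly longer than row 2i + 1, so the position of the first defect
can still be read off and the box can be removed again. -/
theorem IsLowAt.eq_of_add_eq {r s : ℕ → ℕ} (hr : Antitone r) (hs : Antitone s) {i j : ℕ}
    (hi : IsLowAt r i) (hj : IsLowAt s j) (h : r + ind {2 * i} = s + ind {2 * j}) : r = s := by
  have key : ∀ {r s : ℕ → ℕ} {i j : ℕ}, Antitone r → IsLowAt r i → IsLowAt s j →
      r + ind {2 * i} = s + ind {2 * j} → ¬ i < j := by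
    intro r s i j hr hi hj h hij
    have h1 := (hj.1 i hij)
    have e1 := congrFun h (2 * i)
    have e2 := congrFun h (2 * i + 1)
    have h3 := hr (Nat.le_succ (2 * i))
    simp only [Pi.add_apply, ind_singleton, Nat.succ_eq_add_one] at e1 e2 h3
    rw [if_pos trivial, if_neg (by omega)] at e1
    rw [if_neg (by omega), if_neg (by omega)] at e2
    omega
  have hij : i = j := le_antisymm (not_lt.mp (key hs hj hi h.symm)) (not_lt.mp (key hr hi hj h))
  rw [hij] at h
  exact add_right_cancel h

/-- Every partition is of exactly one of three types. -/
theorem evenRows_or {r : ℕ → ℕ} (hr : Antitone r) : EvenRows r ∨ (∃ i, IsLowAt r i) ∨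
    ∃ s i, Antitone s ∧ IsLowAt s i ∧ r = s + ind {2 * i} := by
  by_cases h : EvenRows r
  · exact Or.inl h
  right
  unfold EvenRows at h
  push Not at h
  classical
  obtain ⟨i, hi, hmin⟩ : ∃ i, ¬ (Even (r (2 * i)) ∧ r (2 * i) = r (2 * i + 1)) ∧
      ∀ j < i, Even (r (2 * j)) ∧ r (2 * j) = r (2 * j + 1) := by
    have hex : ∃ i, ¬ (Even (r (2 * i)) ∧ r (2 * i) = r (2 * i + 1)) := by
      obtain ⟨i, hi⟩ := h
      exact ⟨i, fun h => hi h.1 h.2⟩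
    exact ⟨Nat.find hex, Nat.find_spec hex, fun j hj => not_not.mp (Nat.find_min hex hj)⟩
  by_cases hodd : Odd (r (2 * i))
  · exact Or.inl ⟨i, hmin, hodd⟩
  right
  have heven : Even (r (2 * i)) := Nat.not_odd_iff_even.mp hodd
  have hlt : r (2 * i + 1) < r (2 * i) :=
    lt_of_le_of_ne (hr (Nat.le_succ _)) fun h => hi ⟨heven, h.symm⟩
  -- Row 2i is even and strictly longer than the next row, so its last box can be removed.
  refine ⟨fun l => if l = 2 * i then r l - 1 else r l, i, ?_, ⟨fun j hj => ?_, ?_⟩, ?_⟩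
  · refine antitone_nat_of_succ_le fun l => ?_
    have := hr (Nat.le_succ l)
    simp only [Nat.succ_eq_add_one] at this
    by_cases h1 : l = 2 * i
    · subst h1; simp; omega
    · rw [if_neg h1]
      split_ifs <;> omega
  · beta_reduce
    rw [if_neg (by omega), if_neg (by omega)]
    exact hmin j hj
  · beta_reduce
    rw [if_pos rfl]
    exact Nat.Even.sub_odd (by omega) heven odd_one
  · ext l
    simp only [Pi.add_apply, ind_singleton]
    split_ifs with h1
    · subst h1; omega
    · rfl

/-- The cohomology of a complex with a basis indexed by partitions whose differential adds boxes of
odd content. -/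
theorem exists_basis_of_boxes (b : Module.Basis ι k M) (D : M →ₗ[k] M) (hD : ∀ f, D (D f) = 0)
    (rows : ι → ℕ → ℕ) (hinj : Function.Injective rows) (hanti : ∀ i, Antitone (rows i))
    (hsub : ∀ i s, Antitone s → (∀ j, s j ≤ rows i j) → s ∈ Set.range rows)
    (hDb : ∀ i, ∃ (J : Finset ℕ) (a : ℕ → k) (v : ℕ → M), D (b i) = ∑ j ∈ J, a j • v j ∧
      (∀ j, rows i j ≠ 0 → j ∈ J) ∧ (∀ j, Even (rows i j + j) → a j = 0) ∧
      (∀ j, Odd (rows i j + j) → IsUnit (a j)) ∧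
      (∀ j ∈ J, ¬ Antitone (rows i + ind {j}) → v j = 0) ∧
      ∀ j ∈ J, Antitone (rows i + ind {j}) → ∃ i', rows i' = rows i + ind {j} ∧ v j = b i')
    (c : κ → ι) (hc : Function.Injective c) (hc' : ∀ i, i ∈ Set.range c ↔ EvenRows (rows i)) :
    ∃ B : Module.Basis κ k (Cohomology D), ∀ i, ∃ z : LinearMap.ker D,
      (z : M) = b (c i) ∧ B i = cohClass D z := by
  classical
  have hterm : ∀ {i : ι} {a : ℕ → k} {v : ℕ → M} {j : ℕ} {V : Submodule k M},
      (∀ j, Even (rows i j + j) → a j = 0) →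
      (¬ Antitone (rows i + ind {j}) → v j = 0) →
      (Odd (rows i j + j) → Antitone (rows i + ind {j}) → v j ∈ V) → a j • v j ∈ V := by
    intro i a v j V h1 h2 h3
    rcases Nat.even_or_odd (rows i j + j) with h | h
    · rw [h1 j h, zero_smul]; exact zero_mem _
    · by_cases h' : Antitone (rows i + ind {j})
      · exact V.smul_mem _ (h3 h h')
      · rw [h2 h', smul_zero]; exact zero_mem _
  let L : Set ι := {i | ∃ t, IsLowAt (rows i) t}
  have hτ : ∀ i, ∃ i', ∀ t, IsLowAt (rows i) t → rows i' = rows i + ind {2 * t} := by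
    intro i
    by_cases h : ∃ t, IsLowAt (rows i) t
    · obtain ⟨t, ht⟩ := h
      obtain ⟨J, a, v, -, hJ, -, -, -, hv⟩ := hDb i
      -- The toggled row has odd length and so is nonempty. Hence it is among the rows J where boxes
      -- may be added, which keeps the partner inside the index set.
      have hne : rows i (2 * t) ≠ 0 := fun h0 => by
        have := ht.2
        rw [h0] at this
        simp at this
      obtain ⟨i', hi', -⟩ := hv _ (hJ _ hne) (ht.antitone (hanti i))
      exact ⟨i', fun t' ht' => by rw [ht'.unique ht, hi']⟩
    · exact ⟨i, fun t ht => absurd ⟨t, ht⟩ h⟩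
  choose τ hτ using hτ
  refine exists_basis_cohomology b D hD c hc L τ ?_ ?_ ?_ ?_ ?_ ?_
  · intro i
    have hi : EvenRows (rows (c i)) := (hc' _).mp ⟨i, rfl⟩
    obtain ⟨J, a, v, hD', -, ha, -, hv, -⟩ := hDb (c i)
    rw [← Submodule.mem_bot k, hD']
    exact sum_mem fun j hj => hterm ha (hv j hj) fun hodd h => absurd h (hi.not_box hodd)
  · intro f i
    have hi : EvenRows (rows (c i)) := (hc' _).mp ⟨i, rfl⟩
    -- It suffices to test basis vectors: their differentials involve only partitions obtained by
    -- adding a box of odd content.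
    have : b.coord (c i) ∘ₗ D = 0 := b.ext fun i' => by
      obtain ⟨J, a, v, hD', -, ha, -, hv, hv'⟩ := hDb i'
      rw [LinearMap.comp_apply, LinearMap.zero_apply, ← LinearMap.mem_ker, hD']
      refine sum_mem fun j hj => hterm ha (hv j hj) fun hodd h => ?_
      obtain ⟨i'', hi'', hvj⟩ := hv' j hj h
      rw [LinearMap.mem_ker, hvj, Module.Basis.coord_apply, Module.Basis.repr_self,
        Finsupp.single_apply, if_neg]
      intro he
      rw [he] at hi''
      rw [hi''] at hi
      exact not_evenRows_add_box (hanti i') hodd hi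
    exact LinearMap.congr_fun this f
  · rintro i ⟨t, ht⟩
    obtain ⟨J, a, v, hD', hJ, ha, hu, hv, hv'⟩ := hDb i
    have hne : rows i (2 * t) ≠ 0 := fun h0 => by
      have := ht.2
      rw [h0] at this
      simp at this
    have hodd : Odd (rows i (2 * t) + 2 * t) := ht.2.add_even (even_two_mul t)
    refine ⟨a (2 * t), hu _ hodd, ?_⟩
    obtain ⟨i', hi', hvi⟩ := hv' _ (hJ _ hne) (ht.antitone (hanti i))
    have : τ i = i' := hinj (by rw [hτ i t ht, hi'])
    rw [this, ← hvi, hD', ← Finset.add_sum_erase _ _ (hJ _ hne), add_sub_cancel_left]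
    refine sum_mem fun j hj => ?_
    rw [Finset.mem_erase] at hj
    refine hterm ha (hv j hj.2) fun hodd h => ?_
    obtain ⟨i'', hi'', hvj⟩ := hv' j hj.2 h
    rw [hvj]
    refine Submodule.subset_span ⟨i'', ⟨t, ?_⟩, rfl⟩
    rw [hi'']
    exact ht.add_box hodd h hj.1
  · rintro i ⟨t, ht⟩ j ⟨s, hs⟩ hij
    have h1 := hτ i t ht
    have h2 := hτ j s hs
    rw [hij, h2] at h1
    exact (hinj (hs.eq_of_add_eq (hanti j) (hanti i) ht h1)).symm
  · rintro i ⟨t, ht⟩ ⟨s, hs⟩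
    rw [hτ i t ht] at hs
    exact ht.not_isLowAt_add (hanti i) s hs
  · intro i
    rcases evenRows_or (hanti i) with h | h | ⟨s, t, hs, ht, h⟩
    · exact Or.inl ((hc' i).mpr h)
    · exact Or.inr (Or.inl h)
    · right; right
      obtain ⟨i', rfl⟩ := hsub i s hs fun j => by rw [h]; simp
      exact ⟨i', ⟨t, ht⟩, hinj (by rw [hτ i' t ht, h])⟩

end Cohomology

/-! ### Young diagrams and row lengths -/

section Young

theorem colLen_le_iff {lam : YoungDiagram} {n : ℕ} :
    lam.colLen 0 ≤ n ↔ ∀ j, n ≤ j → lam.rowLen j = 0 := by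
  have key : ∀ j, lam.rowLen j = 0 ↔ lam.colLen 0 ≤ j := fun j => by
    rw [← not_iff_not, not_le, ← YoungDiagram.mem_iff_lt_colLen, YoungDiagram.mem_iff_lt_rowLen]
    omega
  constructor
  · intro h j hj
    exact (key j).mpr (h.trans hj)
  · intro h
    exact (key n).mp (h n le_rfl)

theorem rowLen_injective : Function.Injective YoungDiagram.rowLen := by
  intro lam mu h
  ext ⟨i, j⟩
  rw [YoungDiagram.mem_cells, YoungDiagram.mem_cells, YoungDiagram.mem_iff_lt_rowLen,
    YoungDiagram.mem_iff_lt_rowLen, h]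

theorem rowLen_antitone (lam : YoungDiagram) : Antitone lam.rowLen :=
  fun _ _ h => lam.rowLen_anti _ _ h

theorem exists_rowLen_eq {r : ℕ → ℕ} (hr : Antitone r) {n : ℕ} (hn : ∀ j, n ≤ j → r j = 0) :
    ∃ lam : YoungDiagram, lam.rowLen = r := by
  refine ⟨⟨(Finset.range n ×ˢ Finset.range (r 0)).filter (fun c => c.2 < r c.1), ?_⟩, ?_⟩
  · rintro ⟨i, j⟩ ⟨i', j'⟩ ⟨h1, h2⟩ h
    simp only [Finset.coe_filter, Finset.mem_product, Finset.mem_range, Set.mem_ofPred_eq] at h ⊢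
    dsimp only at h1 h2
    have := hr h1
    omega
  · ext i
    refine eq_of_forall_lt_iff fun j => ?_
    rw [← YoungDiagram.mem_iff_lt_rowLen, ← YoungDiagram.mem_cells]
    simp only [Finset.mem_filter, Finset.mem_product, Finset.mem_range]
    have := hr (Nat.zero_le i)
    constructor
    · exact fun h => h.2
    · intro h
      refine ⟨⟨?_, by omega⟩, h⟩
      by_contra! h'
      rw [hn i h'] at h
      omega

theorem even_card_filter_of_pairs {r : ℕ → ℕ} {t : ℕ} (h : ∀ i < t, r (2 * i) = r (2 * i + 1))
    (p : ℕ) : Even ((Finset.range (2 * t)).filter fun j => r j = p).card := by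
  induction t with
  | zero => simp
  | succ t ih =>
    have h1 := h t (Nat.lt_succ_self t)
    rw [show 2 * (t + 1) = 2 * t + 1 + 1 by ring, Finset.range_add_one, Finset.filter_insert,
      Finset.range_add_one, Finset.filter_insert, ← h1]
    have ih' := ih fun i hi => h i (by omega)
    split_ifs with hp
    · rw [Finset.card_insert_of_notMem (by simp), Finset.card_insert_of_notMem (by simp), add_assoc]
      exact ih'.add (by decide)
    · exact ih'

theorem count_rowLens (lam : YoungDiagram) (p : ℕ) : lam.rowLens.count p =
    ((Finset.range (lam.colLen 0)).filter fun j => lam.rowLen j = p).card := by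
  rw [YoungDiagram.rowLens, List.count_eq_countP, List.countP_map, List.countP_eq_length_filter,
    Finset.card_def, Finset.filter_val, Finset.range_val, Multiset.range, Multiset.filter_coe,
    Multiset.coe_card]
  congr 1

/-- Multiplicities are counted over row pairs. At a first unequal pair, row 2i is the last row of
its length and follows complete pairs, so that length occurs an odd number of times. -/
theorem isLima_iff {lam : YoungDiagram} : IsLima lam ↔ EvenRows lam.rowLen := by
  have hlt : ∀ j, j < lam.colLen 0 ↔ lam.rowLen j ≠ 0 := fun j => by
    rw [← YoungDiagram.mem_iff_lt_colLen, YoungDiagram.mem_iff_lt_rowLen]; omega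
  have hmem : ∀ p, p ∈ lam.rowLens ↔ ∃ j, lam.rowLen j ≠ 0 ∧ lam.rowLen j = p := fun p => by
    simp [YoungDiagram.rowLens, hlt]
  have hcount : ∀ p N, p ≠ 0 → (∀ j, N ≤ j → lam.rowLen j ≠ p) → lam.rowLens.count p =
      ((Finset.range N).filter fun j => lam.rowLen j = p).card := by
    intro p N hp hN
    rw [count_rowLens]
    congr 1
    ext j
    simp only [Finset.mem_filter, Finset.mem_range, hlt]
    constructor
    · rintro ⟨h1, h2⟩
      exact ⟨by by_contra! h; exact hN j h h2, h2⟩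
    · rintro ⟨h1, h2⟩
      exact ⟨by rw [h2]; exact hp, h2⟩
  have heven : (∀ p ∈ lam.rowLens, Even p) ↔ ∀ j, Even (lam.rowLen j) := by
    constructor
    · intro h j
      by_cases hj : lam.rowLen j = 0
      · rw [hj]; exact Even.zero
      · exact h _ ((hmem _).mpr ⟨j, hj, rfl⟩)
    · intro h p hp
      obtain ⟨j, -, rfl⟩ := (hmem p).mp hp
      exact h j
  rw [IsLima, heven]
  constructor
  · rintro ⟨h1, h2⟩
    suffices ∀ i, lam.rowLen (2 * i) = lam.rowLen (2 * i + 1) from fun i => ⟨h1 _, this i⟩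
    intro i
    induction i using Nat.strong_induction_on with
    | _ i ih =>
    by_contra hne
    have hle := rowLen_antitone lam (Nat.le_succ (2 * i))
    simp only [Nat.succ_eq_add_one] at hle
    have h3 := h2 (lam.rowLen (2 * i))
    rw [hcount _ (2 * i + 1) (by omega) fun j hj h => by
      have := rowLen_antitone lam hj
      omega, Finset.range_add_one, Finset.filter_insert, if_pos rfl,
      Finset.card_insert_of_notMem (by simp), Nat.even_add_one] at h3
    exact h3 (even_card_filter_of_pairs ih _)
  · intro h
    refine ⟨fun j => ?_, fun p => ?_⟩
    · rcases Nat.even_or_odd' j with ⟨t, rfl | rfl⟩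
      · exact (h t).1
      · rw [← (h t).2]; exact (h t).1
    · by_cases hp : p = 0
      · have : p ∉ lam.rowLens := fun h' => by
          obtain ⟨j, hj, hj'⟩ := (hmem p).mp h'
          exact hj (hj'.trans hp)
        rw [List.count_eq_zero_of_not_mem this]
        exact Even.zero
      -- An even range containing all nonempty rows; the padding rows are empty and do not affect
      -- the count of p ≠ 0.
      · rw [hcount p (2 * lam.colLen 0) hp fun j hj h' => by
          have := (hlt j).mpr (by rw [h']; exact hp)
          omega]
        exact even_card_filter_of_pairs (fun i _ => (h i).2) p

/-- The number of boxes. -/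
def boxes (lam : YoungDiagram) : ℕ := ∑ j ∈ Finset.range (lam.colLen 0), lam.rowLen j

theorem sum_rowLen {lam : YoungDiagram} {n : ℕ} (h : lam.colLen 0 ≤ n) :
    ∑ j ∈ Finset.range n, lam.rowLen j = boxes lam := by
  refine (Finset.sum_subset (Finset.range_subset_range.mpr h) fun j _ hj => ?_).symm
  exact colLen_le_iff.mp le_rfl j (by simpa using hj)

theorem colLen_le_boxes (lam : YoungDiagram) : lam.colLen 0 ≤ boxes lam := by
  have : ∀ j ∈ Finset.range (lam.colLen 0), 1 ≤ lam.rowLen j := fun j hj => by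
    rw [Finset.mem_range, ← YoungDiagram.mem_iff_lt_colLen, YoungDiagram.mem_iff_lt_rowLen] at hj
    omega
  simpa [boxes] using Finset.card_nsmul_le_sum _ _ 1 this

theorem colLen_add_box {lam mu : YoungDiagram} {j n : ℕ} (h : mu.rowLen = lam.rowLen + ind {j})
    (hn : lam.colLen 0 ≤ n) (hj : j < n) : mu.colLen 0 ≤ n := by
  rw [colLen_le_iff] at *
  intro l hl
  rw [h, Pi.add_apply, hn l hl, ind_singleton, if_neg (by omega)]

theorem boxes_add_box {lam mu : YoungDiagram} {j : ℕ} (h : mu.rowLen = lam.rowLen + ind {j}) :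
    boxes mu = boxes lam + 1 := by
  have h1 : lam.colLen 0 ≤ max (lam.colLen 0) (j + 1) := le_max_left _ _
  have h2 : j < max (lam.colLen 0) (j + 1) := lt_of_lt_of_le (Nat.lt_succ_self j) (le_max_right _ _)
  rw [← sum_rowLen (colLen_add_box h h1 h2), ← sum_rowLen h1, h]
  simp only [Pi.add_apply, Finset.sum_add_distrib]
  rw [sum_range_ind (by simp [h2])]
  simp

theorem exists_add_box {lam : YoungDiagram} {j : ℕ} (h : Antitone (lam.rowLen + ind {j})) :
    ∃ mu : YoungDiagram, mu.rowLen = lam.rowLen + ind {j} := by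
  refine exists_rowLen_eq h (n := lam.colLen 0 + j + 1) fun l hl => ?_
  rw [Pi.add_apply, colLen_le_iff.mp le_rfl l (by omega), ind_singleton, if_neg (by omega)]

theorem exists_rowLen_le {lam : YoungDiagram} {s : ℕ → ℕ} (hs : Antitone s)
    (h : ∀ j, s j ≤ lam.rowLen j) : ∃ mu : YoungDiagram, mu.rowLen = s ∧
      ∀ n, lam.colLen 0 ≤ n → mu.colLen 0 ≤ n := by
  have h1 : ∀ n, lam.colLen 0 ≤ n → ∀ j, n ≤ j → s j = 0 := fun n hn j hj =>
    Nat.le_zero.mp ((h j).trans_eq (colLen_le_iff.mp hn j hj))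
  obtain ⟨mu, rfl⟩ := exists_rowLen_eq hs (h1 _ le_rfl)
  exact ⟨mu, rfl, fun n hn => colLen_le_iff.mpr (h1 n hn)⟩

end Young

/-! ### Expansions in odd Schur polynomials -/

section Expand

variable {k : Type*} [CommRing k] {n : ℕ}

theorem schurS_sum_eq_zero {s : Finset YoungDiagram} (hs : ∀ lam ∈ s, lam.colLen 0 ≤ n)
    {a : YoungDiagram → k} (h : ∑ lam ∈ s, a lam • schurS k n lam.rowLen = 0) :
    ∀ lam ∈ s, a lam = 0 := by
  have hli : LinearIndependent k (fun lam : s => schurS k n lam.1.rowLen) :=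
    linearIndependent_schurS (rows := fun lam : s => lam.1.rowLen)
      (fun _ _ h => Subtype.ext (rowLen_injective h)) (fun lam => rowLen_antitone _)
      (fun lam => colLen_le_iff.mp (hs _ lam.2))
  rw [linearIndependent_iff'] at hli
  rw [← Finset.sum_coe_sort] at h
  exact fun lam hlam => hli Finset.univ (fun lam => a lam) h ⟨lam, hlam⟩ (Finset.mem_univ _)

theorem exists_eq_sum_schurS {f : OPol k n} (hf : f ∈ OLam k n) :
    ∃ (s : Finset YoungDiagram) (a : YoungDiagram → k), (∀ lam ∈ s, lam.colLen 0 ≤ n) ∧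
      f = ∑ lam ∈ s, a lam • schurS k n lam.rowLen := by
  have h1 : schurS k n '' {r | Antitone r ∧ ∀ j, n ≤ j → r j = 0} ⊆
      (fun lam : YoungDiagram => schurS k n lam.rowLen) '' {lam | lam.colLen 0 ≤ n} := by
    rintro _ ⟨r, ⟨hr, hz⟩, rfl⟩
    obtain ⟨lam, rfl⟩ := exists_rowLen_eq hr hz
    exact ⟨lam, colLen_le_iff.mpr hz, rfl⟩
  have h2 := Submodule.span_mono (R := k) h1 (mem_span_schurS hf)
  rw [Finsupp.mem_span_image_iff_linearCombination] at h2
  obtain ⟨l, hl, rfl⟩ := h2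
  exact ⟨l.support, l, fun lam h => hl h, rfl⟩

open Polynomial in
/-- The homomorphism recording the degree as a power of a central variable. -/
noncomputable def degHom : OPol k n →ₐ[k] (OPol k n)[X] :=
  lift (fun i => C (x i) * X) fun i j h => by
    rw [mul_assoc, ← mul_assoc X, X_mul_C, mul_assoc, ← mul_assoc (C (x i)), ← C_mul,
      mul_assoc (C (x j)), ← mul_assoc X (C (x i)), X_mul_C, mul_assoc, ← mul_assoc (C (x j)),
      ← C_mul, ← add_mul, ← C_add, x_anticomm h, C_0, zero_mul]

open Polynomial in
theorem degHom_of_mem {m : ℕ} {f : OPol k n} (hf : f ∈ homog k n m) :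
    degHom f = C f * X ^ m := by
  induction m generalizing f with
  | zero =>
    rw [homog, pow_zero] at hf
    obtain ⟨r, rfl⟩ := Submodule.mem_one.mp hf
    rw [AlgHom.commutes, pow_zero, mul_one]
    rfl
  | succ m ih =>
    rw [homog, pow_succ] at hf
    induction hf using Submodule.mul_induction_on' with
    | add f _ g _ hf hg => rw [map_add, hf, hg, C_add, add_mul]
    | mem_mul_mem f hf g hg =>
      have hg' : degHom g = C g * X := by
        induction hg using Submodule.span_induction with
        | mem g hg =>
          obtain ⟨i, rfl⟩ := hg
          rw [degHom, lift_x]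
        | zero => simp
        | add f g _ _ hf hg => rw [map_add, hf, hg, C_add, add_mul]
        | smul r f _ hf => rw [map_smul, hf, ← smul_C, smul_mul_assoc]
      rw [map_mul, ih hf, hg', mul_assoc, ← mul_assoc (X ^ m), X_pow_mul_C, C_mul, pow_succ]
      simp only [mul_assoc]

theorem schurS_rowLen_mem_homog {lam : YoungDiagram} (h : lam.colLen 0 ≤ n) :
    schurS k n lam.rowLen ∈ homog k n (boxes lam) := by
  rw [← sum_rowLen h]
  exact schurS_mem_homog (rowLen_antitone lam) (colLen_le_iff.mp h)

theorem schurS_rowLen_mem {lam : YoungDiagram} (h : lam.colLen 0 ≤ n) :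
    schurS k n lam.rowLen ∈ OLam k n :=
  schurS_mem_OLam (rowLen_antitone lam) (colLen_le_iff.mp h)

-- The coefficient of `degHom` in degree m discards every Schur polynomial of another degree from an
-- arbitrary expansion.
open Polynomial in
theorem exists_eq_sum_schurS_homog {f : OPol k n} (hf : f ∈ OLam k n) {m : ℕ}
    (hm : f ∈ homog k n m) :
    ∃ (s : Finset YoungDiagram) (a : YoungDiagram → k),
      (∀ lam ∈ s, lam.colLen 0 ≤ n ∧ boxes lam = m) ∧
      f = ∑ lam ∈ s, a lam • schurS k n lam.rowLen := by
  obtain ⟨s, a, hs, hfs⟩ := exists_eq_sum_schurS hf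
  refine ⟨s.filter fun lam => boxes lam = m, a, fun lam h => ?_, ?_⟩
  · rw [Finset.mem_filter] at h
    exact ⟨hs lam h.1, h.2⟩
  · have h1 : f = (degHom f).coeff m := by rw [degHom_of_mem hm]; simp
    rw [h1, hfs, map_sum, finsetSum_coeff, Finset.sum_filter]
    refine Finset.sum_congr rfl fun lam hlam => ?_
    rw [map_smul, coeff_smul, degHom_of_mem (schurS_rowLen_mem_homog (hs lam hlam)),
      coeff_C_mul_X_pow]
    by_cases h : boxes lam = m
    · rw [if_pos h.symm, if_pos h]
    · rw [if_neg (Ne.symm h), if_neg h, smul_zero]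

end Expand

/-! ### Cohomology in finitely many variables -/

section FiniteVariables

variable (k : Type*) [CommRing k] (n : ℕ)

theorem exists_schurBasis : ∃ b : Module.Basis {lam : YoungDiagram // lam.colLen 0 ≤ n} k (OLam k n),
    ∀ lam, (b lam : OPol k n) = schurS k n lam.1.rowLen := by
  let v : {lam : YoungDiagram // lam.colLen 0 ≤ n} → OLam k n :=
    fun lam => ⟨schurS k n lam.1.rowLen, schurS_rowLen_mem lam.2⟩
  have hli : LinearIndependent k v := by
    refine LinearIndependent.of_comp (OLam k n).val.toLinearMap ?_
    exact linearIndependent_schurS (rows := fun lam : {lam : YoungDiagram // lam.colLen 0 ≤ n} =>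
      lam.1.rowLen) (fun _ _ h => Subtype.ext (rowLen_injective h)) (fun lam => rowLen_antitone _)
      (fun lam => colLen_le_iff.mp lam.2)
  have hspan : ⊤ ≤ Submodule.span k (Set.range v) := by
    rintro ⟨f, hf⟩ -
    obtain ⟨s, a, hs, hfs⟩ := exists_eq_sum_schurS hf
    have : (⟨f, hf⟩ : OLam k n) = ∑ lam : s, a lam.1 • v ⟨lam.1, hs _ lam.2⟩ := by
      apply Subtype.ext
      rw [AddSubmonoidClass.coe_finsetSum]
      simp only [v, SetLike.val_smul]
      rw [hfs, ← Finset.sum_coe_sort]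
    rw [this]
    exact sum_mem fun lam _ => Submodule.smul_mem _ _ (Submodule.subset_span ⟨_, rfl⟩)
  exact ⟨Module.Basis.mk hli hspan, fun lam => by rw [Module.Basis.mk_apply]⟩

theorem exists_basis_cohomology_OLam :
    ∃ b : Module.Basis {lam : YoungDiagram // IsLima lam ∧ lam.colLen 0 ≤ n} k
        (Cohomology (dOLam k n)),
      ∀ lam, ∃ z : LinearMap.ker (dOLam k n),
        ((z : OLam k n) : OPol k n) = schur k n lam.1 ∧ b lam = cohClass (dOLam k n) z := by
  classical
  obtain ⟨b, hb⟩ := exists_schurBasis k n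
  obtain ⟨B, hB⟩ := exists_basis_of_boxes b (dOLam k n) dOLam_dOLam
    (fun lam => lam.1.rowLen) (fun _ _ h => Subtype.ext (rowLen_injective h))
    (fun lam => rowLen_antitone lam.1)
    (fun lam s hs hle => by
      obtain ⟨mu, rfl, hmu⟩ := exists_rowLen_le hs hle
      exact ⟨⟨mu, hmu n lam.2⟩, rfl⟩)
    (fun lam => by
      obtain ⟨c, hc0, hc1, hc2⟩ := d_schurS (k := k) (n := n) lam.1.rowLen
      have hex : ∀ j, ∃ v : OLam k n, (j < n → (v : OPol k n) =
          schurS k n (lam.1.rowLen + ind {j})) ∧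
          (j < n → ¬ Antitone (lam.1.rowLen + ind {j}) → v = 0) ∧
          (j < n → Antitone (lam.1.rowLen + ind {j}) →
            ∃ mu : {lam : YoungDiagram // lam.colLen 0 ≤ n},
              mu.1.rowLen = lam.1.rowLen + ind {j} ∧ v = b mu) := by
        intro j
        by_cases hj : j < n
        · by_cases h : Antitone (lam.1.rowLen + ind {j})
          · obtain ⟨mu, hmu⟩ := exists_add_box h
            refine ⟨b ⟨mu, colLen_add_box hmu lam.2 hj⟩, fun _ => ?_, fun _ h' => absurd h h',
              fun _ _ => ⟨⟨mu, colLen_add_box hmu lam.2 hj⟩, hmu, rfl⟩⟩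
            rw [hb, hmu]
          · refine ⟨0, fun _ => ?_, fun _ _ => rfl, fun _ h' => absurd h' h⟩
            rw [schurS_add_ind_eq_zero (rowLen_antitone _) (by simpa using hj) h]
            rfl
        · exact ⟨0, fun h => absurd h hj, fun h => absurd h hj, fun h => absurd h hj⟩
      choose v hv1 hv2 hv3 using hex
      refine ⟨Finset.range n, c, v, ?_, fun j hj => ?_, hc0, hc1,
        fun j hj => hv2 j (Finset.mem_range.mp hj), fun j hj => hv3 j (Finset.mem_range.mp hj)⟩
      · apply Subtype.ext
        change d (b lam : OPol k n) = _
        rw [hb, hc2, AddSubmonoidClass.coe_finsetSum]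
        refine Finset.sum_congr rfl fun j hj => ?_
        rw [SetLike.val_smul, hv1 j (Finset.mem_range.mp hj)]
      · rw [Finset.mem_range]
        by_contra! h
        exact hj (colLen_le_iff.mp lam.2 j h))
    (fun lam : {lam : YoungDiagram // IsLima lam ∧ lam.colLen 0 ≤ n} =>
      (⟨lam.1, lam.2.2⟩ : {lam : YoungDiagram // lam.colLen 0 ≤ n}))
    (fun lam mu h => Subtype.ext (congrArg (fun l => l.1) h))
    (fun lam => by
      rw [← isLima_iff]
      exact ⟨fun ⟨mu, h⟩ => h ▸ mu.2.1, fun h => ⟨⟨lam.1, h, lam.2⟩, rfl⟩⟩)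
  refine ⟨B, fun lam => ?_⟩
  obtain ⟨z, hz, hz'⟩ := hB lam
  exact ⟨z, by rw [hz, hb, schur_eq], hz'⟩

end FiniteVariables

/-! ### The inverse limit -/

section Limit

variable {k : Type*} [CommRing k]

theorem schurSeq_apply {lam : YoungDiagram} {n : ℕ} (h : lam.colLen 0 ≤ n) :
    schurSeq k lam n = schurS k n lam.rowLen := by
  rw [schurSeq, if_pos h, schur_eq]

theorem schurSeq_mem (lam : YoungDiagram) : schurSeq k lam ∈ OLamLimDeg k (boxes lam) := by
  refine ⟨fun n => ?_, fun n => ?_, fun n => ?_⟩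
  · by_cases h : lam.colLen 0 ≤ n
    · rw [schurSeq_apply h]; exact schurS_rowLen_mem h
    · rw [schurSeq, if_neg h]; exact zero_mem _
  · by_cases h : lam.colLen 0 ≤ n
    · rw [schurSeq_apply h]; exact schurS_rowLen_mem_homog h
    · rw [schurSeq, if_neg h]; exact zero_mem _
  · by_cases h : lam.colLen 0 ≤ n + 1
    · rw [schurSeq_apply h, proj_schurS (rowLen_antitone lam) (colLen_le_iff.mp h)]
      by_cases h' : lam.colLen 0 ≤ n
      · rw [if_pos (colLen_le_iff.mp h' n le_rfl), schurSeq_apply h']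
      · have h0 : lam.rowLen n ≠ 0 := fun h0 => h' <| colLen_le_iff.mpr fun j hj =>
          Nat.le_zero.mp ((rowLen_antitone lam hj).trans_eq h0)
        rw [if_neg h0, schurSeq, if_neg h']
    · rw [schurSeq, if_neg h, map_zero, schurSeq, if_neg (by omega)]

/-- A partition of m has at most m rows, so from m variables on the projections lose no Schur
polynomial in degree m. Smaller components are projections of the m-th one. Identities in the limit
can therefore be checked in a single number of variables. -/
theorem eq_zero_of_apply_eq_zero {m : ℕ} {f : ∀ n, OPol k n} (hf : f ∈ OLamLimDeg k m)
    (h : f m = 0) : f = 0 := by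
  have hup : ∀ l, f (m + l) = 0 := by
    intro l
    induction l with
    | zero => exact h
    | succ l ih =>
      obtain ⟨s, a, hs, hfs⟩ := exists_eq_sum_schurS_homog (hf.1 (m + l + 1)) (hf.2.1 (m + l + 1))
      have hcol : ∀ lam ∈ s, lam.colLen 0 ≤ m + l := fun lam hlam =>
        (colLen_le_boxes lam).trans (by rw [(hs lam hlam).2]; omega)
      have h0 : ∑ lam ∈ s, a lam • schurS k (m + l) lam.rowLen = 0 := by
        rw [← ih, ← hf.2.2 (m + l), hfs, map_sum]
        refine Finset.sum_congr rfl fun lam hlam => ?_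
        rw [map_smul, proj_schurS (rowLen_antitone lam) (colLen_le_iff.mp (hs lam hlam).1),
          if_pos (colLen_le_iff.mp (hcol lam hlam) _ le_rfl)]
      rw [← add_assoc, hfs]
      refine Finset.sum_eq_zero fun lam hlam => ?_
      rw [schurS_sum_eq_zero hcol h0 lam hlam, zero_smul]
  have hdown : ∀ l n, f (n + l) = 0 → f n = 0 := by
    intro l
    induction l with
    | zero => exact fun n hn => hn
    | succ l ih => exact fun n hn => ih n ((hf.2.2 (n + l)).symm.trans
        ((congrArg (proj (n + l)) hn).trans (map_zero _)))
  funext n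
  exact hdown m n (by rw [add_comm]; exact hup n)

theorem mem_span_schurSeq {f : ∀ n, OPol k n} (hf : f ∈ ⨆ m, OLamLimDeg k m) :
    f ∈ Submodule.span k (Set.range (schurSeq k)) := by
  induction hf using Submodule.iSup_induction' with
  | zero => exact zero_mem _
  | add f g _ _ hf hg => exact add_mem hf hg
  | mem m f hf =>
    obtain ⟨s, a, hs, hfs⟩ := exists_eq_sum_schurS_homog (hf.1 m) (hf.2.1 m)
    have hmem : ∑ lam ∈ s, a lam • schurSeq k lam ∈ OLamLimDeg k m :=
      sum_mem fun lam hlam => Submodule.smul_mem _ _ ((hs lam hlam).2 ▸ schurSeq_mem lam)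
    have h0 : f - ∑ lam ∈ s, a lam • schurSeq k lam = 0 := by
      refine eq_zero_of_apply_eq_zero (sub_mem hf hmem) ?_
      rw [Pi.sub_apply, Finset.sum_apply, sub_eq_zero, hfs]
      exact Finset.sum_congr rfl fun lam hlam => by
        rw [Pi.smul_apply, schurSeq_apply (hs lam hlam).1]
    rw [sub_eq_zero.mp h0]
    exact sum_mem fun lam _ => Submodule.smul_mem _ _ (Submodule.subset_span ⟨lam, rfl⟩)

/-- A finite relation is tested in enough variables for all the partitions involved. -/
theorem linearIndependent_schurSeq : LinearIndependent k (schurSeq k) := by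
  rw [linearIndependent_iff']
  intro s a h
  have hcol : ∀ lam ∈ s, lam.colLen 0 ≤ s.sup fun lam => lam.colLen 0 := fun lam hlam =>
    Finset.le_sup (f := fun lam : YoungDiagram => lam.colLen 0) hlam
  refine schurS_sum_eq_zero hcol ?_
  rw [← Pi.zero_apply (M := OPol k) (s.sup fun lam => lam.colLen 0), ← h, Finset.sum_apply]
  exact Finset.sum_congr rfl fun lam hlam => by
    rw [Pi.smul_apply, schurSeq_apply (hcol lam hlam)]

theorem dSeq_mem_deg {m : ℕ} {f : ∀ n, OPol k n} (hf : f ∈ OLamLimDeg k m) :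
    dSeq k f ∈ OLamLimDeg k (m + 1) :=
  ⟨fun n => d_mem (hf.1 n), fun n => d_homog (hf.2.1 n),
    fun n => by simp [dSeq, proj_d, hf.2.2 n]⟩

variable (k)

theorem exists_schurSeqBasis : ∃ b : Module.Basis YoungDiagram k (OLamLim k),
    ∀ lam, (b lam : ∀ n, OPol k n) = schurSeq k lam := by
  let v : YoungDiagram → OLamLim k :=
    fun lam => ⟨schurSeq k lam, Submodule.mem_iSup_of_mem _ (schurSeq_mem lam)⟩
  have hli : LinearIndependent k v :=
    LinearIndependent.of_comp (OLamLim k).val.toLinearMap linearIndependent_schurSeq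
  have hspan : ⊤ ≤ Submodule.span k (Set.range v) := by
    rintro ⟨f, hf⟩ -
    have h := mem_span_schurSeq hf
    have hv : Set.range (schurSeq k) = (OLamLim k).val.toLinearMap '' Set.range v := by
      rw [← Set.range_comp]; rfl
    rw [hv, Submodule.span_image] at h
    obtain ⟨g, hg, hgf⟩ := h
    have : g = ⟨f, hf⟩ := Subtype.ext hgf
    exact this ▸ hg
  exact ⟨Module.Basis.mk hli hspan, fun lam => by rw [Module.Basis.mk_apply]⟩

theorem exists_basis_cohomology_OLamLim :
    ∃ b : Module.Basis {lam : YoungDiagram // IsLima lam} k (Cohomology (dOLamLim k)),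
      ∀ lam, ∃ z : LinearMap.ker (dOLamLim k),
        ((z : OLamLim k) : ∀ n, OPol k n) = schurSeq k lam.1 ∧
          b lam = cohClass (dOLamLim k) z := by
  classical
  obtain ⟨b, hb⟩ := exists_schurSeqBasis k
  obtain ⟨B, hB⟩ := exists_basis_of_boxes b (dOLamLim k) dOLamLim_dOLamLim
    YoungDiagram.rowLen rowLen_injective rowLen_antitone
    (fun lam s hs hle => by
      obtain ⟨mu, rfl, -⟩ := exists_rowLen_le hs hle
      exact ⟨mu, rfl⟩)
    (fun lam => by
      -- The differential has degree `boxes lam + 1`, so this number of variables determines it; it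
      -- also leaves room for a new row.
      obtain ⟨c, hc0, hc1, hc2⟩ := d_schurS (k := k) (n := boxes lam + 1) lam.rowLen
      have hex : ∀ j, ∃ v : OLamLim k, (v : ∀ n, OPol k n) ∈ OLamLimDeg k (boxes lam + 1) ∧
          (j < boxes lam + 1 → (v : ∀ n, OPol k n) (boxes lam + 1) =
            schurS k (boxes lam + 1) (lam.rowLen + ind {j})) ∧
          (¬ Antitone (lam.rowLen + ind {j}) → v = 0) ∧
          (Antitone (lam.rowLen + ind {j}) →
            ∃ mu : YoungDiagram, mu.rowLen = lam.rowLen + ind {j} ∧ v = b mu) := by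
        intro j
        by_cases h : Antitone (lam.rowLen + ind {j})
        · obtain ⟨mu, hmu⟩ := exists_add_box h
          refine ⟨b mu, ?_, fun _ => ?_, fun h' => absurd h h', fun _ => ⟨mu, hmu, rfl⟩⟩
          · rw [hb, ← boxes_add_box hmu]
            exact schurSeq_mem mu
          · rw [hb, schurSeq_apply ((colLen_le_boxes mu).trans_eq (boxes_add_box hmu)), hmu]
        · refine ⟨0, zero_mem _, fun hj => ?_, fun _ => rfl, fun h' => absurd h' h⟩
          rw [schurS_add_ind_eq_zero (rowLen_antitone _) (by simpa using hj) h]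
          rfl
      choose v hv0 hv1 hv2 hv3 using hex
      refine ⟨Finset.range (boxes lam + 1), c, v, ?_, fun j hj => ?_, hc0, hc1,
        fun j _ => hv2 j, fun j _ => hv3 j⟩
      · apply Subtype.ext
        change dSeq k (b lam : ∀ n, OPol k n) = _
        rw [hb, AddSubmonoidClass.coe_finsetSum, ← sub_eq_zero]
        refine eq_zero_of_apply_eq_zero (m := boxes lam + 1) (sub_mem
          (dSeq_mem_deg (schurSeq_mem lam)) (sum_mem fun j _ => Submodule.smul_mem _ _ (hv0 j))) ?_
        rw [Pi.sub_apply, sub_eq_zero, Finset.sum_apply]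
        change d (schurSeq k lam (boxes lam + 1)) = _
        rw [schurSeq_apply ((colLen_le_boxes lam).trans (Nat.le_succ _)), hc2]
        exact Finset.sum_congr rfl fun j hj => congrArg (c j • ·) (hv1 j (Finset.mem_range.mp hj)).symm
      · rw [Finset.mem_range]
        by_contra! h
        exact hj (colLen_le_iff.mp ((colLen_le_boxes lam).trans (Nat.le_succ _)) j h))
    (Subtype.val : {lam : YoungDiagram // IsLima lam} → YoungDiagram) Subtype.val_injective
    (fun lam => by
      rw [← isLima_iff]
      exact ⟨fun ⟨mu, h⟩ => h ▸ mu.2, fun h => ⟨⟨lam, h⟩, rfl⟩⟩)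
  refine ⟨B, fun lam => ?_⟩
  obtain ⟨z, hz, hz'⟩ := hB lam
  exact ⟨z, by rw [hz, hb], hz'⟩

end Limit

end OddSym

/-- The classes of the odd Schur functions of Lima partitions form a basis of the cohomology of
`OΛ`; those of Lima partitions with at most `n` rows form a basis of the cohomology of `OΛ_n`. -/
theorem mainTheorem9 (k : Type*) [CommRing k] :
    (∃ b : Module.Basis {lam : YoungDiagram // OddSym.IsLima lam} k
        (OddSym.Cohomology (OddSym.dOLamLim k)),
      ∀ lam, ∃ z : LinearMap.ker (OddSym.dOLamLim k),
        ((z : OddSym.OLamLim k) : ∀ n, OddSym.OPol k n) = OddSym.schurSeq k lam.1 ∧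
          b lam = OddSym.cohClass (OddSym.dOLamLim k) z) ∧
    ∀ n : ℕ, ∃ b : Module.Basis {lam : YoungDiagram // OddSym.IsLima lam ∧ lam.colLen 0 ≤ n} k
        (OddSym.Cohomology (OddSym.dOLam k n)),
      ∀ lam, ∃ z : LinearMap.ker (OddSym.dOLam k n),
        ((z : OddSym.OLam k n) : OddSym.OPol k n) = OddSym.schur k n lam.1 ∧
          b lam = OddSym.cohClass (OddSym.dOLam k n) z :=
  ⟨OddSym.exists_basis_cohomology_OLamLim k, fun n => OddSym.exists_basis_cohomology_OLam k n⟩
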